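/- Let $k\ge 0$ and $n\ge\max(1,2k)$ be integers. A diagram on $k$ columns is a set partition of the vertices $1,\dots,k$ (top row) and $1',\dots,k'$ (bottom row). The partition algebra $\mathbf P_k(n)$ is the complex algebra with basis the diagrams and product $d_1d_2=n^{\ell(d_1,d_2)}\,d_1\circ d_2$, where $d_1\circ d_2$ is obtained by placing $d_1$ above $d_2$ and deleting the $\ell(d_1,d_2)$ connected components that lie entirely in the middle row. A diagram is planar if its blocks do not cross inside the rectangle formed by its vertices. Let $\mathbf A_k\subseteq\mathbf P_k(n)$ be one of the following spans of planar diagrams: the Temperley–Lieb algebra $\mathbf{TL}_k(n)$ (all blocks of size $2$), the Motzkin algebra $\mathbf M_k(n)$ (all blocks of size $1$ or $2$), or the planar rook monoid algebra $\mathbf{PR}_k$ (each block has at most one top and at most one bottom vertex). Put $b=2$ for $\mathbf{TL}$ and $b=1$ otherwise, and let $\mathbf e$ be $\frac1n$ times the diagram on $b$ columns whose blocks are its top row and its bottom row. The rank of a diagram is the number of its blocks meeting both rows. For a partition $\lambda$ of $n$ let $\lambda^*$ be $\lambda$ with its first (largest) part removed. Let $\lambda\vdash n$ be such that $\lambda^*=[m]$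 (empty if $m=0$), where $m=k-b\ell$ for some integer $0\le \ell\le k/b$. Let $\mathbf A_k^\lambda$ be the $\mathbf A_k$-module indexed by $\lambda$, that is, the image of the left ideal $\mathbf A_k\mathbf e_m$, $\mathbf e_m=\mathbf 1_m\otimes\mathbf e^{\otimes (k-m)/b}$, in $\mathbf A_k/\mathbf J_{m-1}$, where $\mathbf J_{m-1}$ is spanned by the diagrams in $\mathbf A_k$ of rank less than $m$; let $\chi^\lambda_{\mathbf A_k}$ be its character. Here $\otimes$ is juxtaposition and $\mathbf 1_r$ is the identity diagram on $r$ columns. A symmetric $m$-diagram is a diagram of rank $m$ that equals its reflection in the horizontal axis and in which every block meeting both rows contains, with each of its vertices, the mirror image of that vertex. Then $\mathbf A_k^\lambda$ is irreducible, and for all integers $r,s\ge 0$ with $r+bs=k$, $$\chi^\lambda_{\mathbf A_k}(\mathbf 1_r\otimes \mathbf e^{\otimes s})=\mathsf F^{m,r}_{\mathbf A_k},$$ where $\mathsf F^{m,r}_{\mathbf A_k}$ is the number of symmetric $m$-diagrams in $\mathbf A_r$, and it is given by (a) $\displaystyle \mathsf F^{m,r}_{\mathbf{TL}_k(n)}=\binom{r}{\frac{r-m}{2}}-\binom{r}{\frac{r-m}{2}-1}$,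 (b) $\displaystyle \mathsf F^{m,r}_{\mathbf M_k(n)}=\sum_{t\ge 0}\binom{r}{m+2t}\left(\binom{m+2t}{t}-\binom{m+2t}{t-1}\right)$, (c) $\displaystyle \mathsf F^{m,r}_{\mathbf{PR}_k}=\binom rm$, with $\binom ab=0$ if $b<0$ or $b>a$. -/

import Mathlib

noncomputable section

namespace PlanarDiagram

/-! ## Set-partition diagrams -/

/-- Set-partition diagrams with `k` top vertices `Sum.inl i` (the vertices `1, …, k`) and `k` bottom
vertices `Sum.inr i` (the vertices `1', …, k'`): set partitions of the `2k` vertices, given as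
equivalence relations whose classes are the blocks. -/
abbrev Diagram (k : ℕ) := Setoid (Fin k ⊕ Fin k)

/-- The identity diagram, with blocks `{i, i'}`. -/
def idDiagram (k : ℕ) : Diagram k := Setoid.ker (Sum.elim id id)

/-- Reflection in the horizontal axis, `d ↦ dᵀ`. -/
def flip {k : ℕ} (d : Diagram k) : Diagram k := Setoid.comap Sum.swap d

/-- Inclusion of the top and middle rows into the three rows (top, middle, bottom). -/
def upper {k : ℕ} : Fin k ⊕ Fin k → Fin k ⊕ Fin k ⊕ Fin k
  | .inl i => .inl i
  | .inr i => .inr (.inl i)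

/-- Inclusion of the middle and bottom rows into the three rows. -/
def lower {k : ℕ} : Fin k ⊕ Fin k → Fin k ⊕ Fin k ⊕ Fin k
  | .inl i => .inr (.inl i)
  | .inr i => .inr (.inr i)

/-- Inclusion of the top and bottom rows into the three rows. -/
def outer {k : ℕ} : Fin k ⊕ Fin k → Fin k ⊕ Fin k ⊕ Fin k
  | .inl i => .inl i
  | .inr i => .inr (.inr i)

/-- The connected components of the picture with `d₁` placed above `d₂`, the bottom row of `d₁`
being identified with the top row of `d₂`. -/
def stack {k : ℕ} (d₁ d₂ : Diagram k) : Setoid (Fin k ⊕ Fin k ⊕ Fin k) :=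
  Relation.EqvGen.setoid fun x y =>
    (∃ a b, d₁ a b ∧ upper a = x ∧ upper b = y) ∨ (∃ a b, d₂ a b ∧ lower a = x ∧ lower b = y)

/-- Concatenation `d₁ ∘ d₂`. -/
def comp {k : ℕ} (d₁ d₂ : Diagram k) : Diagram k := Setoid.comap outer (stack d₁ d₂)

/-- `ℓ(d₁, d₂)`: the number of components lying entirely in the middle row. -/
def loops {k : ℕ} (d₁ d₂ : Diagram k) : ℕ :=
  Nat.card {c : Quotient (stack d₁ d₂) // ∀ x, Quotient.mk (stack d₁ d₂) (outer x) ≠ c}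

/-- The rank (propagating number): the number of blocks that meet both rows. -/
def rank {k : ℕ} (d : Diagram k) : ℕ :=
  Nat.card {c : Quotient d // (∃ i, Quotient.mk d (Sum.inl i) = c) ∧
    ∃ j, Quotient.mk d (Sum.inr j) = c}

/-- Position of a vertex on the boundary of the rectangle, read clockwise
`1, 2, …, k, k', …, 2', 1'`. -/
def position {k : ℕ} : Fin k ⊕ Fin k → ℕ
  | .inl i => i
  | .inr i => 2 * k - 1 - i

/-- A diagram is planar if its blocks do not cross inside the rectangle. -/
def IsPlanar {k : ℕ} (d : Diagram k) : Prop :=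
  ∀ a b c e, position a < position b → position b < position c → position c < position e →
    d a c → d b e → d a b

/-- A symmetric `m`-diagram: `dᵀ = d`, the rank is `m`, and every propagating block is connected to
its mirror image. -/
def IsSymmetricDiagram {k : ℕ} (m : ℕ) (d : Diagram k) : Prop :=
  flip d = d ∧ rank d = m ∧ ∀ i j, d (Sum.inl i) (Sum.inr j) → d (Sum.inl i) (Sum.inr i)

/-! ## Concatenation is associative, with additive loop counts

The proofs count two-colourings of the vertices that are constant on blocks. -/

/-- Indicator of the two-colourings of the top and bottom rows that are constant on blocks. -/
def colourMatrix {k : ℕ} (d : Diagram k) : Matrix (Fin k → Bool) (Fin k → Bool) ℕ :=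
  open scoped Classical in fun f g => if d ≤ Setoid.ker (Sum.elim f g) then 1 else 0

theorem card_extensions {X Y : Type} [Finite X] (J : Setoid X) (q : Y → X) (F : Y → Bool)
    (hF : Setoid.comap q J ≤ Setoid.ker F) :
    Nat.card {G : X → Bool // J ≤ Setoid.ker G ∧ G ∘ q = F} =
      2 ^ Nat.card {c : Quotient J // ∀ y, Quotient.mk J (q y) ≠ c} := by
  classical
  let e : {G : X → Bool // J ≤ Setoid.ker G ∧ G ∘ q = F} ≃
      ({c : Quotient J // ∀ y, Quotient.mk J (q y) ≠ c} → Bool) :=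
    { toFun := fun G c => Quotient.lift G.1 (fun a b h => G.2.1 h) c.1
      invFun := fun u => ⟨fun x => if h : ∃ y, Quotient.mk J (q y) = Quotient.mk J x then
          F h.choose else u ⟨Quotient.mk J x, by simpa using h⟩, by
          constructor
          · intro x x' hx
            have hx' : Quotient.mk J x = Quotient.mk J x' := Quotient.sound hx
            simp only [Setoid.ker_def, hx']
          · funext y
            have h : ∃ y', Quotient.mk J (q y') = Quotient.mk J (q y) := ⟨y, rfl⟩
            simp only [Function.comp, dif_pos h]
            have h' : J (q h.choose) (q y) := Quotient.exact h.choose_spec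
            exact hF h'⟩
      left_inv := by
        rintro ⟨G, hG, hq⟩
        apply Subtype.ext
        funext x
        by_cases h : ∃ y, Quotient.mk J (q y) = Quotient.mk J x
        · simp only [dif_pos h]
          rw [← hq]
          exact hG (Quotient.exact h.choose_spec)
        · simp only [dif_neg h]
          rfl
      right_inv := by
        intro u
        funext ⟨c, hc⟩
        induction c using Quotient.inductionOn with
        | h x =>
          have h : ¬ ∃ y, Quotient.mk J (q y) = Quotient.mk J x := by simpa using hc
          simp only [Quotient.lift_mk, dif_neg h] }
  rw [Nat.card_congr e, Nat.card_fun]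
  simp

theorem stack_le_ker {k : ℕ} (d₁ d₂ : Diagram k) (G : Fin k ⊕ Fin k ⊕ Fin k → Bool) :
    stack d₁ d₂ ≤ Setoid.ker G ↔
      d₁ ≤ Setoid.ker (G ∘ upper) ∧ d₂ ≤ Setoid.ker (G ∘ lower) := by
  constructor
  · intro h
    exact ⟨fun a b hab => h (Relation.EqvGen.rel _ _ (Or.inl ⟨a, b, hab, rfl, rfl⟩)),
      fun a b hab => h (Relation.EqvGen.rel _ _ (Or.inr ⟨a, b, hab, rfl, rfl⟩))⟩
  · rintro ⟨h₁, h₂⟩ x y hxy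
    induction hxy with
    | rel x y h =>
      rcases h with ⟨a, b, hab, rfl, rfl⟩ | ⟨a, b, hab, rfl, rfl⟩
      · exact h₁ hab
      · exact h₂ hab
    | refl x => rfl
    | symm x y _ ih => exact ih.symm
    | trans x y z _ _ ih₁ ih₂ => exact ih₁.trans ih₂

theorem colourMatrix_mul {k : ℕ} (d₁ d₂ : Diagram k) :
    colourMatrix d₁ * colourMatrix d₂ = 2 ^ loops d₁ d₂ • colourMatrix (comp d₁ d₂) := by
  classical
  ext f g
  have h₁ : (colourMatrix d₁ * colourMatrix d₂) f g =
      Nat.card {h : Fin k → Bool // d₁ ≤ Setoid.ker (Sum.elim f h) ∧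
        d₂ ≤ Setoid.ker (Sum.elim h g)} := by
    rw [Nat.card_eq_fintype_card, Fintype.card_subtype, Finset.card_filter, Matrix.mul_apply]
    refine Finset.sum_congr rfl fun h _ => ?_
    simp only [colourMatrix, ite_and]
    split_ifs <;> simp
  have hE : {h : Fin k → Bool // d₁ ≤ Setoid.ker (Sum.elim f h) ∧
        d₂ ≤ Setoid.ker (Sum.elim h g)} ≃
      {G : Fin k ⊕ Fin k ⊕ Fin k → Bool // stack d₁ d₂ ≤ Setoid.ker G ∧
        G ∘ outer = Sum.elim f g} :=
    { toFun := fun h => ⟨Sum.elim f (Sum.elim h.1 g), by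
        rw [stack_le_ker]
        refine ⟨?_, by funext x; cases x <;> rfl⟩
        convert h.2 using 3
        · funext x; cases x <;> rfl
        · funext x; cases x <;> rfl⟩
      invFun := fun G => ⟨fun i => G.1 (.inr (.inl i)), by
        have h := (stack_le_ker _ _ _).1 G.2.1
        have hf : ∀ x, G.1 (outer x) = Sum.elim f g x := fun x => congrFun G.2.2 x
        convert h using 3
        · funext x
          cases x with
          | inl i => exact (hf (.inl i)).symm
          | inr i => rfl
        · funext x
          cases x with
          | inl i => rfl
          | inr i => exact (hf (.inr i)).symm⟩
      left_inv := fun h => rfl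
      right_inv := by
        rintro ⟨G, hG, hq⟩
        apply Subtype.ext
        have hf : ∀ x, G (outer x) = Sum.elim f g x := fun x => congrFun hq x
        funext x
        rcases x with i | i | i
        · exact (hf (.inl i)).symm
        · rfl
        · exact (hf (.inr i)).symm }
  rw [h₁, Nat.card_congr hE]
  by_cases hF : comp d₁ d₂ ≤ Setoid.ker (Sum.elim f g)
  · rw [card_extensions _ _ _ hF]
    simp [colourMatrix, hF, loops]
  · have : IsEmpty {G : Fin k ⊕ Fin k ⊕ Fin k → Bool // stack d₁ d₂ ≤ Setoid.ker G ∧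
        G ∘ outer = Sum.elim f g} := by
      refine ⟨fun G => hF ?_⟩
      rw [← G.2.2]
      intro x y hxy
      exact G.2.1 hxy
    simp [colourMatrix, hF]

theorem colourMatrix_inj {k a b : ℕ} {d d' : Diagram k}
    (h : 2 ^ a • colourMatrix d = 2 ^ b • colourMatrix d') : a = b ∧ d = d' := by
  classical
  have hle : ∀ f g : Fin k → Bool, d ≤ Setoid.ker (Sum.elim f g) ↔ d' ≤ Setoid.ker (Sum.elim f g) := by
    intro f g
    have h2 := congrFun (congrFun h f) g
    simp only [Matrix.smul_apply, colourMatrix, smul_eq_mul] at h2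
    have ha : 2 ^ a ≠ 0 := by positivity
    have hb : 2 ^ b ≠ 0 := by positivity
    split_ifs at h2 <;> first | tauto | omega
  have hle' : ∀ F : Fin k ⊕ Fin k → Bool, d ≤ Setoid.ker F ↔ d' ≤ Setoid.ker F := by
    intro F
    have := hle (F ∘ Sum.inl) (F ∘ Sum.inr)
    rwa [Sum.elim_comp_inl_inr] at this
  constructor
  · have h2 := congrFun (congrFun h fun _ => true) fun _ => true
    have hd : ∀ e : Diagram k, e ≤ Setoid.ker (Sum.elim (fun _ => true) (fun _ => true)) := by
      intro e x y _
      cases x <;> cases y <;> rfl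
    simp only [Matrix.smul_apply, colourMatrix, smul_eq_mul, hd, if_true, mul_one] at h2
    exact Nat.pow_right_injective le_rfl h2
  · have key : ∀ e e' : Diagram k, (∀ F : Fin k ⊕ Fin k → Bool, e ≤ Setoid.ker F ↔
        e' ≤ Setoid.ker F) → e' ≤ e := by
      intro e e' hF x y hxy
      have := (hF (fun z => decide (e x z))).1 (by
        intro u v huv
        simp only [Setoid.ker_def]
        congr 1
        exact propext ⟨fun h => e.trans h huv, fun h => e.trans h (e.symm huv)⟩) hxy
      simp only [Setoid.ker_def] at this
      have hx : decide (e x x) = true := by simp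
      rw [hx] at this
      simpa using this.symm
    exact le_antisymm (key d' d fun F => (hle' F).symm) (key d d' hle')

theorem comp_assoc_loops {k : ℕ} (d₁ d₂ d₃ : Diagram k) :
    loops d₁ d₂ + loops (comp d₁ d₂) d₃ = loops d₂ d₃ + loops d₁ (comp d₂ d₃) ∧
      comp (comp d₁ d₂) d₃ = comp d₁ (comp d₂ d₃) := by
  apply colourMatrix_inj
  have h := mul_assoc (colourMatrix d₁) (colourMatrix d₂) (colourMatrix d₃)
  rw [colourMatrix_mul, colourMatrix_mul, smul_mul_assoc, mul_smul_comm, colourMatrix_mul,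
    colourMatrix_mul, smul_smul, smul_smul, ← pow_add, ← pow_add] at h
  exact h

theorem colourMatrix_id (k : ℕ) : colourMatrix (idDiagram k) = 1 := by
  classical
  ext f g
  simp only [colourMatrix, Matrix.one_apply]
  congr 1
  refine propext ⟨fun h => funext fun i => ?_, ?_⟩
  · exact h (show idDiagram k (.inl i) (.inr i) from rfl)
  · rintro rfl x y hxy
    have hxy' : Sum.elim id id x = Sum.elim id id y := hxy
    simp only [Setoid.ker_def]
    cases x <;> cases y <;> simp_all

theorem id_comp_loops {k : ℕ} (d : Diagram k) :
    loops (idDiagram k) d = 0 ∧ comp (idDiagram k) d = d := by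
  apply colourMatrix_inj
  rw [← colourMatrix_mul, colourMatrix_id]
  simp

theorem comp_id_loops {k : ℕ} (d : Diagram k) :
    loops d (idDiagram k) = 0 ∧ comp d (idDiagram k) = d := by
  apply colourMatrix_inj
  rw [← colourMatrix_mul, colourMatrix_id]
  simp

/-! ## The partition algebra -/

/-- The partition algebra `P_k(n)` over `ℂ`: the vector space with basis the diagrams. -/
def PartitionAlgebra (k n : ℕ) : Type := Diagram k →₀ ℂ

namespace PartitionAlgebra

variable {k n : ℕ}

instance : AddCommGroup (PartitionAlgebra k n) := inferInstanceAs (AddCommGroup (Diagram k →₀ ℂ))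

instance : Module ℂ (PartitionAlgebra k n) := inferInstanceAs (Module ℂ (Diagram k →₀ ℂ))

/-- The basis element of the partition algebra given by a diagram. -/
def diag (n : ℕ) (d : Diagram k) : PartitionAlgebra k n := Finsupp.single d 1

/-- The linear extension of a function on diagrams. -/
def extend {M : Type} [AddCommGroup M] [Module ℂ M] (φ : Diagram k → M) :
    PartitionAlgebra k n →ₗ[ℂ] M :=
  Finsupp.linearCombination ℂ φ

theorem extend_diag {M : Type} [AddCommGroup M] [Module ℂ M] (φ : Diagram k → M)
    (d : Diagram k) : extend φ (diag n d) = φ d :=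
  (Finsupp.linearCombination_single ℂ 1 d).trans (one_smul ℂ (φ d))

theorem hom_ext {M : Type} [AddCommGroup M] [Module ℂ M] {f g : PartitionAlgebra k n →ₗ[ℂ] M}
    (h : ∀ d, f (diag n d) = g (diag n d)) : f = g :=
  Finsupp.lhom_ext' fun d => LinearMap.ext_ring (h d)

/-- The bilinear product with `d₁ d₂ = n ^ ℓ(d₁, d₂) • (d₁ ∘ d₂)`. -/
def mulLin : PartitionAlgebra k n →ₗ[ℂ] PartitionAlgebra k n →ₗ[ℂ] PartitionAlgebra k n :=
  extend fun d₁ => extend fun d₂ => (n : ℂ) ^ loops d₁ d₂ • diag n (comp d₁ d₂)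

theorem mulLin_diag (d₁ d₂ : Diagram k) :
    mulLin (diag n d₁) (diag n d₂) = (n : ℂ) ^ loops d₁ d₂ • diag n (comp d₁ d₂) := by
  rw [mulLin, extend_diag, extend_diag]

theorem mulLin_assoc (x y z : PartitionAlgebra k n) :
    mulLin (mulLin x y) z = mulLin x (mulLin y z) := by
  let L : PartitionAlgebra k n →ₗ[ℂ] PartitionAlgebra k n →ₗ[ℂ] PartitionAlgebra k n →ₗ[ℂ]
      PartitionAlgebra k n := mulLin.compr₂ mulLin
  let R : PartitionAlgebra k n →ₗ[ℂ] PartitionAlgebra k n →ₗ[ℂ] PartitionAlgebra k n →ₗ[ℂ]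
      PartitionAlgebra k n :=
    { toFun := fun x => mulLin.compr₂ (mulLin x)
      map_add' := fun a b => by ext; simp
      map_smul' := fun a b => by ext; simp }
  have h : L = R := by
    refine hom_ext fun d₁ => hom_ext fun d₂ => hom_ext fun d₃ => ?_
    change mulLin (mulLin (diag n d₁) (diag n d₂)) (diag n d₃) =
      mulLin (diag n d₁) (mulLin (diag n d₂) (diag n d₃))
    obtain ⟨h₁, h₂⟩ := comp_assoc_loops d₁ d₂ d₃
    simp only [mulLin_diag, map_smul, LinearMap.smul_apply, smul_smul, ← pow_add, h₁, h₂]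
  exact congrArg (fun f => f x y z) h

theorem one_mulLin (x : PartitionAlgebra k n) : mulLin (diag n (idDiagram k)) x = x := by
  have h : mulLin (diag n (idDiagram k)) =
      (LinearMap.id : PartitionAlgebra k n →ₗ[ℂ] PartitionAlgebra k n) := by
    refine hom_ext fun d => ?_
    obtain ⟨h₁, h₂⟩ := id_comp_loops d
    simp [mulLin_diag, h₁, h₂]
  exact congrArg (fun f => f x) h

theorem mulLin_one (x : PartitionAlgebra k n) : mulLin x (diag n (idDiagram k)) = x := by
  have h : mulLin.flip (diag n (idDiagram k)) =
      (LinearMap.id : PartitionAlgebra k n →ₗ[ℂ] PartitionAlgebra k n) := by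
    refine hom_ext fun d => ?_
    obtain ⟨h₁, h₂⟩ := comp_id_loops d
    simp [mulLin_diag, h₁, h₂]
  exact congrArg (fun f => f x) h

instance : Ring (PartitionAlgebra k n) :=
  { (inferInstance : AddCommGroup (PartitionAlgebra k n)) with
    mul := fun x y => mulLin x y
    one := diag n (idDiagram k)
    mul_assoc := mulLin_assoc
    one_mul := one_mulLin
    mul_one := mulLin_one
    left_distrib := fun x y z => map_add (mulLin x) y z
    right_distrib := fun x y z => LinearMap.map_add₂ mulLin x y z
    zero_mul := fun x => LinearMap.map_zero₂ mulLin x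
    mul_zero := fun x => map_zero (mulLin x) }

instance : Algebra ℂ (PartitionAlgebra k n) :=
  Algebra.ofModule (fun c x y => LinearMap.map_smul₂ mulLin c x y)
    (fun c x y => map_smul (mulLin x) c y)

theorem diag_mul_diag (d₁ d₂ : Diagram k) :
    diag n d₁ * diag n d₂ = (n : ℂ) ^ loops d₁ d₂ • diag n (comp d₁ d₂) :=
  mulLin_diag d₁ d₂

end PartitionAlgebra

/-! ## The planar subalgebras -/

/-- The three families of planar diagram algebras. -/
inductive Family
  | temperleyLieb
  | motzkin
  | planarRook

namespace Family

/-- The diagram basis. Temperley-Lieb: planar, all blocks of size 2. Motzkin: planar, all blocks of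
size 1 or 2. Planar rook: planar, at most one top and at most one bottom vertex in each block. -/
def diagrams (k : ℕ) : Family → Set (Diagram k)
  | temperleyLieb => {d | IsPlanar d ∧ ∀ x, {y | d x y}.ncard = 2}
  | motzkin => {d | IsPlanar d ∧ ∀ x, {y | d x y}.ncard = 1 ∨ {y | d x y}.ncard = 2}
  | planarRook => {d | IsPlanar d ∧ (∀ i j, d (Sum.inl i) (Sum.inl j) → i = j) ∧
      ∀ i j, d (Sum.inr i) (Sum.inr j) → i = j}

/-- The diagram algebra `A_k` inside the partition algebra `P_k(n)`. The set of diagrams contains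
the identity and is closed under concatenation, so the subalgebra that it generates is its span. -/
def algebra (A : Family) (k n : ℕ) : Subalgebra ℂ (PartitionAlgebra k n) :=
  Algebra.adjoin ℂ (PartitionAlgebra.diag n '' A.diagrams k)

/-- Number of columns of the diagram `e`: two for Temperley-Lieb (a cup above a cap), one for the
others (two isolated vertices). -/
def width : Family → ℕ
  | temperleyLieb => 2
  | motzkin => 1
  | planarRook => 1

/-- The set of symmetric `m`-diagrams in `A_k`. -/
def symmetricDiagrams (A : Family) (k m : ℕ) : Set (Diagram k) :=
  {d | d ∈ A.diagrams k ∧ IsSymmetricDiagram m d}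

end Family

/-- The label of a vertex: the vertices in the first `r` columns are labelled by their column, and
the further ones by their row and by the number of the group of `b` consecutive columns to which
they belong. -/
def tailLabel (b k r : ℕ) : Fin k ⊕ Fin k → ℕ × ℕ
  | .inl i => if (i : ℕ) < r then (0, i) else (1, (i - r) / b)
  | .inr i => if (i : ℕ) < r then (0, i) else (2, (i - r) / b)

/-- For `k = r + b * s`, the juxtaposition of `r` vertical edges and `s` copies of the diagram with
`b` columns whose blocks are its top row and its bottom row. -/
def tailDiagram (b k r : ℕ) : Diagram k := Setoid.ker (tailLabel b k r)

theorem tailDiagram_iff {b k r : ℕ} {x y : Fin k ⊕ Fin k} :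
    tailDiagram b k r x y ↔ tailLabel b k r x = tailLabel b k r y := Iff.rfl

theorem tailDiagram_planar (A : Family) (k r : ℕ) : IsPlanar (tailDiagram A.width k r) := by
  intro a b c e hab hbc hce hac hbe
  have h : A.width = 1 ∨ A.width = 2 := by cases A <;> simp [Family.width]
  simp only [tailDiagram_iff] at hac hbe ⊢
  rcases h with h | h <;> rw [h] at hac hbe ⊢ <;>
  rcases a with ⟨a, ha⟩ | ⟨a, ha⟩ <;> rcases b with ⟨b, hb⟩ | ⟨b, hb⟩ <;>
  rcases c with ⟨c, hc⟩ | ⟨c, hc⟩ <;> rcases e with ⟨e, he⟩ | ⟨e, he⟩ <;>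
  simp only [position, tailLabel] at * <;>
  split_ifs at * <;> simp only [Prod.mk.injEq] at * <;> omega

theorem tailDiagram_mem (A : Family) {k r s : ℕ} (h : r + A.width * s = k) :
    tailDiagram A.width k r ∈ A.diagrams k := by
  have hp := tailDiagram_planar A k r
  cases A with
  | temperleyLieb =>
    refine ⟨hp, fun x => ?_⟩
    simp only [Family.width] at h ⊢
    rw [Set.ncard_eq_two]
    rcases x with ⟨i, hi⟩ | ⟨i, hi⟩
    · by_cases hr : i < r
      · refine ⟨.inl ⟨i, hi⟩, .inr ⟨i, hi⟩, by simp, ?_⟩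
        ext y
        rcases y with ⟨j, hj⟩ | ⟨j, hj⟩ <;>
        simp only [tailDiagram_iff, tailLabel, Family.width, Set.mem_ofPred_eq, Set.mem_insert_iff,
          Set.mem_singleton_iff, Sum.inl.injEq, Sum.inr.injEq, Fin.mk.injEq, reduceCtorEq,
          or_false, false_or] <;>
        split_ifs <;> simp only [Prod.mk.injEq] <;> grind
      · refine ⟨.inl ⟨i, hi⟩, .inl ⟨if (i - r) % 2 = 0 then i + 1 else i - 1, by
          split_ifs <;> omega⟩, ?_, ?_⟩
        · simp only [ne_eq, Sum.inl.injEq, Fin.mk.injEq]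
          split_ifs <;> omega
        ext y
        rcases y with ⟨j, hj⟩ | ⟨j, hj⟩ <;>
        simp only [tailDiagram_iff, tailLabel, Family.width, Set.mem_ofPred_eq, Set.mem_insert_iff,
          Set.mem_singleton_iff, Sum.inl.injEq, Fin.mk.injEq, reduceCtorEq, or_false] <;>
        split_ifs <;> simp only [Prod.mk.injEq] <;> grind
    · by_cases hr : i < r
      · refine ⟨.inl ⟨i, hi⟩, .inr ⟨i, hi⟩, by simp, ?_⟩
        ext y
        rcases y with ⟨j, hj⟩ | ⟨j, hj⟩ <;>
        simp only [tailDiagram_iff, tailLabel, Family.width, Set.mem_ofPred_eq, Set.mem_insert_iff,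
          Set.mem_singleton_iff, Sum.inl.injEq, Sum.inr.injEq, Fin.mk.injEq, reduceCtorEq,
          or_false, false_or] <;>
        split_ifs <;> simp only [Prod.mk.injEq] <;> grind
      · refine ⟨.inr ⟨i, hi⟩, .inr ⟨if (i - r) % 2 = 0 then i + 1 else i - 1, by
          split_ifs <;> omega⟩, ?_, ?_⟩
        · simp only [ne_eq, Sum.inr.injEq, Fin.mk.injEq]
          split_ifs <;> omega
        ext y
        rcases y with ⟨j, hj⟩ | ⟨j, hj⟩ <;>
        simp only [tailDiagram_iff, tailLabel, Family.width, Set.mem_ofPred_eq, Set.mem_insert_iff,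
          Set.mem_singleton_iff, Sum.inr.injEq, Fin.mk.injEq, reduceCtorEq, or_false] <;>
        split_ifs <;> simp only [Prod.mk.injEq] <;> grind
  | motzkin =>
    refine ⟨hp, fun x => ?_⟩
    simp only [Family.width] at h ⊢
    rw [Set.ncard_eq_one, Set.ncard_eq_two]
    rcases x with ⟨i, hi⟩ | ⟨i, hi⟩ <;> by_cases hr : i < r
    · refine Or.inr ⟨.inl ⟨i, hi⟩, .inr ⟨i, hi⟩, by simp, ?_⟩
      ext y
      rcases y with ⟨j, hj⟩ | ⟨j, hj⟩ <;>
      simp only [tailDiagram_iff, tailLabel, Family.width, Set.mem_ofPred_eq, Set.mem_insert_iff,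
        Set.mem_singleton_iff, Sum.inl.injEq, Sum.inr.injEq, Fin.mk.injEq, reduceCtorEq,
        or_false, false_or] <;>
      split_ifs <;> simp only [Prod.mk.injEq] <;> grind
    · refine Or.inl ⟨.inl ⟨i, hi⟩, ?_⟩
      ext y
      rcases y with ⟨j, hj⟩ | ⟨j, hj⟩ <;>
      simp only [tailDiagram_iff, tailLabel, Family.width, Set.mem_ofPred_eq,
        Set.mem_singleton_iff, Sum.inl.injEq, Fin.mk.injEq, reduceCtorEq] <;>
      split_ifs <;> simp only [Prod.mk.injEq] <;> grind
    · refine Or.inr ⟨.inl ⟨i, hi⟩, .inr ⟨i, hi⟩, by simp, ?_⟩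
      ext y
      rcases y with ⟨j, hj⟩ | ⟨j, hj⟩ <;>
      simp only [tailDiagram_iff, tailLabel, Family.width, Set.mem_ofPred_eq, Set.mem_insert_iff,
        Set.mem_singleton_iff, Sum.inl.injEq, Sum.inr.injEq, Fin.mk.injEq, reduceCtorEq,
        or_false, false_or] <;>
      split_ifs <;> simp only [Prod.mk.injEq] <;> grind
    · refine Or.inl ⟨.inr ⟨i, hi⟩, ?_⟩
      ext y
      rcases y with ⟨j, hj⟩ | ⟨j, hj⟩ <;>
      simp only [tailDiagram_iff, tailLabel, Family.width, Set.mem_ofPred_eq,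
        Set.mem_singleton_iff, Sum.inr.injEq, Fin.mk.injEq, reduceCtorEq] <;>
      split_ifs <;> simp only [Prod.mk.injEq] <;> grind
  | planarRook =>
    refine ⟨hp, ?_, ?_⟩ <;> rintro ⟨i, hi⟩ ⟨j, hj⟩ hij <;>
    simp only [tailDiagram_iff, tailLabel, Family.width] at hij <;>
    split_ifs at hij <;> simp only [Prod.mk.injEq] at hij <;> simp only [Fin.mk.injEq] <;> omega

namespace Family

/-- The element `1_r ⊗ e^{⊗ s}` of `A_k`, where `e` is `1 / n` times the diagram with
`A.width` columns whose blocks are its top row and its bottom row. -/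
def tailElement (A : Family) (n : ℕ) {k r s : ℕ} (h : r + A.width * s = k) : A.algebra k n :=
  ⟨((n : ℂ)⁻¹) ^ s • PartitionAlgebra.diag n (tailDiagram A.width k r),
    Subalgebra.smul_mem _ (Algebra.subset_adjoin (Set.mem_image_of_mem _ (tailDiagram_mem A h))) _⟩

/-! ## Irreducible modules and characters -/

/-- The set `Γ` of ranks of diagrams in `A_k`: `k, k - 2, k - 4, …` for Temperley-Lieb, and
`0, …, k` for the others. -/
def ranks (A : Family) (k : ℕ) : Set ℕ := {m | ∃ s, m + A.width * s = k}

theorem ranks_spec {A : Family} {k m : ℕ} (h : m ∈ A.ranks k) :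
    m + A.width * ((k - m) / A.width) = k := by
  obtain ⟨s, rfl⟩ := h
  cases A <;> simp [width]

/-- The ideal `J_{m-1}` of `A_k`, spanned by the diagrams of rank less than `m`. -/
def lowerIdeal (A : Family) (k n m : ℕ) : Submodule (A.algebra k n) (A.algebra k n) :=
  Submodule.span (A.algebra k n)
    {x | ∃ d ∈ A.diagrams k, rank d < m ∧ (x : PartitionAlgebra k n) = PartitionAlgebra.diag n d}

/-- The idempotent `e_m = 1_m ⊗ e^{⊗ s}` of `A_k`, for `m + A.width * s = k`. -/
def idempotent (A : Family) (n : ℕ) {k m : ℕ} (h : m ∈ A.ranks k) : A.algebra k n :=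
  A.tailElement n (ranks_spec h)

/-- The irreducible module of `A_k` with label `m`: the image of the left ideal `A_k e_m` in the
quotient `A_k / J_{m-1}` of the left regular representation. -/
def irreducibleModule (A : Family) (n : ℕ) {k m : ℕ} (h : m ∈ A.ranks k) :
    Submodule (A.algebra k n) (A.algebra k n ⧸ A.lowerIdeal k n m) :=
  Submodule.map (A.lowerIdeal k n m).mkQ (Submodule.span (A.algebra k n) {A.idempotent n h})

end Family

/-- The parts of `λ* = [λ₂, λ₃, …]`, where `λ = [λ₁, λ₂, …]` with `λ₁` a largest part. -/
def starParts {n : ℕ} (lam : n.Partition) : Multiset ℕ := lam.parts.erase lam.parts.sup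

/-- `|λ*|`. -/
def starSize {n : ℕ} (lam : n.Partition) : ℕ := (starParts lam).sum

namespace Family

/-- The index set of the irreducible modules of `A_k`: the partitions `λ` of `n` such that
`λ* = [m]` (the empty partition if `m = 0`) for some rank `m` of `A_k`. -/
def indexSet (A : Family) (k n : ℕ) : Set n.Partition :=
  {lam | (starParts lam).card ≤ 1 ∧ starSize lam ∈ A.ranks k}

/-- The irreducible `A_k`-module indexed by `λ`. -/
abbrev irrep (A : Family) {k n : ℕ} {lam : n.Partition} (h : lam ∈ A.indexSet k n) :
    Submodule (A.algebra k n) (A.algebra k n ⧸ A.lowerIdeal k n (starSize lam)) :=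
  A.irreducibleModule n h.2

section Shortcuts

variable {A : Family} {k n m : ℕ}
  (V : Submodule (A.algebra k n) (A.algebra k n ⧸ A.lowerIdeal k n m))

/-! Shortcuts to Mathlib's own instances, to speed up type class inference. -/

instance : Module (A.algebra k n) V := inferInstance

instance : Module ℂ V := inferInstance

instance : SMul (A.algebra k n) V := Module.toDistribMulAction.toSMul

set_option synthInstance.maxHeartbeats 200000 in
instance : IsScalarTower ℂ (A.algebra k n) V := inferInstance

set_option synthInstance.maxHeartbeats 200000 in
instance : SMulCommClass (A.algebra k n) ℂ V := inferInstance

end Shortcuts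

/-- The character of the irreducible `A_k`-module indexed by `λ`. -/
def character (A : Family) {k n : ℕ} {lam : n.Partition} (h : lam ∈ A.indexSet k n)
    (x : A.algebra k n) : ℂ :=
  LinearMap.trace ℂ (A.irrep h) (Algebra.lsmul ℂ ℂ (A.irrep h) x)

end Family

/-- The binomial coefficient with integer lower entry, equal to `0` if that entry is negative. -/
def binom (a : ℕ) (b : ℤ) : ℤ := if b < 0 then 0 else (a.choose b.toNat : ℤ)

end PlanarDiagram

end

noncomputable section

namespace PlanarDiagram

/-! ## Planar partial matchings and concatenation -/

/-! The character value is a trace of an idempotent, hence a dimension, and that dimension counts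
diagrams. Write `t_r` for `tailDiagram A.width k r`. The range of `1_r ⊗ e^{⊗ s}` on the module is
`e_r A_k e_m` modulo lower rank, and its basis consists of the rank `m` diagrams fixed by `t_r` on
the left and by `t_m` on the right (`map_range_tailElement`, `linearIndependent_quotDiag`).

To count them, read the boundary of a diagram as a path: opening vertices go up, closing ones down.
A planar diagram is determined by the words of its two rows (`diagram_ext`), and any two admissible
words with the same total `m` occur (`exists_diagram`). In a diagram of the basis the bottom word is
forced and the top word has a prescribed tail, so what remains is an arbitrary admissible word of
length `r` and total `m`. A symmetric `m`-diagram in `A_r` is given by the same data, its two words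
being equal. This proves the character formula (`ncard_sandwichDiagrams`, `trace_tailElement`).
Words satisfy ballot recurrences in their last letter, whence the three closed formulas.

For irreducibility, `e_m A_k e_m` consists of scalar multiples of `e_m` modulo lower rank, because a
planar diagram of rank `m` squeezed between two copies of `t_m` equals `t_m` (`sandwich_eq`). It
remains to send each nonzero `a e_m` to something nonzero in this corner. Since `n ≥ 2k`, the
representation on `n`-colourings is faithful, and reflection becomes the conjugate transpose; by a
positivity argument `(a e_m)^* (a e_m)` lies in the lower ideal only if `a e_m` does
(`mem_of_star_mul_mem`).

All of this uses that planar diagrams are closed under concatenation (`comp_mem`), shown by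
contracting one pair of middle vertices at a time. -/

/-- The partition `E`, restricted to the set `Y` of points placed on a line by `pos`, has the shape
required of the diagrams of the family `A`; `c` separates the two sides. -/
structure PlanarOn (A : Family) {X : Type} (pos : X → ℕ) (c : X → Bool) (Y : Set X)
    (E : Setoid X) : Prop where
  noncrossing : ∀ w ∈ Y, ∀ x ∈ Y, ∀ y ∈ Y, ∀ z ∈ Y, pos w < pos x → pos x < pos y →
    pos y < pos z → E w y → E x z → E w x
  small : ∀ x ∈ Y, ∀ y ∈ Y, ∀ z ∈ Y, E x y → E x z → x = y ∨ x = z ∨ y = z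
  paired : A = .temperleyLieb → ∀ x ∈ Y, ∃ y ∈ Y, y ≠ x ∧ E x y
  transversal : A = .planarRook → ∀ x ∈ Y, ∀ y ∈ Y, E x y → c x = c y → x = y

/-- The partition obtained by merging the blocks of `p` and `q`. -/
def joinPair {X : Type} (E : Setoid X) (p q : X) : Setoid X where
  r x y := E x y ∨ (E x p ∧ E q y) ∨ (E x q ∧ E p y)
  iseqv :=
    { refl := fun x => Or.inl (E.refl x)
      symm := by
        rintro x y (h | ⟨h, h'⟩ | ⟨h, h'⟩)
        · exact Or.inl (E.symm h)
        · exact Or.inr (Or.inr ⟨E.symm h', E.symm h⟩)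
        · exact Or.inr (Or.inl ⟨E.symm h', E.symm h⟩)
      trans := by
        rintro x y z (h | ⟨h, h'⟩ | ⟨h, h'⟩) (g | ⟨g, g'⟩ | ⟨g, g'⟩)
        · exact Or.inl (E.trans h g)
        · exact Or.inr (Or.inl ⟨E.trans h g, g'⟩)
        · exact Or.inr (Or.inr ⟨E.trans h g, g'⟩)
        · exact Or.inr (Or.inl ⟨h, E.trans h' g⟩)
        · exact Or.inr (Or.inl ⟨h, g'⟩)
        · exact Or.inl (E.trans h g')
        · exact Or.inr (Or.inr ⟨h, E.trans h' g⟩)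
        · exact Or.inl (E.trans h g')
        · exact Or.inr (Or.inr ⟨h, g'⟩) }

/-- By `hadj` no other point of `Y` lies between `p` and `q`, so a short arc from `p` to `q` crosses
nothing. The blocks of `p` and `q` are spliced, and once `p` and `q` are dropped only their old
partners are left. As `p` and `q` are on opposite sides, partners lying opposite to them are again
on opposite sides. -/
theorem PlanarOn.joinPair {A : Family} {X : Type} {pos : X → ℕ} {c : X → Bool} {Y : Set X}
    {E : Setoid X} (hE : PlanarOn A pos c Y E) {p q : X} (hp : p ∈ Y) (hq : q ∈ Y)
    (hpq : p ≠ q) (hc : c p ≠ c q)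
    (hadj : ∀ x ∈ Y, x ≠ p → x ≠ q →
      (pos x < pos p ∧ pos x < pos q) ∨ (pos p < pos x ∧ pos q < pos x)) :
    PlanarOn A pos c (Y \ {p, q}) (joinPair E p q) := by
  have hs : ∀ {x y}, E x y → E y x := fun h => E.symm h
  have ht : ∀ {x y z}, E x y → E y z → E x z := fun h h' => E.trans h h'
  have hnc := hE.noncrossing
  have hsm := hE.small
  constructor
  · rintro w ⟨hw, hw'⟩ x ⟨hx, hx'⟩ y ⟨hy, hy'⟩ z ⟨hz, hz'⟩ hwx hxy hyz hwy hxz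
    simp only [Set.mem_insert_iff, Set.mem_singleton_iff, not_or] at hw' hx' hy' hz'
    have aw := hadj w hw hw'.1 hw'.2
    have ax := hadj x hx hx'.1 hx'.2
    have ay := hadj y hy hy'.1 hy'.2
    have az := hadj z hz hz'.1 hz'.2
    -- Here one of the two crossing pairs is joined through `p` and `q`. Having no point between
    -- them, `p` and `q` compare alike with every other point, so the crossing already occurs among
    -- old blocks. `key₂` treats the other pair.
    have key₁ : ∀ p ∈ Y, ∀ q ∈ Y,
        ((pos w < pos p ∧ pos w < pos q) ∨ (pos p < pos w ∧ pos q < pos w)) →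
        ((pos y < pos p ∧ pos y < pos q) ∨ (pos p < pos y ∧ pos q < pos y)) →
        E w y → E x p → E q z → E w x ∨ (E w q ∧ E p x) := by
      intro p hp q hq aw ay h₁ h₂ h₃
      rcases ay with ay | ay
      · exact Or.inl (hnc w hw x hx y hy p hp hwx hxy ay.1 h₁ h₂)
      rcases aw with aw | aw
      · exact Or.inr ⟨hnc w hw q hq y hy z hz aw.2 ay.2 hyz h₁ h₃, hs h₂⟩
      · have := hnc p hp w hw x hx y hy aw.1 hwx hxy (hs h₂) h₁
        exact Or.inl (ht (hs this) (hs h₂))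
    have key₂ : ∀ p ∈ Y, ∀ q ∈ Y,
        ((pos x < pos p ∧ pos x < pos q) ∨ (pos p < pos x ∧ pos q < pos x)) →
        ((pos z < pos p ∧ pos z < pos q) ∨ (pos p < pos z ∧ pos q < pos z)) →
        E x z → E w p → E q y → E w x ∨ (E w p ∧ E q x) := by
      intro p hp q hq ax az h₁ h₂ h₃
      rcases ax with ax | ax
      · rcases az with az | az
        · have := hnc x hx y hy z hz q hq hxy hyz az.2 h₁ (hs h₃)
          exact Or.inr ⟨h₂, ht h₃ (hs this)⟩
        · exact Or.inl (hnc w hw x hx p hp z hz hwx ax.1 az.1 h₂ h₁)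
      · exact Or.inr ⟨h₂, hnc q hq x hx y hy z hz ax.2 hxy hyz h₃ h₁⟩
    rcases hwy with h | ⟨h, h'⟩ | ⟨h, h'⟩ <;> rcases hxz with g | ⟨g, g'⟩ | ⟨g, g'⟩
    · exact Or.inl (hnc w hw x hx y hy z hz hwx hxy hyz h g)
    · exact (key₁ p hp q hq aw ay h g g').imp_right Or.inr
    · exact (key₁ q hq p hp (aw.imp And.symm And.symm) (ay.imp And.symm And.symm) h g g').imp_right
        Or.inl
    · exact (key₂ p hp q hq ax az g h h').imp_right Or.inl
    · exact Or.inl (ht h (hs g))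
    · exact Or.inr (Or.inl ⟨h, hs g⟩)
    · exact (key₂ q hq p hp (ax.imp And.symm And.symm) (az.imp And.symm And.symm) g h h').imp_right
        Or.inr
    · exact Or.inr (Or.inr ⟨h, hs g⟩)
    · exact Or.inl (ht h (hs g))
  · rintro x ⟨hx, hx'⟩ y ⟨hy, hy'⟩ z ⟨hz, hz'⟩ hxy hxz
    simp only [Set.mem_insert_iff, Set.mem_singleton_iff, not_or] at hx' hy' hz'
    have s₁ := hsm x hx y hy z hz
    have s₂ := hsm x hx y hy p hp
    have s₃ := hsm x hx y hy q hq
    have s₄ := hsm x hx z hz p hp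
    have s₅ := hsm x hx z hz q hq
    have s₆ := hsm p hp y hy z hz
    have s₇ := hsm q hq y hy z hz
    have s₈ := hsm x hx p hp q hq
    rcases hxy with h | ⟨h, h'⟩ | ⟨h, h'⟩ <;> rcases hxz with g | ⟨g, g'⟩ | ⟨g, g'⟩ <;> grind
  · intro hA x ⟨hx, hx'⟩
    simp only [Set.mem_insert_iff, Set.mem_singleton_iff, not_or] at hx'
    have hpair := hE.paired hA
    -- If `x` loses its partner `p`, its new partner is the old partner of `q`; smallness of blocks
    -- keeps that one away from `p` and `x`.
    have key : ∀ p ∈ Y, ∀ q ∈ Y, p ≠ q → x ≠ p → x ≠ q → E x p →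
        ∃ z ∈ Y, z ≠ p ∧ z ≠ q ∧ z ≠ x ∧ E q z := by
      intro p hp q hq hpq hxp hxq h
      obtain ⟨z, hz, hzq, hqz⟩ := hpair q hq
      have h₁ := hsm x hx p hp q hq h
      refine ⟨z, hz, ?_, hzq, ?_, hqz⟩
      · rintro rfl
        rcases h₁ (ht h (hs hqz)) with h₁ | h₁ | h₁
        exacts [hxp h₁, hxq h₁, hpq h₁]
      · rintro rfl
        rcases h₁ (hs hqz) with h₁ | h₁ | h₁
        exacts [hxp h₁, hxq h₁, hpq h₁]
    obtain ⟨y, hy, hyx, hxy⟩ := hpair x hx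
    by_cases hyp : y = p
    · subst hyp
      obtain ⟨z, hz, h₁, h₂, h₃, h₄⟩ := key y hp q hq hpq hx'.1 hx'.2 hxy
      exact ⟨z, ⟨hz, by simp [h₁, h₂]⟩, h₃, Or.inr (Or.inl ⟨hxy, h₄⟩)⟩
    by_cases hyq : y = q
    · subst hyq
      obtain ⟨z, hz, h₁, h₂, h₃, h₄⟩ := key y hq p hp hpq.symm hx'.2 hx'.1 hxy
      exact ⟨z, ⟨hz, by simp [h₁, h₂]⟩, h₃, Or.inr (Or.inr ⟨hxy, h₄⟩)⟩
    exact ⟨y, ⟨hy, by simp [hyp, hyq]⟩, hyx, Or.inl hxy⟩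
  · rintro hA x ⟨hx, hx'⟩ y ⟨hy, hy'⟩ hxy hcxy
    simp only [Set.mem_insert_iff, Set.mem_singleton_iff, not_or] at hx' hy'
    have htr := hE.transversal hA
    have h₁ := htr x hx p hp
    have h₂ := htr x hx q hq
    have h₃ := htr q hq y hy
    have h₄ := htr p hp y hy
    rcases hxy with h | ⟨h, h'⟩ | ⟨h, h'⟩
    · exact htr x hx y hy h hcxy
    · have a₁ : c x ≠ c p := fun e => hx'.1 (h₁ h e)
      have a₂ : c q ≠ c y := fun e => hy'.2 (h₃ h' e).symm
      revert a₁ a₂ hc hcxy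
      cases c x <;> cases c y <;> cases c p <;> cases c q <;> simp
    · have a₁ : c x ≠ c q := fun e => hx'.2 (h₂ h e)
      have a₂ : c p ≠ c y := fun e => hy'.1 (h₄ h' e).symm
      revert a₁ a₂ hc hcxy
      cases c x <;> cases c y <;> cases c p <;> cases c q <;> simp

theorem position_injective {k : ℕ} : Function.Injective (position (k := k)) := by
  rintro (⟨i, hi⟩ | ⟨i, hi⟩) (⟨j, hj⟩ | ⟨j, hj⟩) h <;> simp only [position] at h <;> grind

theorem position_lt {k : ℕ} (x : Fin k ⊕ Fin k) : position x < 2 * k := by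
  rcases x with ⟨i, hi⟩ | ⟨i, hi⟩ <;> simp only [position] <;> omega

theorem ncard_block {X : Type} [Finite X] (E : Setoid X) (x : X) (m : ℕ) (hm : m = 1 ∨ m = 2) :
    {y | E x y}.ncard = m ↔ (m = 1 ∧ ∀ y, E x y → x = y) ∨
      (m = 2 ∧ (∃ y, y ≠ x ∧ E x y) ∧ ∀ y z, E x y → E x z → x = y ∨ x = z ∨ y = z) := by
  rcases hm with rfl | rfl
  · rw [Set.ncard_eq_one]
    constructor
    · rintro ⟨a, ha⟩
      refine Or.inl ⟨rfl, fun y hy => ?_⟩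
      have h₁ : x ∈ {y | E x y} := E.refl x
      have h₂ : y ∈ {y | E x y} := hy
      rw [ha] at h₁ h₂
      exact h₁.trans h₂.symm
    · rintro (⟨-, h⟩ | ⟨h, -⟩)
      · exact ⟨x, Set.ext fun y => ⟨fun hy => (h y hy).symm, fun hy => by
          rw [Set.mem_singleton_iff.1 hy]; exact E.refl x⟩⟩
      · exact absurd h (by decide)
  · rw [Set.ncard_eq_two]
    constructor
    · rintro ⟨a, b, hab, h⟩
      have h' : ∀ y, E x y ↔ y = a ∨ y = b := fun y => by
        have := congrArg (y ∈ ·) h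
        simpa using this
      refine Or.inr ⟨rfl, ?_, fun y z hy hz => ?_⟩
      · rcases (h' x).1 (E.refl x) with rfl | rfl
        · exact ⟨b, hab.symm, (h' b).2 (Or.inr rfl)⟩
        · exact ⟨a, hab, (h' a).2 (Or.inl rfl)⟩
      · have := (h' x).1 (E.refl x)
        rw [h'] at hy hz
        grind
    · rintro (⟨h, -⟩ | ⟨-, ⟨y, hy, hxy⟩, h⟩)
      · exact absurd h (by decide)
      · refine ⟨x, y, hy.symm, Set.ext fun z => ⟨fun hz => ?_, ?_⟩⟩
        · rcases h y z hxy hz with h | h | h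
          · exact absurd h.symm hy
          · exact Or.inl h.symm
          · exact Or.inr h.symm
        · rintro (rfl | rfl)
          · exact E.refl _
          · exact hxy

/-- Describes the three families by a single list of conditions, so that closure under concatenation
and reflection is proved once for all. -/
theorem mem_diagrams_iff {A : Family} {k : ℕ} {d : Diagram k} :
    d ∈ A.diagrams k ↔ PlanarOn A position Sum.isRight Set.univ d := by
  have two := fun x => ncard_block d x 2 (Or.inr rfl)
  have one := fun x => ncard_block d x 1 (Or.inl rfl)
  constructor
  · intro h
    cases A with
    | temperleyLieb =>
      refine ⟨fun w _ x _ y _ z _ => h.1 w x y z, fun x _ y _ z _ hy hz => ?_, fun _ x _ => ?_,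
        nofun⟩
      · have := (two x).1 (h.2 x)
        simp only [OfNat.ofNat_ne_one, false_and, true_and, false_or] at this
        exact this.2 y z hy hz
      · have := (two x).1 (h.2 x)
        simp only [OfNat.ofNat_ne_one, false_and, true_and, false_or] at this
        simpa using this.1
    | motzkin =>
      refine ⟨fun w _ x _ y _ z _ => h.1 w x y z, fun x _ y _ z _ hy hz => ?_,
        nofun, nofun⟩
      rcases h.2 x with h' | h'
      · have := (one x).1 h'
        simp only [OfNat.one_ne_ofNat, false_and, true_and, or_false] at this
        exact Or.inl (this y hy)
      · have := (two x).1 h'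
        simp only [OfNat.ofNat_ne_one, false_and, true_and, false_or] at this
        exact this.2 y z hy hz
    | planarRook =>
      obtain ⟨h, ht, hb⟩ := h
      refine ⟨fun w _ x _ y _ z _ => h w x y z, fun x _ y _ z _ hy hz => ?_,
        nofun, fun _ x _ y _ hy hc => ?_⟩
      -- Of three vertices in one block two lie in the same row, hence coincide.
      · have hyz := d.trans (d.symm hy) hz
        rcases x with x | x <;> rcases y with y | y <;> rcases z with z | z
        · exact Or.inl (congrArg _ (ht _ _ hy))
        · exact Or.inl (congrArg _ (ht _ _ hy))
        · exact Or.inr (Or.inl (congrArg _ (ht _ _ hz)))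
        · exact Or.inr (Or.inr (congrArg _ (hb _ _ hyz)))
        · exact Or.inr (Or.inr (congrArg _ (ht _ _ hyz)))
        · exact Or.inr (Or.inl (congrArg _ (hb _ _ hz)))
        · exact Or.inl (congrArg _ (hb _ _ hy))
        · exact Or.inl (congrArg _ (hb _ _ hy))
      · rcases x with x | x <;> rcases y with y | y
        · exact congrArg _ (ht _ _ hy)
        · simp at hc
        · simp at hc
        · exact congrArg _ (hb _ _ hy)
  · intro h
    have hp : IsPlanar d := fun w x y z => h.noncrossing w trivial x trivial y trivial z trivial
    have hs := fun x y z => h.small x trivial y trivial z trivial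
    cases A with
    | temperleyLieb =>
      refine ⟨hp, fun x => (two x).2 (Or.inr ⟨rfl, ?_, hs x⟩)⟩
      simpa using h.paired rfl x trivial
    | motzkin =>
      refine ⟨hp, fun x => ?_⟩
      by_cases hx : ∃ y, y ≠ x ∧ d x y
      · exact Or.inr ((two x).2 (Or.inr ⟨rfl, hx, hs x⟩))
      · exact Or.inl ((one x).2 (Or.inl ⟨rfl, fun y hy => by_contra fun hne => hx
          ⟨y, fun h => hne h.symm, hy⟩⟩))
    | planarRook =>
      refine ⟨hp, fun i j hij => ?_, fun i j hij => ?_⟩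
      · simpa using h.transversal rfl _ trivial _ trivial hij
      · simpa using h.transversal rfl _ trivial _ trivial hij

/-! ### Concatenation by successive contraction of the middle row -/

/-- Four rows: those of `d₁` followed by those of `d₂`. -/
abbrev FourRows (k : ℕ) : Type := (Fin k ⊕ Fin k) ⊕ (Fin k ⊕ Fin k)

namespace FourRows

variable {k : ℕ}

/-- Position of a point of the four rows on a line, on which the two middle rows are nested. -/
def pos : FourRows k → ℕ
  | .inl x => position x
  | .inr x => 2 * k + position x

/-- The side of a point within its diagram. -/
def side : FourRows k → Bool
  | .inl x => x.isRight
  | .inr x => x.isRight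

/-- The disjoint union of two diagrams. -/
def union (d₁ d₂ : Diagram k) : Setoid (FourRows k) where
  r
    | .inl x, .inl y => d₁ x y
    | .inr x, .inr y => d₂ x y
    | _, _ => False
  iseqv :=
    { refl := by
        rintro (x | x)
        · exact d₁.refl x
        · exact d₂.refl x
      symm := by
        rintro (x | x) (y | y) h
        · exact d₁.symm h
        · exact h.elim
        · exact h.elim
        · exact d₂.symm h
      trans := by
        rintro (x | x) (y | y) (z | z) h h'
        exacts [d₁.trans h h', h'.elim, h.elim, h.elim, h.elim, h.elim, h'.elim, d₂.trans h h'] }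

/-- The two copies of the first `j` middle points are identified. -/
def merge (d₁ d₂ : Diagram k) : ℕ → Setoid (FourRows k)
  | 0 => union d₁ d₂
  | j + 1 => if h : j < k then
      joinPair (merge d₁ d₂ j) (.inl (.inr ⟨j, h⟩)) (.inr (.inl ⟨j, h⟩)) else merge d₁ d₂ j

/-- The points that remain once the first `j` middle points are removed. -/
def remaining (k j : ℕ) : Set (FourRows k) :=
  {x | ∀ i : Fin k, (x = .inl (.inr i) ∨ x = .inr (.inl i)) → j ≤ i}

theorem union_planarOn {A : Family} {d₁ d₂ : Diagram k} (h₁ : d₁ ∈ A.diagrams k)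
    (h₂ : d₂ ∈ A.diagrams k) : PlanarOn A pos side Set.univ (union d₁ d₂) := by
  rw [mem_diagrams_iff] at h₁ h₂
  refine ⟨?_, ?_, ?_, ?_⟩
  · rintro (w | w) - (x | x) - (y | y) - (z | z) - hwx hxy hyz hwy hxz
    · exact h₁.noncrossing w trivial x trivial y trivial z trivial hwx hxy hyz hwy hxz
    all_goals try first | exact False.elim hwy | exact False.elim hxz
    · have := position_lt y
      simp only [pos] at hxy
      omega
    · have := position_lt z
      simp only [pos] at hyz
      omega
    · simp only [pos] at hwx hxy hyz
      exact h₂.noncrossing w trivial x trivial y trivial z trivial (by omega) (by omega) (by omega)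
        hwy hxz
  · rintro (x | x) - (y | y) - (z | z) - hxy hxz
    all_goals try first | exact False.elim hxy | exact False.elim hxz
    · simpa using h₁.small x trivial y trivial z trivial hxy hxz
    · simpa using h₂.small x trivial y trivial z trivial hxy hxz
  · rintro hA (x | x) -
    · obtain ⟨y, -, hy, h⟩ := h₁.paired hA x trivial
      exact ⟨.inl y, trivial, by simpa using hy, h⟩
    · obtain ⟨y, -, hy, h⟩ := h₂.paired hA x trivial
      exact ⟨.inr y, trivial, by simpa using hy, h⟩
  · rintro hA (x | x) - (y | y) - hxy hc
    all_goals try exact False.elim hxy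
    · exact congrArg _ (h₁.transversal hA x trivial y trivial hxy hc)
    · exact congrArg _ (h₂.transversal hA x trivial y trivial hxy hc)

/-- The copies of middle vertex `j` sit at `2k - 1 - j` and `2k + j`. Only copies of earlier middle
vertices lie between them, and these are gone, so `PlanarOn.joinPair` applies. -/
theorem merge_planarOn {A : Family} {d₁ d₂ : Diagram k} (h₁ : d₁ ∈ A.diagrams k)
    (h₂ : d₂ ∈ A.diagrams k) (j : ℕ) (hj : j ≤ k) :
    PlanarOn A pos side (remaining k j) (merge d₁ d₂ j) := by
  induction j with
  | zero =>
    have : remaining k 0 = Set.univ := Set.eq_univ_of_forall fun x i _ => Nat.zero_le _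
    rw [this]
    exact union_planarOn h₁ h₂
  | succ j ih =>
    have hjk : j < k := hj
    have h := ih hjk.le
    have hp : (.inl (.inr ⟨j, hjk⟩) : FourRows k) ∈ remaining k j := by
      rintro i (h | h) <;> simp at h; simp [← h]
    have hq : (.inr (.inl ⟨j, hjk⟩) : FourRows k) ∈ remaining k j := by
      rintro i (h | h) <;> simp at h; simp [← h]
    have h' := h.joinPair hp hq (by simp) (by simp [side]) (by
      rintro ((⟨i, hi⟩ | ⟨i, hi⟩) | (⟨i, hi⟩ | ⟨i, hi⟩)) hx hxp hxq
      · simp only [pos, position]; omega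
      · have := hx ⟨i, hi⟩ (Or.inl rfl)
        simp only [ne_eq, Sum.inl.injEq, Sum.inr.injEq, Fin.mk.injEq] at hxp
        simp only [pos, position] at *; omega
      · have := hx ⟨i, hi⟩ (Or.inr rfl)
        simp only [ne_eq, Sum.inl.injEq, Sum.inr.injEq, Fin.mk.injEq] at hxq
        simp only [pos, position] at *; omega
      · simp only [pos, position]; omega)
    have hrem : remaining k (j + 1) =
        remaining k j \ {.inl (.inr ⟨j, hjk⟩), .inr (.inl ⟨j, hjk⟩)} := by
      ext x
      simp only [remaining, Set.mem_sdiff, Set.mem_insert_iff, Set.mem_singleton_iff, not_or,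
        Set.mem_ofPred_eq]
      constructor
      · intro hx
        refine ⟨fun i hi => (Nat.le_succ j).trans (hx i hi), fun e => ?_, fun e => ?_⟩
        · exact absurd (hx ⟨j, hjk⟩ (Or.inl e)) (by simp)
        · exact absurd (hx ⟨j, hjk⟩ (Or.inr e)) (by simp)
      · rintro ⟨hx, h₁, h₂⟩ i hi
        refine Nat.lt_of_le_of_ne (hx i hi) fun e => ?_
        have e' : i = ⟨j, hjk⟩ := Fin.ext e.symm
        subst e'
        exact hi.elim h₁ h₂
    rw [merge, dif_pos hjk, hrem]
    exact h'

/-- The top and bottom rows among the four rows. -/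
def outside : Fin k ⊕ Fin k → FourRows k
  | .inl i => .inl (.inl i)
  | .inr i => .inr (.inr i)

/-- Identification of the two middle rows. -/
def collapse : FourRows k → Fin k ⊕ Fin k ⊕ Fin k
  | .inl x => upper x
  | .inr x => lower x

theorem stack_upper {d₁ : Diagram k} (d₂ : Diagram k) {x y : Fin k ⊕ Fin k} (h : d₁ x y) :
    stack d₁ d₂ (upper x) (upper y) := Relation.EqvGen.rel _ _ (Or.inl ⟨x, y, h, rfl, rfl⟩)

theorem stack_lower (d₁ : Diagram k) {d₂ : Diagram k} {x y : Fin k ⊕ Fin k} (h : d₂ x y) :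
    stack d₁ d₂ (lower x) (lower y) := Relation.EqvGen.rel _ _ (Or.inr ⟨x, y, h, rfl, rfl⟩)

theorem merge_le (d₁ d₂ : Diagram k) (j : ℕ) :
    merge d₁ d₂ j ≤ Setoid.comap collapse (stack d₁ d₂) := by
  induction j with
  | zero =>
    rintro (x | x) (y | y) h
    · exact stack_upper d₂ h
    · exact False.elim h
    · exact False.elim h
    · exact stack_lower d₁ h
  | succ j ih =>
    rw [merge]
    split_ifs with hj
    · rintro x y (h | ⟨h, h'⟩ | ⟨h, h'⟩)
      · exact ih h
      · have a : stack d₁ d₂ (collapse x) (.inr (.inl ⟨j, hj⟩)) := ih h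
        have b : stack d₁ d₂ (.inr (.inl ⟨j, hj⟩)) (collapse y) := ih h'
        exact Setoid.trans' (stack d₁ d₂) a b
      · have a : stack d₁ d₂ (collapse x) (.inr (.inl ⟨j, hj⟩)) := ih h
        have b : stack d₁ d₂ (.inr (.inl ⟨j, hj⟩)) (collapse y) := ih h'
        exact Setoid.trans' (stack d₁ d₂) a b
    · exact ih

theorem merge_mono (d₁ d₂ : Diagram k) {i j : ℕ} (hij : i ≤ j) :
    merge d₁ d₂ i ≤ merge d₁ d₂ j := by
  induction j, hij using Nat.le_induction with
  | base => exact le_rfl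
  | succ j _ ih =>
    refine ih.trans ?_
    rw [merge]
    split_ifs
    · exact fun x y h => Or.inl h
    · exact le_rfl

theorem merge_middle (d₁ d₂ : Diagram k) (i : Fin k) :
    merge d₁ d₂ k (.inl (.inr i)) (.inr (.inl i)) := by
  refine merge_mono d₁ d₂ (Nat.succ_le_of_lt i.2) ?_
  rw [merge, dif_pos i.2]
  exact Or.inr (Or.inl ⟨Setoid.refl' _ _, Setoid.refl' _ _⟩)

/-- Section of `collapse`. -/
def lift : Fin k ⊕ Fin k ⊕ Fin k → FourRows k
  | .inl i => .inl (.inl i)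
  | .inr (.inl i) => .inl (.inr i)
  | .inr (.inr i) => .inr (.inr i)

theorem stack_le (d₁ d₂ : Diagram k) :
    stack d₁ d₂ ≤ Setoid.comap lift (merge d₁ d₂ k) := by
  have h₁ : ∀ {x y}, d₁ x y → merge d₁ d₂ k (.inl x) (.inl y) :=
    fun h => merge_mono d₁ d₂ (Nat.zero_le k) h
  have h₂ : ∀ {x y}, d₂ x y → merge d₁ d₂ k (.inr x) (.inr y) :=
    fun h => merge_mono d₁ d₂ (Nat.zero_le k) h
  have hl : ∀ x, merge d₁ d₂ k (lift (lower x)) (.inr x) := by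
    rintro (i | i)
    · exact merge_middle d₁ d₂ i
    · exact Setoid.refl' _ _
  intro x y h
  induction h with
  | rel x y h =>
    rcases h with ⟨a, b, h, rfl, rfl⟩ | ⟨a, b, h, rfl, rfl⟩
    · rcases a with a | a <;> rcases b with b | b <;> exact h₁ h
    · exact Setoid.trans' (merge d₁ d₂ k) (hl a)
        (Setoid.trans' _ (h₂ h) (Setoid.symm' (merge d₁ d₂ k) (hl b)))
  | refl x => exact Setoid.refl' _ _
  | symm x y _ ih => exact Setoid.symm' _ ih
  | trans x y z _ _ ih₁ ih₂ => exact Setoid.trans' _ ih₁ ih₂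

/-- Contracting the middle pairs one by one produces the connected components of the stacked
picture: `merge_le` and `stack_le` give the two inclusions. -/
theorem comp_eq (d₁ d₂ : Diagram k) : comp d₁ d₂ = Setoid.comap outside (merge d₁ d₂ k) := by
  refine le_antisymm (fun x y h => ?_) fun x y h => ?_
  · have := stack_le d₁ d₂ h
    rcases x with x | x <;> rcases y with y | y <;> exact this
  · have := merge_le d₁ d₂ k h
    rcases x with x | x <;> rcases y with y | y <;> exact this

theorem pos_outside {x y : Fin k ⊕ Fin k} (h : position x < position y) :
    pos (outside x) < pos (outside y) := by
  rcases x with ⟨x, hx⟩ | ⟨x, hx⟩ <;> rcases y with ⟨y, hy⟩ | ⟨y, hy⟩ <;>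
    simp only [pos, outside, position] at * <;> omega

end FourRows

-- When every middle pair is removed, `outside` is an order-preserving bijection from the vertices
-- of the concatenation to the remaining points, and planarity is pulled back along it.
open FourRows in
theorem comp_mem {A : Family} {k : ℕ} {d₁ d₂ : Diagram k} (h₁ : d₁ ∈ A.diagrams k)
    (h₂ : d₂ ∈ A.diagrams k) : comp d₁ d₂ ∈ A.diagrams k := by
  have h := merge_planarOn h₁ h₂ k le_rfl
  have hmem : ∀ x, outside x ∈ remaining k k := by
    rintro (x | x) i (h | h) <;> simp [outside] at h
  have hinj : Function.Injective (outside (k := k)) := by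
    rintro (x | x) (y | y) h <;> simp [outside] at h <;> rw [h]
  have hsurj : ∀ y ∈ remaining k k, ∃ x, outside x = y := by
    rintro ((y | y) | (y | y)) hy
    · exact ⟨.inl y, rfl⟩
    · exact absurd (hy y (Or.inl rfl)) (by simp)
    · exact absurd (hy y (Or.inr rfl)) (by simp)
    · exact ⟨.inr y, rfl⟩
  have hside : ∀ x, side (outside (k := k) x) = x.isRight := by rintro (x | x) <;> rfl
  rw [mem_diagrams_iff, comp_eq]
  refine ⟨fun w _ x _ y _ z _ hwx hxy hyz => h.noncrossing _ (hmem w) _ (hmem x) _ (hmem y) _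
      (hmem z) (pos_outside hwx) (pos_outside hxy) (pos_outside hyz),
    fun x _ y _ z _ hxy hxz => ?_, fun hA x _ => ?_, fun hA x _ y _ hxy hc => ?_⟩
  · simpa only [hinj.eq_iff] using h.small _ (hmem x) _ (hmem y) _ (hmem z) hxy hxz
  · obtain ⟨y, hy, hyx, hxy⟩ := h.paired hA _ (hmem x)
    obtain ⟨y, rfl⟩ := hsurj y hy
    exact ⟨y, trivial, fun e => hyx (congrArg _ e), hxy⟩
  · exact hinj (h.transversal hA _ (hmem x) _ (hmem y) hxy (by rw [hside, hside, hc]))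

/-! ## Reflection and ranks -/

theorem flip_flip {k : ℕ} (d : Diagram k) : flip (flip d) = d := by
  ext x y
  rcases x with x | x <;> rcases y with y | y <;> exact Iff.rfl

/-- Reflection reverses the order of positions on the boundary, and noncrossing does not depend on
the direction of reading. -/
theorem flip_mem {A : Family} {k : ℕ} {d : Diagram k} (h : d ∈ A.diagrams k) :
    flip d ∈ A.diagrams k := by
  rw [mem_diagrams_iff] at *
  have hpos : ∀ {x y : Fin k ⊕ Fin k}, position x < position y →
      position y.swap < position x.swap := by
    rintro (⟨x, hx⟩ | ⟨x, hx⟩) (⟨y, hy⟩ | ⟨y, hy⟩) <;>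
      simp only [position, Sum.swap_inl, Sum.swap_inr] <;> omega
  have hinj : Function.Injective (Sum.swap : Fin k ⊕ Fin k → Fin k ⊕ Fin k) :=
    Sum.swap_leftInverse.injective
  refine ⟨fun w _ x _ y _ z _ hwx hxy hyz hwy hxz => ?_, fun x _ y _ z _ hxy hxz => ?_,
    fun hA x _ => ?_, fun hA x _ y _ hxy hc => ?_⟩
  · have := h.noncrossing _ trivial _ trivial _ trivial _ trivial (hpos hyz) (hpos hxy) (hpos hwx)
      (d.symm hxz) (d.symm hwy)
    exact d.trans hwy (d.trans (d.symm this) (d.symm hxz))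
  · simpa only [hinj.eq_iff] using h.small _ trivial _ trivial _ trivial hxy hxz
  · obtain ⟨y, -, hy, h⟩ := h.paired hA x.swap trivial
    exact ⟨y.swap, trivial, fun e => hy (by rw [← e, Sum.swap_swap]), by
      change d x.swap y.swap.swap
      rwa [Sum.swap_swap]⟩
  · refine hinj (h.transversal hA _ trivial _ trivial hxy ?_)
    rcases x with x | x <;> rcases y with y | y <;> simp at hc ⊢

/-- Turning the stacked picture upside down (`σ`) exchanges the two diagrams. Since reflection is an
involution, the inclusion `key` for all pairs gives both directions. -/
theorem comp_flip {k : ℕ} (d₁ d₂ : Diagram k) : comp (flip d₂) (flip d₁) = flip (comp d₁ d₂) := by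
  let σ : Fin k ⊕ Fin k ⊕ Fin k → Fin k ⊕ Fin k ⊕ Fin k
    | .inl i => .inr (.inr i)
    | .inr (.inl i) => .inr (.inl i)
    | .inr (.inr i) => .inl i
  have key : ∀ d₁ d₂ : Diagram k, stack d₁ d₂ ≤ Setoid.comap σ (stack (flip d₂) (flip d₁)) := by
    intro d₁ d₂ x y h
    induction h with
    | rel x y h =>
      rcases h with ⟨a, b, h, rfl, rfl⟩ | ⟨a, b, h, rfl, rfl⟩
      · have := FourRows.stack_lower (flip d₂) (d₂ := flip d₁) (x := a.swap) (y := b.swap)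
          (show Setoid.comap _ _ _ _ by
            rw [Setoid.comap_rel, Sum.swap_swap, Sum.swap_swap]; exact h)
        rcases a with a | a <;> rcases b with b | b <;> exact this
      · have := FourRows.stack_upper (flip d₁) (d₁ := flip d₂) (x := a.swap) (y := b.swap)
          (show Setoid.comap _ _ _ _ by
            rw [Setoid.comap_rel, Sum.swap_swap, Sum.swap_swap]; exact h)
        rcases a with a | a <;> rcases b with b | b <;> exact this
    | refl x => exact Setoid.refl' _ _
    | symm x y _ ih => exact Setoid.symm' _ ih
    | trans x y z _ _ ih₁ ih₂ => exact Setoid.trans' _ ih₁ ih₂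
  refine le_antisymm (fun x y h => ?_) fun x y h => ?_
  · have := key _ _ h
    rw [flip_flip, flip_flip] at this
    rcases x with x | x <;> rcases y with y | y <;> exact this
  · have := key _ _ h
    rcases x with x | x <;> rcases y with y | y <;> exact this

theorem rank_flip {k : ℕ} (d : Diagram k) : rank (flip d) = rank d := by
  have hle : ∀ d : Diagram k, rank (flip d) ≤ rank d := by
    intro d
    let f : Quotient (flip d) → Quotient d :=
      Quotient.map' (s₁ := flip d) (s₂ := d) Sum.swap fun _ _ h => h
    have hf : Function.Injective f := by
      rintro ⟨x⟩ ⟨y⟩ h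
      exact Quotient.sound (s := flip d) (Quotient.exact (s := d) h)
    refine Nat.card_le_card_of_injective
      (fun c => ⟨f c.1, ?_, ?_⟩) fun c c' h => Subtype.ext (hf (congrArg Subtype.val h))
    · obtain ⟨c, -, ⟨j, rfl⟩⟩ := c
      exact ⟨j, rfl⟩
    · obtain ⟨c, ⟨i, rfl⟩, -⟩ := c
      exact ⟨i, rfl⟩
  refine le_antisymm (hle d) ?_
  have := hle (flip d)
  rwa [flip_flip] at this

/-- A top vertex whose block in `d₁` lies in the top row keeps its block in `d₁ ∘ d₂`. -/
theorem comp_left_of_isolated {k : ℕ} {d₁ d₂ : Diagram k} {i : Fin k}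
    (hi : ∀ j, ¬ d₁ (.inl i) (.inr j)) (x : Fin k ⊕ Fin k) :
    comp d₁ d₂ (.inl i) x ↔ d₁ (.inl i) x := by
  constructor
  · intro h
    -- The block of `i` in `d₁` is closed under all connections of the stacked picture: it avoids
    -- the middle row, where those of `d₂` could attach.
    have key : ∀ x y, stack d₁ d₂ x y → ((∃ z, d₁ (.inl i) z ∧ upper z = x) ↔
        ∃ z, d₁ (.inl i) z ∧ upper z = y) := by
      have hu : Function.Injective (upper (k := k)) := by
        rintro (x | x) (y | y) h <;> simp [upper] at h <;> rw [h]
      intro x y h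
      induction h with
      | rel x y h =>
        rcases h with ⟨a, b, h, rfl, rfl⟩ | ⟨a, b, h, rfl, rfl⟩
        · constructor
          · rintro ⟨z, hz, e⟩
            exact ⟨b, d₁.trans hz (by rw [hu e]; exact h), rfl⟩
          · rintro ⟨z, hz, e⟩
            exact ⟨a, d₁.trans hz (by rw [hu e]; exact d₁.symm h), rfl⟩
        · have hlow : ∀ a, ¬ ∃ z, d₁ (.inl i) z ∧ upper z = lower a := by
            rintro (a | a) ⟨z | z, hz, e⟩
            · cases e
            · exact hi z hz
            · cases e
            · cases e
          exact iff_of_false (hlow a) (hlow b)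
      | refl x => exact Iff.rfl
      | symm x y _ ih => exact ih.symm
      | trans x y z _ _ ih₁ ih₂ => exact ih₁.trans ih₂
    obtain ⟨z, hz, e⟩ := (key _ _ h).1 ⟨.inl i, d₁.refl _, rfl⟩
    rcases x with x | x
    · rcases z with z | z
      · cases e; exact hz
      · cases e
    · rcases z with z | z
      · cases e
      · exact absurd hz (hi z)
  · intro h
    rcases x with x | x
    · exact FourRows.stack_upper d₂ h
    · exact absurd h (hi x)

/-- The top vertices whose block meets the bottom row. -/
def through {k : ℕ} (d : Diagram k) : Set (Fin k) := {i | ∃ j, d (.inl i) (.inr j)}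

/-- A block with at most two vertices that meets both rows has exactly one top vertex. -/
theorem rank_eq_ncard {A : Family} {k : ℕ} {d : Diagram k} (hd : d ∈ A.diagrams k) :
    rank d = (through d).ncard := by
  rw [mem_diagrams_iff] at hd
  refine (Nat.card_congr (Equiv.ofBijective
    (fun i : through d => ⟨Quotient.mk d (.inl i.1), ⟨i, rfl⟩, i.2.imp fun j hj =>
      Quotient.sound (s := d) (d.symm hj)⟩) ⟨?_, ?_⟩)).symm
  · rintro ⟨i, j, hij⟩ ⟨i', hi'⟩ h
    have h' : d (.inl i) (.inl i') := Quotient.exact (s := d) (congrArg Subtype.val h)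
    have := hd.small _ trivial _ trivial _ trivial h' hij
    exact Subtype.ext (by simpa using this)
  · rintro ⟨_, ⟨i, rfl⟩, j, hj⟩
    exact ⟨⟨i, j, d.symm (Quotient.exact (s := d) hj)⟩, rfl⟩

theorem through_comp_subset {k : ℕ} (d₁ d₂ : Diagram k) :
    through (comp d₁ d₂) ⊆ through d₁ := by
  rintro i ⟨j, hj⟩
  by_contra h
  have h' : ∀ j, ¬ d₁ (.inl i) (.inr j) := fun j hj => h ⟨j, hj⟩
  exact h' j ((comp_left_of_isolated h' _).1 hj)

theorem rank_comp_le_left {A : Family} {k : ℕ} {d₁ d₂ : Diagram k} (h₁ : d₁ ∈ A.diagrams k)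
    (h₂ : d₂ ∈ A.diagrams k) : rank (comp d₁ d₂) ≤ rank d₁ := by
  rw [rank_eq_ncard h₁, rank_eq_ncard (comp_mem h₁ h₂)]
  exact Set.ncard_le_ncard (through_comp_subset d₁ d₂)

theorem rank_comp_le_right {A : Family} {k : ℕ} {d₁ d₂ : Diagram k} (h₁ : d₁ ∈ A.diagrams k)
    (h₂ : d₂ ∈ A.diagrams k) : rank (comp d₁ d₂) ≤ rank d₂ := by
  rw [← rank_flip, ← rank_flip d₂, ← comp_flip]
  exact rank_comp_le_left (flip_mem h₂) (flip_mem h₁)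

/-! ## Noncrossing matchings from height functions -/

/-- Sum of the first `l` steps of a path. -/
def pathHeight (V : ℕ → ℤ) (l : ℕ) : ℤ := ∑ i ∈ Finset.range l, V i

theorem pathHeight_succ (V : ℕ → ℤ) (l : ℕ) : pathHeight V (l + 1) = pathHeight V l + V l :=
  Finset.sum_range_succ V l

/-- A path with steps `1`, `0`, `-1` that stays nonnegative and returns to `0` at time `N`. -/
structure IsExcursion (N : ℕ) (V : ℕ → ℤ) : Prop where
  step : ∀ i, V i = -1 ∨ V i = 0 ∨ V i = 1
  nonneg : ∀ l ≤ N, 0 ≤ pathHeight V l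
  closed : pathHeight V N = 0
  eventually_zero : ∀ i, N ≤ i → V i = 0

/-- The starting point of the arc that ends at `j`, or `j` itself if no arc ends at `j`. -/
def arcStart (V : ℕ → ℤ) (j : ℕ) : ℕ :=
  if V j = -1 then Nat.findGreatest (fun i => pathHeight V i ≤ pathHeight V (j + 1)) j else j

/-- The noncrossing matching that joins every up step to the first return to its starting height. -/
def arcs (V : ℕ → ℤ) : Setoid ℕ := Setoid.ker (arcStart V)

section Arcs

variable {N : ℕ} {V : ℕ → ℤ} (hV : IsExcursion N V)
include hV

/-- The arc starts at the last time `i ≤ j` whose height does not exceed the height after the down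
step at `j`; time `0` qualifies by nonnegativity. Right after that time the height is larger, and
steps are at most `1`, so the step there is up and the two heights agree. -/
theorem arcStart_spec {j : ℕ} (hj : V j = -1) :
    arcStart V j < j ∧ V (arcStart V j) = 1 ∧
      pathHeight V (arcStart V j) = pathHeight V (j + 1) ∧
      ∀ l, arcStart V j < l → l ≤ j → pathHeight V (j + 1) < pathHeight V l := by
  have hjN : j < N := by
    by_contra h
    have := hV.eventually_zero j (not_lt.1 h)
    omega
  have h0 : pathHeight V 0 ≤ pathHeight V (j + 1) := by
    have := hV.nonneg (j + 1) hjN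
    simpa [pathHeight] using this
  have hspec := Nat.findGreatest_spec (P := fun i => pathHeight V i ≤ pathHeight V (j + 1))
    (Nat.zero_le j) h0
  have hgt : ∀ l, arcStart V j < l → l ≤ j → pathHeight V (j + 1) < pathHeight V l := by
    intro l hl hlj
    rw [arcStart, if_pos hj] at hl
    exact not_le.1 (Nat.findGreatest_is_greatest hl hlj)
  have hle := Nat.findGreatest_le (P := fun i => pathHeight V i ≤ pathHeight V (j + 1)) j
  have e : arcStart V j = Nat.findGreatest (fun i => pathHeight V i ≤ pathHeight V (j + 1)) j := by
    rw [arcStart, if_pos hj]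
  rw [← e] at hspec hle
  have hstep := pathHeight_succ V j
  have hlt : arcStart V j < j := by
    refine lt_of_le_of_ne hle fun h => ?_
    rw [h] at hspec
    omega
  have h₁ := hgt (arcStart V j + 1) (Nat.lt_succ_self _) hlt
  have h₂ := pathHeight_succ V (arcStart V j)
  have h₃ := hV.step (arcStart V j)
  refine ⟨hlt, ?_, ?_, hgt⟩ <;> rcases h₃ with h₃ | h₃ | h₃ <;> omega

theorem arcs_lt {x y : ℕ} (hxy : x < y) (h : arcs V x y) : V y = -1 ∧ arcStart V y = x := by
  have h : arcStart V x = arcStart V y := h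
  have hy : V y = -1 := by
    by_contra hy
    have e : arcStart V y = y := if_neg hy
    have : arcStart V x ≤ x := by
      by_cases hx : V x = -1
      · exact (arcStart_spec hV hx).1.le
      · exact (if_neg hx : arcStart V x = x).le
    omega
  refine ⟨hy, ?_⟩
  by_cases hx : V x = -1
  -- Two down steps cannot share a start: after step `x` the path is back at the common starting
  -- height, whereas it must stay strictly above it up to time `y`.
  · have h₁ := arcStart_spec hV hx
    have h₂ := (arcStart_spec hV hy).2.2.2 (x + 1) (by omega) hxy
    have h₃ := (arcStart_spec hV hy).2.2.1
    rw [← h] at h₃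
    omega
  · rw [← h]
    exact if_neg hx

theorem arcs_start {x y : ℕ} (hxy : x < y) (h : arcs V x y) : V x = 1 := by
  obtain ⟨h₁, h₂⟩ := arcs_lt hV hxy h
  rw [← h₂]
  exact (arcStart_spec hV h₁).2.1

theorem exists_arc_of_down {y : ℕ} (hy : V y = -1) : ∃ x < y, arcs V x y := by
  obtain ⟨h₁, h₂, -, -⟩ := arcStart_spec hV hy
  refine ⟨arcStart V y, h₁, ?_⟩
  change arcStart V (arcStart V y) = arcStart V y
  exact if_neg (by omega)

/-- The partner is the step that first brings the path back to its height at `x`; such a return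
occurs because the path ends at height `0`. -/
theorem exists_arc_of_up {x : ℕ} (hx : V x = 1) : ∃ y, x < y ∧ arcs V x y := by
  have hxN : x < N := by
    by_contra h
    have := hV.eventually_zero x (not_lt.1 h)
    omega
  have hex : ∃ l, x < l ∧ pathHeight V l ≤ pathHeight V x :=
    ⟨N, hxN, by rw [hV.closed]; exact hV.nonneg x hxN.le⟩
  classical
  obtain ⟨hl, hle⟩ := Nat.find_spec hex
  have hmin : ∀ l, l < Nat.find hex → x < l → pathHeight V x < pathHeight V l := by
    intro l hl hxl
    have := Nat.find_min hex hl
    push Not at this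
    exact this hxl
  obtain ⟨j, hj⟩ : ∃ j, Nat.find hex = j + 1 := ⟨Nat.find hex - 1, by omega⟩
  rw [hj] at hl hle hmin
  have hs := pathHeight_succ V j
  have hsx := pathHeight_succ V x
  have hxj : x < j := by
    rcases Nat.lt_succ_iff_lt_or_eq.1 hl with h | h
    · exact h
    · subst h; omega
  have hgt := hmin j (Nat.lt_succ_self j) hxj
  have hstep := hV.step j
  have hVj : V j = -1 := by omega
  refine ⟨j, hxj, ?_⟩
  change arcStart V x = arcStart V j
  rw [arcStart, if_neg (by omega), arcStart, if_pos hVj, eq_comm, Nat.findGreatest_eq_iff]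
  refine ⟨hxj.le, fun _ => by omega, fun l hl hlj => ?_⟩
  have := hmin l (by omega) hl
  omega

theorem arcs_small {x y z : ℕ} (hxy : x < y) (hyz : y < z) (h : arcs V x y) (h' : arcs V x z) :
    False := by
  have h₁ := arcs_lt hV (hxy.trans hyz) h'
  have h₂ := arcs_lt hV hyz ((arcs V).trans ((arcs V).symm h) h')
  omega

/-- The arc from `w` to `y` puts the height at `x` above that at `y + 1`, and the arc from `x` to
`z` puts the height at `y + 1` above that at `x`. -/
theorem arcs_noncrossing {w x y z : ℕ} (hwx : w < x) (hxy : x < y) (hyz : y < z)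
    (h : arcs V w y) (h' : arcs V x z) : False := by
  obtain ⟨h₁, h₂⟩ := arcs_lt hV (hwx.trans hxy) h
  obtain ⟨h₃, h₄⟩ := arcs_lt hV (hxy.trans hyz) h'
  have a := arcStart_spec hV h₁
  have b := arcStart_spec hV h₃
  rw [h₂] at a
  rw [h₄] at b
  have := a.2.2.2 x hwx hxy.le
  have := b.2.2.2 (y + 1) (by omega) hyz
  omega

end Arcs

/-! ## Words of diagrams -/

open scoped Classical in
/-- `1` if the vertex is joined to a later vertex, `-1` if it is joined to an earlier one, and `0`
if it is isolated. -/
def sgn {k : ℕ} (d : Diagram k) (x : Fin k ⊕ Fin k) : SignType :=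
  if ∃ y, d x y ∧ position x < position y then 1
  else if ∃ y, d x y ∧ position y < position x then -1 else 0

/-- The word of the top row of a diagram. -/
def topWord {k : ℕ} (d : Diagram k) (i : Fin k) : SignType := sgn d (.inl i)

theorem sgn_eq_one_iff {k : ℕ} {d : Diagram k} {x : Fin k ⊕ Fin k} :
    sgn d x = 1 ↔ ∃ y, d x y ∧ position x < position y := by
  unfold sgn
  split_ifs <;> simp_all

section Sgn

variable {A : Family} {k : ℕ} {d : Diagram k} (hd : d ∈ A.diagrams k)
include hd

theorem eq_of_rel {x y z : Fin k ⊕ Fin k} (hy : d x y) (hz : d x z) (hyx : y ≠ x) (hzx : z ≠ x) :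
    y = z := by
  rw [mem_diagrams_iff] at hd
  rcases hd.small x trivial y trivial z trivial hy hz with h | h | h
  · exact absurd h.symm hyx
  · exact absurd h.symm hzx
  · exact h

theorem sgn_eq_neg_one_iff {x : Fin k ⊕ Fin k} :
    sgn d x = -1 ↔ ∃ y, d x y ∧ position y < position x := by
  have hne : ∀ {a b : Fin k ⊕ Fin k}, position a < position b → a ≠ b := by
    rintro a b h rfl
    exact lt_irrefl _ h
  by_cases h : ∃ y, d x y ∧ position x < position y
  · rw [sgn_eq_one_iff.2 h]
    refine iff_of_false (by decide) ?_
    rintro ⟨z, hz, hzx⟩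
    obtain ⟨y, hy, hxy⟩ := h
    have := eq_of_rel hd hy hz (hne hxy).symm (hne hzx)
    subst this
    exact lt_asymm hxy hzx
  · unfold sgn
    rw [if_neg h]
    split_ifs with h' <;> simp_all

theorem sgn_eq_zero_iff {x : Fin k ⊕ Fin k} : sgn d x = 0 ↔ ∀ y, d x y → y = x := by
  constructor
  · intro h y hxy
    by_contra hne
    rcases lt_or_gt_of_ne (position_injective.ne hne) with h' | h'
    · rw [(sgn_eq_neg_one_iff hd).2 ⟨y, hxy, h'⟩] at h
      exact absurd h (by decide)
    · rw [sgn_eq_one_iff.2 ⟨y, hxy, h'⟩] at h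
      exact absurd h (by decide)
  · intro h
    unfold sgn
    rw [if_neg, if_neg]
    · rintro ⟨y, hy, h'⟩
      rw [h y hy] at h'
      exact lt_irrefl _ h'
    · rintro ⟨y, hy, h'⟩
      rw [h y hy] at h'
      exact lt_irrefl _ h'

/-- Reflection reverses positions, so earlier and later partners change places. -/
theorem sgn_flip (x : Fin k ⊕ Fin k) : sgn (flip d) x = - sgn d x.swap := by
  have hpos : ∀ {x y : Fin k ⊕ Fin k}, position x < position y ↔
      position y.swap < position x.swap := by
    rintro (⟨x, hx⟩ | ⟨x, hx⟩) (⟨y, hy⟩ | ⟨y, hy⟩) <;>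
      simp only [position, Sum.swap_inl, Sum.swap_inr] <;> omega
  have hsw : ∀ P : Fin k ⊕ Fin k → Prop, (∃ y, P y) ↔ ∃ y, P (Sum.swap y) := fun P =>
    ⟨fun ⟨y, hy⟩ => ⟨y.swap, by rwa [Sum.swap_swap]⟩, fun ⟨y, hy⟩ => ⟨_, hy⟩⟩
  have h1 : sgn (flip d) x = 1 ↔ sgn d x.swap = -1 := by
    rw [sgn_eq_one_iff, sgn_eq_neg_one_iff hd,
      hsw fun y => d x.swap y ∧ position y < position x.swap]
    exact exists_congr fun y => and_congr Iff.rfl hpos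
  have h2 : sgn (flip d) x = -1 ↔ sgn d x.swap = 1 := by
    rw [sgn_eq_neg_one_iff (flip_mem hd), sgn_eq_one_iff,
      hsw fun y => d x.swap y ∧ position x.swap < position y]
    exact exists_congr fun y => and_congr Iff.rfl hpos
  revert h1 h2
  generalize sgn (flip d) x = a
  generalize sgn d x.swap = b
  revert a b
  decide

theorem sgn_inr (i : Fin k) : sgn d (.inr i) = - topWord (flip d) i := by
  rw [topWord, sgn_flip hd, neg_neg]
  rfl

theorem noncrossing_false {w x y z : Fin k ⊕ Fin k} (hwx : position w < position x)
    (hxy : position x < position y) (hyz : position y < position z) (hwy : d w y)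
    (hxz : d x z) : False := by
  have h := (mem_diagrams_iff.1 hd).noncrossing w trivial x trivial y trivial z trivial
    hwx hxy hyz hwy hxz
  have := eq_of_rel hd h hwy (by rintro rfl; omega) (by rintro rfl; omega)
  subst this
  exact lt_irrefl _ hxy

end Sgn

/-! ### A diagram is determined by its signs -/

/-- Descent on the position `P` of the farther partner. In `d'` the closing vertex `y` has a partner
`u`, which noncrossing places between `x` and `y`. In `d` the opening vertex `u` has a partner `v`,
which noncrossing places between `u` and `y`. Then `u`, `v`, `y` form the same configuration with
the smaller value `position y`. -/
theorem partner_le {A : Family} {k : ℕ} (P : ℕ) : ∀ {d d' : Diagram k}, d ∈ A.diagrams k →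
    d' ∈ A.diagrams k → (∀ x, sgn d x = sgn d' x) → ∀ {x y y'}, position x < position y →
    d x y → d' x y' → position y < position y' → position y' = P → False := by
  induction P using Nat.strong_induction_on with
  | _ P ih =>
    intro d d' hd hd' hs x y y' hxy h h' hyy' hP
    have h₁ : sgn d' y = -1 := by
      rw [← hs, sgn_eq_neg_one_iff hd]
      exact ⟨x, d.symm h, hxy⟩
    obtain ⟨u, hu, huy⟩ := (sgn_eq_neg_one_iff hd').1 h₁
    have hxu : position x < position u := by
      by_contra hle
      rcases (not_lt.1 hle).lt_or_eq with hlt | heq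
      · exact noncrossing_false hd' hlt hxy hyy' (d'.symm hu) h'
      · have := position_injective heq
        subst this
        have := eq_of_rel hd' (d'.symm hu) h' (by rintro rfl; omega) (by rintro rfl; omega)
        subst this
        omega
    have h₂ : sgn d u = 1 := by
      rw [hs, sgn_eq_one_iff]
      exact ⟨y, d'.symm hu, huy⟩
    obtain ⟨v, hv, huv⟩ := sgn_eq_one_iff.1 h₂
    have hvy : position v < position y := by
      by_contra hle
      rcases (not_lt.1 hle).lt_or_eq with hlt | heq
      · exact noncrossing_false hd hxu huy hlt h hv
      · have := position_injective heq
        subst this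
        have := eq_of_rel hd (d.symm h) (d.symm hv) (by rintro rfl; omega) (by rintro rfl; omega)
        subst this
        omega
    exact ih (position y) (hP ▸ hyy') hd hd' hs huv hv (d'.symm hu) hvy rfl

theorem diagram_le_of_sgn {A : Family} {k : ℕ} {d d' : Diagram k} (hd : d ∈ A.diagrams k)
    (hd' : d' ∈ A.diagrams k) (hs : ∀ x, sgn d x = sgn d' x) : d ≤ d' := by
  have key : ∀ {x y}, position x < position y → d x y → d' x y := by
    intro x y hxy h
    have h₁ : sgn d' x = 1 := by
      rw [← hs, sgn_eq_one_iff]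
      exact ⟨y, h, hxy⟩
    obtain ⟨y', h', hxy'⟩ := sgn_eq_one_iff.1 h₁
    rcases lt_trichotomy (position y) (position y') with hlt | heq | hlt
    · exact (partner_le _ hd hd' hs hxy h h' hlt rfl).elim
    · rwa [position_injective heq]
    · exact (partner_le _ hd' hd (fun x => (hs x).symm) hxy' h' h hlt rfl).elim
  intro x y h
  rcases lt_trichotomy (position x) (position y) with hlt | heq | hlt
  · exact key hlt h
  · rw [position_injective heq]
  · exact d'.symm (key hlt (d.symm h))

/-- A diagram is determined by the words of its two rows. -/
theorem diagram_ext {A : Family} {k : ℕ} {d d' : Diagram k} (hd : d ∈ A.diagrams k)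
    (hd' : d' ∈ A.diagrams k) (ht : topWord d = topWord d')
    (hb : topWord (flip d) = topWord (flip d')) : d = d' := by
  have hs : ∀ x, sgn d x = sgn d' x := by
    rintro (i | i)
    · exact congrFun ht i
    · rw [sgn_inr hd, sgn_inr hd', hb]
  exact le_antisymm (diagram_le_of_sgn hd hd' hs) (diagram_le_of_sgn hd' hd fun x => (hs x).symm)

/-! ## Words -/

/-- Extension of a word by zeros. -/
def extendWord {k : ℕ} (w : Fin k → SignType) (i : ℕ) : ℤ := if h : i < k then (w ⟨i, h⟩ : ℤ) else 0

/-- Sum of the first `l` letters. -/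
def height {k : ℕ} (w : Fin k → SignType) : ℕ → ℤ := pathHeight (extendWord w)

/-- The words of the rows of the diagrams of rank `m`. -/
structure IsWord (A : Family) {k : ℕ} (m : ℤ) (w : Fin k → SignType) : Prop where
  nonneg : ∀ l ≤ k, 0 ≤ height w l
  total : height w k = m
  ne_zero : A = .temperleyLieb → ∀ i, w i ≠ 0
  ne_neg : A = .planarRook → ∀ i, w i ≠ -1

theorem height_eq {k : ℕ} (w : Fin k → SignType) {l : ℕ} (hl : l ≤ k) :
    height w l = ∑ i : Fin k with i.1 < l, (w i : ℤ) := by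
  rw [Finset.sum_filter, Finset.sum_fin_eq_sum_range, height, pathHeight,
    ← Finset.sum_subset (Finset.range_subset_range.2 hl)]
  · refine Finset.sum_congr rfl fun i hi => ?_
    have h₁ := Finset.mem_range.1 hi
    rw [extendWord, dif_pos (h₁.trans_le hl), dif_pos (h₁.trans_le hl), if_pos h₁]
  · intro i _ hi
    split_ifs with h₁ h₂
    · exact absurd (Finset.mem_range.2 h₂) hi
    · rfl
    · rfl

/-- Matching is an involution on `F` whose pairs contribute `1` and `-1`. -/
theorem sum_matched {A : Family} {k : ℕ} {d : Diagram k} (hd : d ∈ A.diagrams k)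
    (F : Finset (Fin k)) (hF : ∀ i ∈ F, ∃ j ∈ F, j ≠ i ∧ d (.inl i) (.inl j)) :
    ∑ i ∈ F, (topWord d i : ℤ) = 0 := by
  choose g hgF hgne hg using hF
  have hinj : ∀ i hi, g (g i hi) (hgF i hi) = i := fun i hi => by
    have h := eq_of_rel hd (hg (g i hi) (hgF i hi)) (d.symm (hg i hi))
      (by simpa using hgne _ _) (by simpa using (hgne i hi).symm)
    simpa using h
  refine Finset.sum_involution g (fun i hi => ?_) (fun i hi _ => hgne i hi) hgF hinj
  have hrel := hg i hi
  rcases lt_or_gt_of_ne (position_injective.ne (a₁ := .inl (g i hi)) (a₂ := .inl i)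
    (by simpa using hgne i hi)) with h | h
  · have h₁ : topWord d i = -1 := (sgn_eq_neg_one_iff hd).2 ⟨_, hrel, h⟩
    have h₂ : topWord d (g i hi) = 1 := sgn_eq_one_iff.2 ⟨_, d.symm hrel, h⟩
    rw [h₁, h₂]
    rfl
  · have h₁ : topWord d i = 1 := sgn_eq_one_iff.2 ⟨_, hrel, h⟩
    have h₂ : topWord d (g i hi) = -1 := (sgn_eq_neg_one_iff hd).2 ⟨_, d.symm hrel, h⟩
    rw [h₁, h₂]
    rfl

theorem topWord_of_through {k : ℕ} {d : Diagram k}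
    {i : Fin k} (hi : i ∈ through d) : topWord d i = 1 := by
  obtain ⟨j, hj⟩ := hi
  exact sgn_eq_one_iff.2 ⟨_, hj, by
    obtain ⟨i, hi⟩ := i; obtain ⟨j, hj⟩ := j; simp only [position]; omega⟩

/-- Pairs matched inside a prefix cancel. A letter `-1` has its partner earlier in the row, so it
always cancels and prefix sums are nonnegative. Over the whole row the unmatched letters are the
`1`s of propagating vertices and the `0`s of isolated ones, so the total is the rank. -/
theorem isWord_topWord {A : Family} {k : ℕ} {d : Diagram k} (hd : d ∈ A.diagrams k) :
    IsWord A (rank d) (topWord d) := by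
  classical
  have split : ∀ F : Finset (Fin k), ∑ i ∈ F, (topWord d i : ℤ) =
      ∑ i ∈ F with ¬ ∃ j ∈ F, j ≠ i ∧ d (.inl i) (.inl j), (topWord d i : ℤ) := by
    intro F
    rw [← Finset.sum_filter_add_sum_filter_not F fun i => ∃ j ∈ F, j ≠ i ∧ d (.inl i) (.inl j),
      sum_matched hd, zero_add]
    intro i hi
    obtain ⟨hiF, j, hj, hne, h⟩ := Finset.mem_filter.1 hi
    exact ⟨j, Finset.mem_filter.2 ⟨hj, i, hiF, hne.symm, d.symm h⟩, hne, h⟩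
  have hdown : ∀ i, topWord d i = -1 → ∃ j < i, d (.inl i) (.inl j) := by
    intro i hi
    obtain ⟨y, hy, hlt⟩ := (sgn_eq_neg_one_iff hd).1 hi
    rcases y with j | j
    · exact ⟨j, hlt, hy⟩
    · obtain ⟨i, hi⟩ := i
      obtain ⟨j, hj⟩ := j
      simp only [position] at hlt
      omega
  refine ⟨fun l hl => ?_, ?_, fun hA i h => ?_, fun hA i h => ?_⟩
  · rw [height_eq _ hl, split]
    refine Finset.sum_nonneg fun i hi => ?_
    obtain ⟨hi, hno⟩ := Finset.mem_filter.1 hi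
    rcases h : topWord d i with _ | _ | _
    · rfl
    · obtain ⟨j, hji, hj⟩ := hdown i h
      refine absurd ⟨j, ?_, hji.ne, hj⟩ hno
      have : (j : ℕ) < i := hji
      simp only [Finset.mem_filter_univ] at hi ⊢
      omega
    · exact zero_le_one
  · have hterm : ∀ i, (if ¬ ∃ j ∈ Finset.univ, j ≠ i ∧ d (.inl i) (.inl j) then
        (topWord d i : ℤ) else 0) = if i ∈ through d then 1 else 0 := by
      intro i
      by_cases hi : i ∈ through d
      · obtain ⟨l, hl⟩ := id hi
        rw [if_pos hi, if_pos, topWord_of_through hi]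
        · rfl
        · rintro ⟨j, -, hne, hj⟩
          have := eq_of_rel hd hj hl (by simpa using hne) (by simp)
          simp at this
      · rw [if_neg hi]
        split_ifs with h
        · rfl
        · have : topWord d i = 0 := by
            refine (sgn_eq_zero_iff hd).2 ?_
            rintro (j | j) hj
            · by_contra hne
              exact h ⟨j, Finset.mem_univ j, fun e => hne (congrArg _ e), hj⟩
            · exact absurd ⟨j, hj⟩ hi
          rw [this]
          rfl
    rw [height_eq _ le_rfl, rank_eq_ncard hd, Set.ncard_eq_toFinset_card',
      Finset.filter_true_of_mem fun i _ => i.2, split, Finset.sum_filter,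
      Finset.sum_congr rfl fun i _ => hterm i, Finset.sum_boole]
    congr 2
    ext i
    simp
  · obtain ⟨y, -, hne, hy⟩ := (mem_diagrams_iff.1 hd).paired hA (.inl i) trivial
    exact hne ((sgn_eq_zero_iff hd).1 h y hy)
  · obtain ⟨j, hji, hj⟩ := hdown i h
    have := (mem_diagrams_iff.1 hd).transversal hA _ trivial _ trivial hj rfl
    rw [Sum.inl.inj this] at hji
    exact lt_irrefl _ hji

/-- The steps given by the word of the top row and the negated, reversed word of the bottom row. -/
def boundaryWord {k : ℕ} (w w' : Fin k → SignType) (p : ℕ) : ℤ :=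
  if p < k then extendWord w p else if p < 2 * k then - extendWord w' (2 * k - 1 - p) else 0

theorem extendWord_step {k : ℕ} (w : Fin k → SignType) (i : ℕ) :
    extendWord w i = -1 ∨ extendWord w i = 0 ∨ extendWord w i = 1 := by
  unfold extendWord
  split_ifs with h
  · generalize w ⟨i, h⟩ = a
    revert a
    decide
  · exact Or.inr (Or.inl rfl)

/-- The path climbs along `w` to height `m` and then retraces the heights of `w'` backwards; the two
halves fit because the totals agree. -/
theorem isExcursion_boundaryWord {A : Family} {k : ℕ} {m : ℤ} {w w' : Fin k → SignType}
    (hw : IsWord A m w) (hw' : IsWord A m w') : IsExcursion (2 * k) (boundaryWord w w') := by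
  have h₁ : ∀ l ≤ k, pathHeight (boundaryWord w w') l = height w l := by
    intro l hl
    refine Finset.sum_congr rfl fun i hi => ?_
    exact if_pos ((Finset.mem_range.1 hi).trans_le hl)
  have h₂ : ∀ j ≤ k, pathHeight (boundaryWord w w') (k + j) = height w' (k - j) := by
    intro j hj
    induction j with
    | zero => rw [Nat.add_zero, h₁ k le_rfl, hw.total, Nat.sub_zero, hw'.total]
    | succ j ih =>
      have e : k - j = k - (j + 1) + 1 := by omega
      have hs := pathHeight_succ (extendWord w') (k - (j + 1))
      have e' : 2 * k - 1 - (k + j) = k - (j + 1) := by omega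
      rw [← Nat.add_assoc, pathHeight_succ, ih (by omega), boundaryWord, if_neg (by omega),
        if_pos (by omega), e', e, height, hs]
      ring
  refine ⟨fun i => ?_, fun l hl => ?_, ?_, fun i hi => ?_⟩
  · unfold boundaryWord
    split_ifs
    · exact extendWord_step w i
    · rcases extendWord_step w' (2 * k - 1 - i) with h | h | h <;> rw [h] <;> simp
    · exact Or.inr (Or.inl rfl)
  · rcases le_or_gt l k with h | h
    · rw [h₁ l h]
      exact hw.nonneg l h
    · obtain ⟨j, rfl⟩ := Nat.exists_eq_add_of_le h.le
      rw [h₂ j (by omega)]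
      exact hw'.nonneg _ (by omega)
  · rw [Nat.two_mul, h₂ k le_rfl, Nat.sub_self]
    exact Finset.sum_range_zero (extendWord w')
  · rw [boundaryWord, if_neg (by omega), if_neg (by omega)]

theorem boundaryWord_inl {k : ℕ} (w w' : Fin k → SignType) (i : Fin k) :
    boundaryWord w w' (position (.inl i : Fin k ⊕ Fin k)) = w i := by
  rw [boundaryWord, if_pos (show position (.inl i : Fin k ⊕ Fin k) < k from i.2), extendWord,
    dif_pos (show position (.inl i : Fin k ⊕ Fin k) < k from i.2)]
  rfl

theorem boundaryWord_inr {k : ℕ} (w w' : Fin k → SignType) (i : Fin k) :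
    boundaryWord w w' (position (.inr i : Fin k ⊕ Fin k)) = - (w' i : ℤ) := by
  obtain ⟨i, hi⟩ := i
  have h₁ : ¬ position (.inr ⟨i, hi⟩ : Fin k ⊕ Fin k) < k := by simp only [position]; omega
  have h₂ : position (.inr ⟨i, hi⟩ : Fin k ⊕ Fin k) < 2 * k := position_lt _
  have h₃ : 2 * k - 1 - position (.inr ⟨i, hi⟩ : Fin k ⊕ Fin k) = i := by
    simp only [position]; omega
  rw [boundaryWord, if_neg h₁, if_pos h₂, h₃, extendWord, dif_pos hi]

theorem exists_position {k p : ℕ} (hp : p < 2 * k) : ∃ x : Fin k ⊕ Fin k, position x = p := by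
  by_cases h : p < k
  · exact ⟨.inl ⟨p, h⟩, rfl⟩
  · exact ⟨.inr ⟨2 * k - 1 - p, by omega⟩, by simp only [position]; omega⟩

theorem signType_cast_eq_one {a : SignType} : (a : ℤ) = 1 ↔ a = 1 := by revert a; decide

theorem signType_cast_eq_neg_one {a : SignType} : (a : ℤ) = -1 ↔ a = -1 := by revert a; decide

/-- The diagram consists of the arcs of the excursion along the boundary. Without letters `0` every
vertex is matched. Without letters `-1` the top row has only openings and, its word being negated,
the bottom row only closings, so no arc stays in one row. -/
theorem exists_diagram {A : Family} {k : ℕ} {m : ℤ} {w w' : Fin k → SignType}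
    (hw : IsWord A m w) (hw' : IsWord A m w') :
    ∃ d ∈ A.diagrams k, topWord d = w ∧ topWord (flip d) = w' := by
  have hV := isExcursion_boundaryWord hw hw'
  set V := boundaryWord w w' with hVdef
  let d : Diagram k := Setoid.comap position (arcs V)
  have hup : ∀ x : Fin k ⊕ Fin k, V (position x) = 1 ↔ ∃ y, d x y ∧ position x < position y := by
    intro x
    constructor
    · intro h
      obtain ⟨p, hp, hxp⟩ := exists_arc_of_up hV h
      -- Arcs end at down steps, and there are none from time `2k` on.
      have hp2 : p < 2 * k := by
        by_contra hp2
        have h₁ := hV.eventually_zero p (not_lt.1 hp2)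
        have h₂ := (arcs_lt hV hp hxp).1
        omega
      obtain ⟨y, rfl⟩ := exists_position hp2
      exact ⟨y, hxp, hp⟩
    · rintro ⟨y, hy, hxy⟩
      exact arcs_start hV hxy hy
  have hdown : ∀ x : Fin k ⊕ Fin k,
      V (position x) = -1 ↔ ∃ y, d x y ∧ position y < position x := by
    intro x
    constructor
    · intro h
      obtain ⟨p, hp, hxp⟩ := exists_arc_of_down hV h
      obtain ⟨y, rfl⟩ := exists_position (hp.trans (position_lt x))
      exact ⟨y, d.symm hxp, hp⟩
    · rintro ⟨y, hy, hxy⟩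
      exact (arcs_lt hV hxy (d.symm hy)).1
  have hd : d ∈ A.diagrams k := by
    rw [mem_diagrams_iff]
    refine ⟨fun w _ x _ y _ z _ hwx hxy hyz h h' => (arcs_noncrossing hV hwx hxy hyz h h').elim,
      fun x _ y _ z _ h h' => ?_, fun hA x _ => ?_, fun hA x _ y _ h hc => ?_⟩
    · by_contra hne
      push Not at hne
      have n₁ := position_injective.ne hne.1
      have n₂ := position_injective.ne hne.2.1
      have n₃ := position_injective.ne hne.2.2
      have key : ∀ x y z : Fin k ⊕ Fin k, position x < position y → position y < position z →
          d x y → d x z → False := fun x y z => arcs_small hV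
      rcases lt_or_gt_of_ne n₁ with l₁ | l₁ <;> rcases lt_or_gt_of_ne n₂ with l₂ | l₂ <;>
        rcases lt_or_gt_of_ne n₃ with l₃ | l₃
      · exact key x y z l₁ l₃ h h'
      · exact key x z y l₂ l₃ h' h
      · omega
      · exact key z x y l₂ l₁ (d.symm h') (d.trans (d.symm h') h)
      · exact key y x z l₁ l₂ (d.symm h) (d.trans (d.symm h) h')
      · omega
      · exact key y z x l₃ l₂ (d.trans (d.symm h) h') (d.symm h)
      · exact key z y x l₃ l₁ (d.trans (d.symm h') h) (d.symm h')
    · have hne : V (position x) ≠ 0 := by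
        rcases x with x | x
        · rw [hVdef, boundaryWord_inl]
          have := hw.ne_zero hA x
          revert this
          generalize w x = a
          revert a
          decide
        · rw [hVdef, boundaryWord_inr]
          have := hw'.ne_zero hA x
          revert this
          generalize w' x = a
          revert a
          decide
      rcases hV.step (position x) with h | h | h
      · obtain ⟨y, hy, hlt⟩ := (hdown x).1 h
        exact ⟨y, trivial, by rintro rfl; exact lt_irrefl _ hlt, hy⟩
      · exact absurd h hne
      · obtain ⟨y, hy, hlt⟩ := (hup x).1 h
        exact ⟨y, trivial, by rintro rfl; exact lt_irrefl _ hlt, hy⟩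
    · have key : ∀ x y : Fin k ⊕ Fin k, d x y → x.isRight = y.isRight →
          position x < position y → False := by
        rintro (x | x) (y | y) h hc hlt
        · have := (hdown (.inl y)).2 ⟨_, d.symm h, hlt⟩
          rw [hVdef, boundaryWord_inl, signType_cast_eq_neg_one] at this
          exact hw.ne_neg hA y this
        · simp at hc
        · simp at hc
        · have := (hup (.inr x)).2 ⟨_, h, hlt⟩
          rw [hVdef, boundaryWord_inr, neg_eq_iff_eq_neg, signType_cast_eq_neg_one] at this
          exact hw'.ne_neg hA x this
      by_contra hne
      rcases lt_or_gt_of_ne (position_injective.ne hne) with hlt | hlt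
      · exact key x y h hc hlt
      · exact key y x (d.symm h) hc.symm hlt
  have hsgn : ∀ x : Fin k ⊕ Fin k, (sgn d x : ℤ) = V (position x) := by
    intro x
    rcases hV.step (position x) with h | h | h
    · rw [h, signType_cast_eq_neg_one, sgn_eq_neg_one_iff hd]
      exact (hdown x).1 h
    · rw [h]
      rcases hs : sgn d x with _ | _ | _
      · rfl
      · have := (hdown x).2 ((sgn_eq_neg_one_iff hd).1 hs)
        omega
      · have := (hup x).2 (sgn_eq_one_iff.1 hs)
        omega
    · rw [h, signType_cast_eq_one, sgn_eq_one_iff]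
      exact (hup x).1 h
  have hcast : ∀ a b : SignType, (a : ℤ) = b → a = b := by decide
  refine ⟨d, hd, funext fun i => hcast _ _ ?_, funext fun i => hcast _ _ ?_⟩
  · exact (hsgn _).trans (boundaryWord_inl w w' i)
  · have := (hsgn (.inr i)).trans (boundaryWord_inr w w' i)
    rw [sgn_inr hd] at this
    revert this
    generalize topWord (flip d) i = a
    generalize w' i = b
    revert a b
    decide

/-! ## Symmetric diagrams -/

/-- Reflection swaps the two words, so a diagram is its own reflection exactly when they agree; such
diagrams correspond to single words. -/
theorem ncard_symmetricDiagrams (A : Family) (r m : ℕ) :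
    (A.symmetricDiagrams r m).ncard = {w : Fin r → SignType | IsWord A m w}.ncard := by
  have himg : {w : Fin r → SignType | IsWord A m w} = topWord '' A.symmetricDiagrams r m := by
    ext w
    constructor
    · intro hw
      obtain ⟨d, hd, h₁, h₂⟩ := exists_diagram hw hw
      have hflip : flip d = d := diagram_ext (flip_mem hd) hd (h₂.trans h₁.symm)
        (by rw [flip_flip, h₁, h₂])
      refine ⟨d, ⟨hd, hflip, ?_, fun i j hij => ?_⟩, h₁⟩
      · have := (isWord_topWord hd).total
        rw [h₁, hw.total] at this
        exact_mod_cast this.symm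
      -- With the edge from `i` to `j'` comes its mirror image from `j` to `i'`; the two cross
      -- unless `i = j`. So the last condition on symmetric diagrams is automatic here.
      · have hji : d (.inl j) (.inr i) := by
          have : flip d (.inl i) (.inr j) := by rwa [hflip]
          exact d.symm this
        rcases lt_trichotomy i j with h | h | h
        · exact (noncrossing_false hd (w := .inl i) (x := .inl j) (y := .inr j) (z := .inr i) h
            (by simp only [position]; omega)
            (by have : (i : ℕ) < j := h
                simp only [position]; omega) hij hji).elim
        · rwa [← h] at hij
        · exact (noncrossing_false hd (w := .inl j) (x := .inl i) (y := .inr i) (z := .inr j) h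
            (by simp only [position]; omega)
            (by have : (j : ℕ) < i := h
                simp only [position]; omega) hji hij).elim
    · rintro ⟨d, ⟨hd, -, hr, -⟩, rfl⟩
      rw [← hr]
      exact isWord_topWord hd
  rw [himg, Set.InjOn.ncard_image]
  rintro d ⟨hd, hf, -⟩ d' ⟨hd', hf', -⟩ h
  exact diagram_ext hd hd' h (by rw [hf, hf', h])

/-! ## Words with a prescribed tail -/

/-- The word of `e^{⊗ s}`. -/
def tailSign : Family → ℕ → SignType
  | .temperleyLieb, j => if j % 2 = 0 then 1 else -1
  | .motzkin, _ => 0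
  | .planarRook, _ => 0

theorem tailSign_sum (A : Family) (j : ℕ) :
    0 ≤ ∑ i ∈ Finset.range j, (tailSign A i : ℤ) ∧
      ∀ s, j = A.width * s → ∑ i ∈ Finset.range j, (tailSign A i : ℤ) = 0 := by
  cases A with
  | temperleyLieb =>
    have h : ∀ j, ∑ i ∈ Finset.range j, (tailSign .temperleyLieb i : ℤ) =
        if j % 2 = 0 then 0 else 1 := by
      intro j
      induction j with
      | zero => rfl
      | succ j ih =>
        rw [Finset.sum_range_succ, ih]
        simp only [tailSign]
        rcases Nat.mod_two_eq_zero_or_one j with h | h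
        · rw [if_pos h, if_pos h, if_neg (by omega)]; rfl
        · rw [if_neg (by omega), if_neg (by omega), if_pos (by omega)]; rfl
    rw [h]
    refine ⟨by split_ifs <;> simp, fun s hs => if_pos ?_⟩
    simp only [Family.width] at hs
    omega
  | motzkin => simp [tailSign]
  | planarRook => simp [tailSign]

/-- The prescribed tail has nonnegative partial sums and total `0`, consisting of `s` whole groups.
Appending it changes neither admissibility nor the total, so restriction to the first `r` letters is
a bijection. -/
theorem ncard_words_tail (A : Family) {k r s : ℕ} (h : r + A.width * s = k) (m : ℤ) :
    {w : Fin k → SignType | IsWord A m w ∧ ∀ i : Fin k, r ≤ i → w i = tailSign A (i - r)}.ncard =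
      {w : Fin r → SignType | IsWord A m w}.ncard := by
  have hrk : r ≤ k := by omega
  have low : ∀ (w : Fin k → SignType) (l : ℕ), l ≤ r →
      height (fun i : Fin r => w (Fin.castLE hrk i)) l = height w l := by
    intro w l hl
    unfold height pathHeight
    refine Finset.sum_congr rfl fun i hi => ?_
    have := Finset.mem_range.1 hi
    rw [extendWord, extendWord, dif_pos (by omega), dif_pos (by omega)]
    rfl
  have high : ∀ (w : Fin k → SignType), (∀ i : Fin k, r ≤ i → w i = tailSign A (i - r)) →
      ∀ j, r + j ≤ k → height w (r + j) =
        height w r + ∑ i ∈ Finset.range j, (tailSign A i : ℤ) := by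
    intro w hw j hj
    rw [height, pathHeight, Finset.sum_range_add]
    change height w r + _ = _
    congr 1
    refine Finset.sum_congr rfl fun i hi => ?_
    have := Finset.mem_range.1 hi
    rw [extendWord, dif_pos (by omega), hw ⟨r + i, by omega⟩ (Nat.le_add_right r i)]
    simp
  have himg : {w : Fin r → SignType | IsWord A m w} =
      (fun w (i : Fin r) => w (Fin.castLE hrk i)) '' {w : Fin k → SignType |
        IsWord A m w ∧ ∀ i : Fin k, r ≤ i → w i = tailSign A (i - r)} := by
    ext w
    constructor
    · intro hw
      let v : Fin k → SignType := fun i => if hi : i.1 < r then w ⟨i, hi⟩ else tailSign A (i - r)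
      have hv : (fun i : Fin r => v (Fin.castLE hrk i)) = w := by
        funext i
        exact dif_pos i.2
      have hvt : ∀ i : Fin k, r ≤ i → v i = tailSign A (i - r) := fun i hi =>
        dif_neg (not_lt.2 hi)
      have hvr : height v r = m := by rw [← low v r le_rfl, hv, hw.total]
      refine ⟨v, ⟨⟨fun l hl => ?_, ?_, fun hA i => ?_, fun hA i => ?_⟩, hvt⟩, hv⟩
      · rcases le_or_gt l r with h' | h'
        · rw [← low v l h', hv]
          exact hw.nonneg l h'
        · obtain ⟨j, rfl⟩ := Nat.exists_eq_add_of_le h'.le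
          rw [high v hvt j hl, hvr, ← hw.total]
          exact add_nonneg (hw.nonneg r le_rfl) (tailSign_sum A j).1
      · have := high v hvt (A.width * s) h.le
        rw [h] at this
        rw [this, hvr, (tailSign_sum A _).2 s rfl, add_zero]
      · by_cases hi : i.1 < r
        · rw [show v i = w ⟨i, hi⟩ from dif_pos hi]
          exact hw.ne_zero hA _
        · rw [hvt i (not_lt.1 hi), hA, tailSign]
          split_ifs <;> decide
      · by_cases hi : i.1 < r
        · rw [show v i = w ⟨i, hi⟩ from dif_pos hi]
          exact hw.ne_neg hA _
        · rw [hvt i (not_lt.1 hi), hA, tailSign]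
          decide
    · rintro ⟨w, ⟨hw, ht⟩, rfl⟩
      refine ⟨fun l hl => ?_, ?_, fun hA i => hw.ne_zero hA _, fun hA i => hw.ne_neg hA _⟩
      · rw [low w l hl]
        exact hw.nonneg l (hl.trans hrk)
      · have := high w ht (A.width * s) h.le
        rw [h, hw.total, (tailSign_sum A _).2 s rfl, add_zero] at this
        rw [low w r le_rfl, this]
  rw [himg, Set.InjOn.ncard_image]
  rintro w ⟨-, hw⟩ w' ⟨-, hw'⟩ e
  funext i
  by_cases hi : i.1 < r
  · exact congrFun e ⟨i, hi⟩
  · rw [hw i (not_lt.1 hi), hw' i (not_lt.1 hi)]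

/-! ## Counting words -/

/-- The number of words. -/
def wordCount (A : Family) (k : ℕ) (m : ℤ) : ℤ := Nat.card {w : Fin k → SignType // IsWord A m w}

/-- The letters allowed in the words of a family. -/
def IsLetter (A : Family) (a : SignType) : Prop :=
  (A = .temperleyLieb → a ≠ 0) ∧ (A = .planarRook → a ≠ -1)

theorem wordCount_of_neg (A : Family) (k : ℕ) {m : ℤ} (hm : m < 0) : wordCount A k m = 0 := by
  have : IsEmpty {w : Fin k → SignType // IsWord A m w} := by
    refine ⟨fun w => ?_⟩
    have := w.2.nonneg k le_rfl
    rw [w.2.total] at this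
    omega
  rw [wordCount, Nat.card_of_isEmpty]
  rfl

theorem wordCount_zero (A : Family) (m : ℤ) : wordCount A 0 m = if m = 0 then 1 else 0 := by
  have h : ∀ (w : Fin 0 → SignType) l, l ≤ 0 → height w l = 0 := by
    intro w l hl
    rw [Nat.le_zero.1 hl]
    exact Finset.sum_range_zero (extendWord w)
  split_ifs with hm
  · have : ∀ w : Fin 0 → SignType, IsWord A m w := fun w =>
      ⟨fun l hl => (h w l hl).ge, (h w 0 le_rfl).trans hm.symm, fun _ i => i.elim0,
        fun _ i => i.elim0⟩
    rw [wordCount, Nat.card_congr (Equiv.subtypeUnivEquiv this)]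
    simp
  · have : IsEmpty {w : Fin 0 → SignType // IsWord A m w} :=
      ⟨fun w => hm (w.2.total.symm.trans (h w 0 le_rfl))⟩
    rw [wordCount, Nat.card_of_isEmpty]
    rfl

/-- The hypothesis `0 ≤ m` is the nonnegativity condition at the full length, the only one that the
shorter word does not supply. -/
theorem isWord_snoc_iff {A : Family} {k : ℕ} {m : ℤ} (hm : 0 ≤ m) (w : Fin k → SignType)
    (a : SignType) :
    IsWord A m (Fin.snoc w a : Fin (k + 1) → SignType) ↔ IsLetter A a ∧ IsWord A (m - a) w := by
  have low : ∀ l ≤ k, height (Fin.snoc w a : Fin (k + 1) → SignType) l = height w l := by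
    intro l hl
    unfold height pathHeight
    refine Finset.sum_congr rfl fun i hi => ?_
    have hi := Finset.mem_range.1 hi
    rw [extendWord, extendWord, dif_pos (by omega), dif_pos (by omega)]
    exact congrArg _ (Fin.snoc_castSucc (α := fun _ => SignType) a w ⟨i, by omega⟩)
  have last : height (Fin.snoc w a : Fin (k + 1) → SignType) (k + 1) = height w k + a := by
    rw [← low k le_rfl, height, pathHeight_succ]
    congr 1
    rw [extendWord, dif_pos k.lt_succ_self]
    exact congrArg _ (Fin.snoc_last (α := fun _ => SignType) a w)
  constructor
  · intro h
    refine ⟨⟨fun hA => ?_, fun hA => ?_⟩, fun l hl => ?_, ?_, fun hA i => ?_, fun hA i => ?_⟩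
    · simpa using h.ne_zero hA (Fin.last k)
    · simpa using h.ne_neg hA (Fin.last k)
    · rw [← low l hl]
      exact h.nonneg l (hl.trans k.le_succ)
    · rw [← h.total, last, add_sub_cancel_right]
    · simpa using h.ne_zero hA i.castSucc
    · simpa using h.ne_neg hA i.castSucc
  · rintro ⟨ha, h⟩
    refine ⟨fun l hl => ?_, ?_, fun hA i => ?_, fun hA i => ?_⟩
    · rcases Nat.le_succ_iff.1 hl with h' | rfl
      · rw [low l h']
        exact h.nonneg l h'
      · rw [last, h.total, sub_add_cancel]
        exact hm
    · rw [last, h.total, sub_add_cancel]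
    · refine Fin.lastCases ?_ (fun i => ?_) i
      · simpa using ha.1 hA
      · simpa using h.ne_zero hA i
    · refine Fin.lastCases ?_ (fun i => ?_) i
      · simpa using ha.2 hA
      · simpa using h.ne_neg hA i

open scoped Classical in
theorem wordCount_succ (A : Family) (k : ℕ) {m : ℤ} (hm : 0 ≤ m) :
    wordCount A (k + 1) m = ∑ a : SignType, if IsLetter A a then wordCount A k (m - a) else 0 := by
  let e : {w : Fin (k + 1) → SignType // IsWord A m w} ≃
      Σ a : SignType, {w : Fin k → SignType // IsLetter A a ∧ IsWord A (m - a) w} :=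
    ((Fin.snocEquiv fun _ => SignType).symm.subtypeEquiv
      (q := fun x => IsLetter A x.1 ∧ IsWord A (m - x.1) x.2) fun w => by
        obtain ⟨⟨a, v⟩, rfl⟩ := (Fin.snocEquiv fun _ => SignType).surjective w
        rw [Equiv.symm_apply_apply]
        exact isWord_snoc_iff hm v a).trans
      (Equiv.subtypeProdEquivSigmaSubtype fun a w => IsLetter A a ∧ IsWord A (m - a) w)
  rw [wordCount, Nat.card_congr e, Nat.card_sigma, Nat.cast_sum]
  refine Finset.sum_congr rfl fun a _ => ?_
  split_ifs with h
  · simp only [h, true_and]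
    rfl
  · simp [h]

theorem wordCount_temperleyLieb_succ (k : ℕ) {m : ℤ} (hm : 0 ≤ m) :
    wordCount .temperleyLieb (k + 1) m =
      wordCount .temperleyLieb k (m - 1) + wordCount .temperleyLieb k (m + 1) := by
  rw [wordCount_succ _ _ hm, SignType.univ_eq]
  simp [IsLetter, add_comm]

theorem wordCount_motzkin_succ (k : ℕ) {m : ℤ} (hm : 0 ≤ m) :
    wordCount .motzkin (k + 1) m = wordCount .motzkin k m +
      (wordCount .motzkin k (m - 1) + wordCount .motzkin k (m + 1)) := by
  rw [wordCount_succ _ _ hm, SignType.univ_eq]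
  simp [IsLetter, add_comm]

theorem wordCount_planarRook_succ (k : ℕ) {m : ℤ} (hm : 0 ≤ m) :
    wordCount .planarRook (k + 1) m =
      wordCount .planarRook k m + wordCount .planarRook k (m - 1) := by
  rw [wordCount_succ _ _ hm, SignType.univ_eq]
  simp [IsLetter]

theorem binom_zero (b : ℤ) : binom 0 b = if b = 0 then 1 else 0 := by
  unfold binom
  split_ifs with h₁ h₂ h₂
  · omega
  · rfl
  · subst h₂; rfl
  · rw [Nat.choose_eq_zero_of_lt (by omega)]
    rfl

theorem binom_succ (a : ℕ) (b : ℤ) : binom (a + 1) b = binom a b + binom a (b - 1) := by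
  unfold binom
  rcases lt_trichotomy b 0 with h | h | h
  · rw [if_pos h, if_pos h, if_pos (by omega)]
    rfl
  · subst h
    simp
  · obtain ⟨c, hc⟩ : ∃ c : ℕ, b = c + 1 := ⟨(b - 1).toNat, by omega⟩
    subst hc
    have e₁ : ((c : ℤ) + 1).toNat = c + 1 := by omega
    have e₂ : ((c : ℤ) + 1 - 1).toNat = c := by omega
    rw [if_neg (by omega), if_neg (by omega), if_neg (by omega), e₁, e₂, Nat.choose_succ_succ]
    push_cast
    ring

/-- The conventions for entries out of range match: one lower entry is negative exactly when the
other exceeds `a`. -/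
theorem binom_symm {a : ℕ} {b c : ℤ} (h : b + c = a) : binom a b = binom a c := by
  unfold binom
  split_ifs with h₁ h₂ h₂
  · rfl
  · rw [Nat.choose_eq_zero_of_lt (by omega)]
    rfl
  · rw [Nat.choose_eq_zero_of_lt (by omega)]
    rfl
  · rw [Nat.choose_symm_of_eq_add (show a = b.toNat + c.toNat by omega)]

/-- Ballot numbers, with `j` the number of down steps. The range of `j` includes total `-1`, since
the recurrence at total `0` refers to it. -/
theorem wordCount_temperleyLieb (N : ℕ) : ∀ j : ℤ, 2 * j ≤ N + 1 →
    wordCount .temperleyLieb N (N - 2 * j) = binom N j - binom N (j - 1) := by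
  induction N with
  | zero =>
    intro j hj
    rw [wordCount_zero, binom_zero, binom_zero]
    push_cast at hj ⊢
    split_ifs <;> omega
  | succ N ih =>
    intro j hj
    push_cast at hj ⊢
    rcases hj.eq_or_lt with h | h
    -- Total `-1`: no words on the left, and symmetric binomials cancel on the right.
    · rw [wordCount_of_neg _ _ (by omega), binom_symm (b := j) (c := j - 1) (by push_cast; omega),
        sub_self]
    · have e₁ : (N : ℤ) + 1 - 2 * j - 1 = N - 2 * j := by ring
      have e₂ : (N : ℤ) + 1 - 2 * j + 1 = N - 2 * (j - 1) := by ring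
      rw [wordCount_temperleyLieb_succ _ (by omega), e₁, e₂, ih j (by omega),
        ih (j - 1) (by omega), binom_succ, binom_succ]
      ring

theorem wordCount_temperleyLieb_of_odd (N : ℕ) : ∀ m : ℤ, (N - m) % 2 = 1 →
    wordCount .temperleyLieb N m = 0 := by
  induction N with
  | zero =>
    intro m hm
    rw [wordCount_zero, if_neg (by rintro rfl; simp at hm)]
  | succ N ih =>
    intro m hm
    push_cast at hm
    rcases lt_or_ge m 0 with h | h
    · exact wordCount_of_neg _ _ h
    · rw [wordCount_temperleyLieb_succ _ h, ih _ (by omega), ih _ (by omega), add_zero]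

theorem wordCount_planarRook (k : ℕ) : ∀ m : ℤ, wordCount .planarRook k m = binom k m := by
  induction k with
  | zero => intro m; rw [wordCount_zero, binom_zero]
  | succ k ih =>
    intro m
    rcases lt_or_ge m 0 with h | h
    · rw [wordCount_of_neg _ _ h, binom, if_pos h]
    · rw [wordCount_planarRook_succ _ h, ih, ih, binom_succ]

/-- Zeros do not change heights: a Motzkin word is a choice of the `N` positions of its nonzero
letters together with a Temperley–Lieb word on them. The formal proof compares recurrences through
Pascal's rule. -/
theorem wordCount_motzkin_eq_sum (k : ℕ) : ∀ m : ℤ, wordCount .motzkin k m =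
    ∑ N ∈ Finset.range (k + 1), (k.choose N : ℤ) * wordCount .temperleyLieb N m := by
  induction k with
  | zero => intro m; simp [wordCount_zero]
  | succ k ih =>
    intro m
    rcases lt_or_ge m 0 with h | h
    · rw [wordCount_of_neg _ _ h]
      exact (Finset.sum_eq_zero fun N _ => by rw [wordCount_of_neg _ _ h, mul_zero]).symm
    · rw [wordCount_motzkin_succ _ h, ih, ih, ih, ← Finset.sum_add_distrib,
        Finset.sum_range_succ' _ (k + 1)]
      have e : ∑ N ∈ Finset.range (k + 1), (((k + 1).choose (N + 1) : ℕ) : ℤ) *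
          wordCount .temperleyLieb (N + 1) m =
          ∑ N ∈ Finset.range (k + 1), ((k.choose N : ℤ) * wordCount .temperleyLieb N (m - 1) +
            (k.choose N : ℤ) * wordCount .temperleyLieb N (m + 1)) +
          ∑ N ∈ Finset.range (k + 1), (k.choose (N + 1) : ℤ) *
            wordCount .temperleyLieb (N + 1) m := by
        rw [← Finset.sum_add_distrib]
        refine Finset.sum_congr rfl fun N _ => ?_
        rw [Nat.choose_succ_succ, wordCount_temperleyLieb_succ _ h]
        push_cast
        ring
      have e' : ∑ N ∈ Finset.range (k + 1), (k.choose N : ℤ) * wordCount .temperleyLieb N m =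
          ∑ N ∈ Finset.range (k + 1), (k.choose (N + 1) : ℤ) * wordCount .temperleyLieb (N + 1) m +
            wordCount .temperleyLieb 0 m := by
        have h₁ := Finset.sum_range_succ
          (fun N => (k.choose N : ℤ) * wordCount .temperleyLieb N m) (k + 1)
        rw [Finset.sum_range_succ'] at h₁
        simpa using h₁.symm
      rw [e, e']
      simp only [Nat.choose_zero_right, Nat.cast_one, one_mul]
      ring

theorem wordCount_motzkin (k m : ℕ) : wordCount .motzkin k m =
    ∑ t ∈ Finset.range (k + 1), binom k (m + 2 * t) *
      (binom (m + 2 * t) t - binom (m + 2 * t) (t - 1)) := by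
  -- The range is enlarged to contain every `N = m + 2t` with `t ≤ k`; the added binomials vanish.
  -- Values of `N` of the wrong parity or below `m` contribute nothing.
  rw [wordCount_motzkin_eq_sum, Finset.sum_subset
    (Finset.range_subset_range.2 (show k + 1 ≤ m + 2 * k + 1 by omega))]
  · refine (Finset.sum_of_injOn (fun t => m + 2 * t) (fun a _ b _ h => by simpa using h)
      (fun t ht => ?_) (fun N _ hN => ?_) fun t _ => ?_).symm
    · simp only [Finset.coe_range, Set.mem_Iio] at ht ⊢
      omega
    · rcases Nat.lt_or_ge k N with hk | hk
      · rw [Nat.choose_eq_zero_of_lt hk]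
        simp
      rcases Int.emod_two_eq_zero_or_one ((N : ℤ) - m) with h | h
      · obtain ⟨j, hj⟩ : ∃ j : ℤ, (m : ℤ) = N - 2 * j := ⟨((N : ℤ) - m) / 2, by omega⟩
        have hj0 : j < 0 := by
          by_contra hj0
          refine hN ⟨j.toNat, ?_, ?_⟩
          · simp only [Finset.coe_range, Set.mem_Iio]
            omega
          · simp only
            omega
        rw [hj, wordCount_temperleyLieb _ _ (by omega), binom, binom, if_pos hj0,
          if_pos (by omega)]
        simp
      · rw [wordCount_temperleyLieb_of_odd _ _ h, mul_zero]
    · have e : (m : ℤ) = ((m + 2 * t : ℕ) : ℤ) - 2 * t := by push_cast; ring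
      have h := wordCount_temperleyLieb (m + 2 * t) t (by push_cast; omega)
      rw [← e] at h
      rw [h]
      congr 1
  · intro N _ hN
    rw [Nat.choose_eq_zero_of_lt (by simpa using hN)]
    simp

theorem ncard_words (A : Family) (r : ℕ) (m : ℤ) :
    ({w : Fin r → SignType | IsWord A m w}.ncard : ℤ) = wordCount A r m := rfl

/-! ## The diagrams of the idempotents -/

theorem width_pos (A : Family) : 0 < A.width := by cases A <;> decide

theorem flip_tailDiagram (b k r : ℕ) : flip (tailDiagram b k r) = tailDiagram b k r := by
  ext x y
  change tailLabel b k r x.swap = tailLabel b k r y.swap ↔ tailLabel b k r x = tailLabel b k r y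
  rcases x with x | x <;> rcases y with y | y <;>
    simp only [tailLabel, Sum.swap_inl, Sum.swap_inr] <;> split_ifs <;> simp

theorem tailDiagram_isolated {b k r : ℕ} {i : Fin k} (hi : r ≤ i) (j : Fin k) :
    ¬ tailDiagram b k r (.inl i) (.inr j) := by
  rw [tailDiagram_iff]
  simp only [tailLabel, if_neg (not_lt.2 hi)]
  split_ifs <;> simp

theorem through_tailDiagram (b k r : ℕ) : through (tailDiagram b k r) = {i : Fin k | i.1 < r} := by
  ext i
  constructor
  · rintro ⟨j, hj⟩
    by_contra h
    exact tailDiagram_isolated (not_lt.1 h) j hj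
  · intro hi
    have hi : i.1 < r := hi
    exact ⟨i, by rw [tailDiagram_iff]; simp [tailLabel, hi]⟩

theorem ncard_lt {k r : ℕ} (h : r ≤ k) : {i : Fin k | i.1 < r}.ncard = r := by
  rw [Set.ncard_eq_toFinset_card', Set.toFinset_ofPred]
  simp [Fin.card_filter_val_lt, h]

theorem rank_tailDiagram (A : Family) {k r s : ℕ} (h : r + A.width * s = k) :
    rank (tailDiagram A.width k r) = r := by
  rw [rank_eq_ncard (tailDiagram_mem A h), through_tailDiagram, ncard_lt (by omega)]

theorem topWord_tailDiagram (A : Family) {k r s : ℕ} (h : r + A.width * s = k) {i : Fin k}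
    (hi : r ≤ i) : topWord (tailDiagram A.width k r) i = tailSign A (i - r) := by
  have ht := tailDiagram_mem A h
  obtain ⟨i, hik⟩ := i
  have hi : r ≤ i := hi
  have single : A.width = 1 → topWord (tailDiagram A.width k r) ⟨i, hik⟩ = 0 := by
    intro hw
    refine (sgn_eq_zero_iff ht).2 ?_
    rintro (⟨j, hj⟩ | j) hij
    · rw [tailDiagram_iff] at hij
      simp only [tailLabel, hw, if_neg (not_lt.2 hi), Nat.div_one] at hij
      split_ifs at hij <;> simp only [Prod.mk.injEq] at hij
      · omega
      · simp only [Sum.inl.injEq, Fin.mk.injEq]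
        omega
    · exact absurd hij (tailDiagram_isolated hi j)
  cases A with
  | motzkin => exact single rfl
  | planarRook => exact single rfl
  | temperleyLieb =>
    simp only [Family.width] at h ht ⊢
    simp only [tailSign]
    split_ifs with hpar
    · refine sgn_eq_one_iff.2 ⟨.inl ⟨i + 1, by omega⟩, ?_, by simp [position]⟩
      rw [tailDiagram_iff]
      simp only [tailLabel]
      rw [if_neg (by omega), if_neg (by omega)]
      simp only [Prod.mk.injEq, true_and]
      omega
    · refine (sgn_eq_neg_one_iff ht).2 ⟨.inl ⟨i - 1, by omega⟩, ?_, by simp [position]; omega⟩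
      rw [tailDiagram_iff]
      simp only [tailLabel]
      rw [if_neg (by omega), if_neg (by omega)]
      simp only [Prod.mk.injEq, true_and]
      omega

/-- The first `r` columns of the tail diagram are vertical edges, and in the other columns `d`
already has the same top blocks, so nothing changes. -/
theorem tailDiagram_comp {b k r : ℕ} {d : Diagram k}
    (hd : ∀ i : Fin k, r ≤ i → ∀ x, d (.inl i) x ↔ tailDiagram b k r (.inl i) x) :
    comp (tailDiagram b k r) d = d := by
  have hcross : ∀ i : Fin k, i.1 < r → tailDiagram b k r (.inl i) (.inr i) := by
    intro i hi
    rw [tailDiagram_iff]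
    simp [tailLabel, hi]
  have hcross' : ∀ i j : Fin k, tailDiagram b k r (.inl i) (.inr j) → i = j := by
    intro i j hij
    rw [tailDiagram_iff] at hij
    simp only [tailLabel] at hij
    split_ifs at hij <;> simp only [Prod.mk.injEq] at hij
    · exact Fin.ext hij.2
    all_goals omega
  have htop : ∀ i j, tailDiagram b k r (.inl i) (.inl j) → d (.inl i) (.inl j) := by
    intro i j hij
    rcases lt_or_ge i.1 r with hi | hi
    · have hij' := hij
      rw [tailDiagram_iff] at hij'
      simp only [tailLabel, if_pos hi] at hij'
      split_ifs at hij' <;> simp only [Prod.mk.injEq] at hij'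
      · rw [Fin.ext hij'.2]
      · omega
    · exact (hd i hi _).2 hij
  have hbot : ∀ i j : Fin k, tailDiagram b k r (.inr i) (.inr j) →
      tailDiagram b k r (.inl i) (.inl j) := by
    intro i j hij
    rw [← flip_tailDiagram]
    exact hij
  refine le_antisymm (fun x y h => ?_) fun x y h => ?_
  -- Folding the top row onto the middle row turns every connection of the stacked picture into one
  -- of `d`.
  · let φ : Fin k ⊕ Fin k ⊕ Fin k → Fin k ⊕ Fin k
      | .inl i => .inl i
      | .inr (.inl i) => .inl i
      | .inr (.inr i) => .inr i
    have key : stack (tailDiagram b k r) d ≤ Setoid.comap φ d := by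
      intro x y h
      induction h with
      | rel x y h =>
        rcases h with ⟨u, v, h, rfl, rfl⟩ | ⟨u, v, h, rfl, rfl⟩
        · rcases u with u | u <;> rcases v with v | v
          · exact htop u v h
          · rw [hcross' u v h]
            exact Setoid.refl' d _
          · rw [← hcross' v u (Setoid.symm' _ h)]
            exact Setoid.refl' d _
          · exact htop u v (hbot u v h)
        · rcases u with u | u <;> rcases v with v | v <;> exact h
      | refl x => exact Setoid.refl' _ _
      | symm x y _ ih => exact Setoid.symm' _ ih
      | trans x y z _ _ ih₁ ih₂ => exact Setoid.trans' _ ih₁ ih₂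
    have := key h
    rcases x with x | x <;> rcases y with y | y <;> exact this
  · have main : ∀ x y, (∀ i : Fin k, x = .inl i → i.1 < r) → (∀ i : Fin k, y = .inl i → i.1 < r) →
        d x y → comp (tailDiagram b k r) d x y := by
      have hlink : ∀ x, (∀ i : Fin k, x = .inl i → i.1 < r) →
          stack (tailDiagram b k r) d (outer x) (lower x) := by
        rintro (i | i) hx
        · exact FourRows.stack_upper d (hcross i (hx i rfl))
        · exact Setoid.refl' _ _
      intro x y hx hy h
      exact Setoid.trans' (stack (tailDiagram b k r) d) (hlink x hx) (Setoid.trans' _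
        (FourRows.stack_lower _ h) (Setoid.symm' _ (hlink y hy)))
    have tail : ∀ (i : Fin k) y, r ≤ i → d (.inl i) y → comp (tailDiagram b k r) d (.inl i) y :=
      fun i y hi h => (comp_left_of_isolated (tailDiagram_isolated hi) y).2 ((hd i hi y).1 h)
    by_cases hx : ∀ i : Fin k, x = .inl i → i.1 < r
    · by_cases hy : ∀ i : Fin k, y = .inl i → i.1 < r
      · exact main x y hx hy h
      · push Not at hy
        obtain ⟨i, rfl, hi⟩ := hy
        exact Setoid.symm' _ (tail i x hi (Setoid.symm' d h))
    · push Not at hx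
      obtain ⟨i, rfl, hi⟩ := hx
      exact tail i y hi h

theorem tailDiagram_comp_self (b k r : ℕ) :
    comp (tailDiagram b k r) (tailDiagram b k r) = tailDiagram b k r :=
  tailDiagram_comp fun _ _ _ => Iff.rfl

/-- Each of the `s` groups of middle vertices closes up to a component. The resulting factor `n ^ s`
makes the normalised element idempotent. -/
theorem loops_tailDiagram (A : Family) {k r s : ℕ} (h : r + A.width * s = k) :
    loops (tailDiagram A.width k r) (tailDiagram A.width k r) = s := by
  have hb := width_pos A
  generalize A.width = b at h hb
  let t := tailDiagram b k r
  -- An invariant of components; the value `3`, used for middle groups only, separates them from the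
  -- outer rows, and the quotient by `b` separates them from each other.
  let label : Fin k ⊕ Fin k ⊕ Fin k → ℕ × ℕ
    | .inl i => tailLabel b k r (.inl i)
    | .inr (.inl i) => if (i : ℕ) < r then (0, i) else (3, (i - r) / b)
    | .inr (.inr i) => tailLabel b k r (.inr i)
  have hup : ∀ {x y}, t x y → label (upper x) = label (upper y) := by
    intro x y hxy
    rw [tailDiagram_iff] at hxy
    rcases x with x | x <;> rcases y with y | y <;> simp only [tailLabel, label, upper] at hxy ⊢ <;>
      split_ifs at hxy ⊢ <;> simp only [Prod.mk.injEq] at hxy ⊢ <;> omega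
  have hlow : ∀ {x y}, t x y → label (lower x) = label (lower y) := by
    intro x y hxy
    rw [tailDiagram_iff] at hxy
    rcases x with x | x <;> rcases y with y | y <;> simp only [tailLabel, label, lower] at hxy ⊢ <;>
      split_ifs at hxy ⊢ <;> simp only [Prod.mk.injEq] at hxy ⊢ <;> omega
  have hker : stack t t ≤ Setoid.ker label := by
    intro x y h
    induction h with
    | rel x y h =>
      rcases h with ⟨u, v, h, rfl, rfl⟩ | ⟨u, v, h, rfl, rfl⟩
      · exact hup h
      · exact hlow h
    | refl x => rfl
    | symm x y _ ih => exact Setoid.symm' _ ih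
    | trans x y z _ _ ih₁ ih₂ => exact Setoid.trans' _ ih₁ ih₂
  have hlt : ∀ a : Fin s, r + b * a.1 < k := by
    intro a
    have := Nat.mul_lt_mul_of_pos_left a.2 hb
    omega
  let f : Fin s → {c : Quotient (stack t t) // ∀ x, Quotient.mk (stack t t) (outer x) ≠ c} :=
    fun a => ⟨Quotient.mk (stack t t) (.inr (.inl ⟨r + b * a, hlt a⟩)), by
      intro x hx
      have h' : label (outer x) = label (.inr (.inl ⟨r + b * a, hlt a⟩)) :=
        hker (Quotient.exact (s := stack t t) hx)
      rcases x with x | x <;> simp only [label, outer, tailLabel] at h' <;> split_ifs at h' <;>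
        simp only [Prod.mk.injEq] at h' <;> omega⟩
  have hf : Function.Bijective f := by
    constructor
    · intro a a' e
      have h' : label (.inr (.inl ⟨r + b * a, hlt a⟩)) =
          label (.inr (.inl ⟨r + b * a', hlt a'⟩)) :=
        hker (Quotient.exact (s := stack t t) (congrArg Subtype.val e))
      simp only [label] at h'
      rw [if_neg (by omega), if_neg (by omega)] at h'
      simp only [Prod.mk.injEq, true_and, Nat.add_sub_cancel_left, Nat.mul_div_cancel_left _ hb]
        at h'
      exact Fin.ext h'
    · rintro ⟨c, hc⟩
      induction c using Quotient.inductionOn with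
      | h x =>
        rcases x with i | i | i
        · exact absurd rfl (hc (.inl i))
        · rcases lt_or_ge i.1 r with hi | hi
          · refine absurd (Quotient.sound (s := stack t t) ?_) (hc (.inl i))
            have : t (.inl i) (.inr i) := by
              rw [tailDiagram_iff]
              simp [tailLabel, hi]
            exact FourRows.stack_upper t this
          · have hdiv : (i.1 - r) / b < s := by
              rw [Nat.div_lt_iff_lt_mul hb, Nat.mul_comm]
              omega
            refine ⟨⟨(i.1 - r) / b, hdiv⟩, Subtype.ext (Quotient.sound (s := stack t t) ?_)⟩
            have : t (.inl ⟨r + b * ((i.1 - r) / b), hlt ⟨_, hdiv⟩⟩) (.inl i) := by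
              rw [tailDiagram_iff]
              simp only [tailLabel]
              rw [if_neg (by omega), if_neg (by omega), Nat.add_sub_cancel_left,
                Nat.mul_div_cancel_left _ hb]
            exact FourRows.stack_lower t this
        · exact absurd rfl (hc (.inr i))
  change Nat.card {c : Quotient (stack t t) // ∀ x, Quotient.mk (stack t t) (outer x) ≠ c} = s
  rw [← Nat.card_congr (Equiv.ofBijective f hf), Nat.card_eq_fintype_card, Fintype.card_fin]

theorem topWord_tailDiagram_comp (A : Family) {k r s : ℕ} (h : r + A.width * s = k) (d : Diagram k)
    {i : Fin k} (hi : r ≤ i) : topWord (comp (tailDiagram A.width k r) d) i = tailSign A (i - r) := by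
  rw [← topWord_tailDiagram A h hi]
  have := comp_left_of_isolated (d₂ := d) (tailDiagram_isolated (b := A.width) hi)
  classical
  exact if_congr (exists_congr fun y => and_congr_left' (this y)) rfl
    (if_congr (exists_congr fun y => and_congr_left' (this y)) rfl rfl)

/-- A diagram of rank `r` that starts with `1_r ⊗ e^{⊗ s}` has the top row of that diagram. -/
theorem topWord_eq_of_rank {A : Family} {k r s : ℕ} (h : r + A.width * s = k) {d : Diagram k}
    (hd : d ∈ A.diagrams k) (hr : rank (comp (tailDiagram A.width k r) d) = r) :
    topWord (comp (tailDiagram A.width k r) d) = topWord (tailDiagram A.width k r) := by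
  have hc := comp_mem (tailDiagram_mem A h) hd
  -- Concatenation creates no new propagating top vertex, so equal ranks force equal sets.
  have hth : through (comp (tailDiagram A.width k r) d) = through (tailDiagram A.width k r) := by
    refine Set.eq_of_subset_of_ncard_le (through_comp_subset _ _) ?_
    rw [← rank_eq_ncard hc, ← rank_eq_ncard (tailDiagram_mem A h), hr, rank_tailDiagram A h]
  funext i
  rcases lt_or_ge i.1 r with hi | hi
  · have hi' : i ∈ through (tailDiagram A.width k r) := by
      rw [through_tailDiagram]
      exact hi
    rw [topWord_of_through hi', topWord_of_through (hth ▸ hi')]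
  · rw [topWord_tailDiagram_comp A h d hi, topWord_tailDiagram A h hi]

theorem comp_assoc {k : ℕ} (d₁ d₂ d₃ : Diagram k) :
    comp (comp d₁ d₂) d₃ = comp d₁ (comp d₂ d₃) := (comp_assoc_loops d₁ d₂ d₃).2

/-- Full rank forces the top word to be that of the tail diagram, and by reflection the bottom word
too; the two words determine the diagram. -/
theorem sandwich_eq {A : Family} {k r s : ℕ} (h : r + A.width * s = k) {d : Diagram k}
    (hd : d ∈ A.diagrams k)
    (hr : rank (comp (tailDiagram A.width k r) (comp d (tailDiagram A.width k r))) = r) :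
    comp (tailDiagram A.width k r) (comp d (tailDiagram A.width k r)) =
      tailDiagram A.width k r := by
  have ht := tailDiagram_mem A h
  have hflip : flip (comp (tailDiagram A.width k r) (comp d (tailDiagram A.width k r))) =
      comp (tailDiagram A.width k r) (comp (flip d) (tailDiagram A.width k r)) := by
    rw [← comp_flip, ← comp_flip, flip_tailDiagram, comp_assoc]
  refine diagram_ext (comp_mem ht (comp_mem hd ht)) ht
    (topWord_eq_of_rank h (comp_mem hd ht) hr) ?_
  rw [hflip, flip_tailDiagram]
  refine topWord_eq_of_rank h (comp_mem (flip_mem hd) ht) ?_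
  rw [← hflip, rank_flip, hr]

/-- If an opening vertex followed directly by a closing one were not joined to it, their two arcs
would cross. -/
theorem rel_of_adjacent {A : Family} {k : ℕ} {d : Diagram k} (hd : d ∈ A.diagrams k)
    {i j : Fin k} (hij : j.1 = i.1 + 1) (hi : topWord d i = 1) (hj : topWord d j = -1) :
    d (.inl i) (.inl j) := by
  obtain ⟨x, hx, hix⟩ := sgn_eq_one_iff.1 hi
  obtain ⟨y, hy, hyj⟩ := (sgn_eq_neg_one_iff hd).1 hj
  have pi : position (.inl i : Fin k ⊕ Fin k) = i := rfl
  have pj : position (.inl j : Fin k ⊕ Fin k) = j := rfl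
  by_cases hxj : x = .inl j
  · rwa [hxj] at hx
  by_cases hyi : y = .inl i
  · rw [hyi] at hy
    exact Setoid.symm' d hy
  have n₁ := position_injective.ne hxj
  have n₂ := position_injective.ne hyi
  exact (noncrossing_false hd (w := y) (x := .inl i) (y := .inl j) (z := x) (by omega) (by omega)
    (by omega) (Setoid.symm' d hy) hx).elim

/-- The tail letters determine the blocks there: `0` is an isolated vertex, and an adjacent pair `1,
-1` is matched. So `tailDiagram_comp` applies. -/
theorem tailDiagram_comp_of_topWord {A : Family} {k r s : ℕ} (h : r + A.width * s = k)
    {d : Diagram k} (hd : d ∈ A.diagrams k)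
    (hw : ∀ i : Fin k, r ≤ i → topWord d i = tailSign A (i - r)) :
    comp (tailDiagram A.width k r) d = d := by
  have ht := tailDiagram_mem A h
  have htw := fun (i : Fin k) (hi : r ≤ i) => topWord_tailDiagram A h hi
  refine tailDiagram_comp fun i hi x => ?_
  generalize tailDiagram A.width k r = t at ht htw
  have single : tailSign A (i - r) = 0 → (d (.inl i) x ↔ t (.inl i) x) := by
    intro h0
    have h₁ := (sgn_eq_zero_iff hd).1 ((hw i hi).trans h0)
    have h₂ := (sgn_eq_zero_iff ht).1 ((htw i hi).trans h0)
    constructor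
    · intro hx
      rw [h₁ x hx]
    · intro hx
      rw [h₂ x hx]
  have pair : ∀ j, j ≠ i → d (.inl i) (.inl j) → t (.inl i) (.inl j) →
      (d (.inl i) x ↔ t (.inl i) x) := by
    intro j hj h₁ h₂
    have hj' : (.inl j : Fin k ⊕ Fin k) ≠ .inl i := by simpa using hj
    by_cases hx : x = .inl i
    · rw [hx]
      exact iff_of_true (Setoid.refl' _ _) (Setoid.refl' _ _)
    constructor
    · intro h
      rwa [eq_of_rel hd h h₁ hx hj']
    · intro h
      rwa [eq_of_rel ht h h₂ hx hj']
  cases A with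
  | motzkin => exact single rfl
  | planarRook => exact single rfl
  | temperleyLieb =>
    simp only [Family.width] at h
    obtain ⟨i, hik⟩ := i
    have hi : r ≤ i := hi
    simp only [tailSign] at hw htw
    rcases Nat.mod_two_eq_zero_or_one (i - r) with hp | hp
    · have key : ∀ {d : Diagram k}, d ∈ Family.temperleyLieb.diagrams k →
          (∀ i : Fin k, r ≤ i → topWord d i = if (i - r) % 2 = 0 then 1 else -1) →
          d (.inl ⟨i, hik⟩) (.inl ⟨i + 1, by omega⟩) := by
        intro d hd hw
        refine rel_of_adjacent hd rfl ?_ ?_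
        · rw [hw _ hi, if_pos hp]
        · rw [hw _ (show r ≤ i + 1 by omega), if_neg (by simp only; omega)]
      exact pair _ (by simp) (key hd hw) (key ht htw)
    · have key : ∀ {d : Diagram k}, d ∈ Family.temperleyLieb.diagrams k →
          (∀ i : Fin k, r ≤ i → topWord d i = if (i - r) % 2 = 0 then 1 else -1) →
          d (.inl ⟨i, hik⟩) (.inl ⟨i - 1, by omega⟩) := by
        intro d hd hw
        refine Setoid.symm' d (rel_of_adjacent hd (by simp only; omega) ?_ ?_)
        · rw [hw _ (show r ≤ i - 1 by omega), if_pos (by simp only; omega)]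
        · rw [hw _ hi, if_neg (by simp only; omega)]
      exact pair _ (by simp only [ne_eq, Fin.mk.injEq]; omega) (key hd hw) (key ht htw)

/-- The diagrams of rank `m` in `e_r A_k e_m`. -/
def sandwichDiagrams (A : Family) (k r m : ℕ) : Set (Diagram k) :=
  {d | d ∈ A.diagrams k ∧ rank d = m ∧ comp (tailDiagram A.width k r) d = d ∧
    comp d (tailDiagram A.width k m) = d}

/-- The right condition and the rank fix the bottom word, and the left condition fixes the tail of
the top word. Cutting that tail off leaves the word of a symmetric diagram. -/
theorem ncard_sandwichDiagrams (A : Family) {k r s m s' : ℕ} (h : r + A.width * s = k)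
    (h' : m + A.width * s' = k) :
    (A.symmetricDiagrams r m).ncard = (sandwichDiagrams A k r m).ncard := by
  have ht := tailDiagram_mem A h'
  rw [ncard_symmetricDiagrams, ← ncard_words_tail A h]
  have himg : {w : Fin k → SignType | IsWord A m w ∧ ∀ i : Fin k, r ≤ i →
      w i = tailSign A (i - r)} = topWord '' sandwichDiagrams A k r m := by
    ext w
    constructor
    · rintro ⟨hw, htail⟩
      have hwt := isWord_topWord ht
      rw [rank_tailDiagram A h'] at hwt
      obtain ⟨d, hd, rfl, hd₂⟩ := exists_diagram hw hwt
      refine ⟨d, ⟨hd, ?_, tailDiagram_comp_of_topWord h hd htail, ?_⟩, rfl⟩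
      · have := (isWord_topWord hd).total
        rw [hw.total] at this
        exact_mod_cast this.symm
      · have := tailDiagram_comp_of_topWord h' (flip_mem hd) fun i hi => by
          rw [hd₂, topWord_tailDiagram A h' hi]
        rw [← flip_flip d, ← flip_tailDiagram, comp_flip, this]
    · rintro ⟨d, ⟨hd, hr, h₁, -⟩, rfl⟩
      refine ⟨hr ▸ isWord_topWord hd, fun i hi => ?_⟩
      rw [← h₁]
      exact topWord_tailDiagram_comp A h d hi
  rw [himg, Set.InjOn.ncard_image]
  have hb : ∀ d ∈ sandwichDiagrams A k r m,
      topWord (flip d) = topWord (tailDiagram A.width k m) := by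
    rintro d ⟨hd, hr, -, h₂⟩
    have e : comp (tailDiagram A.width k m) (flip d) = flip d := by
      rw [← flip_tailDiagram, comp_flip, h₂]
    have := topWord_eq_of_rank h' (flip_mem hd) (by rw [e, rank_flip, hr])
    rwa [e] at this
  intro d hd d' hd' e
  exact diagram_ext hd.1 hd'.1 e ((hb d hd).trans (hb d' hd').symm)

/-! ## A faithful representation by colourings -/

/-- Indicator of the `n`-colourings of the top and bottom rows that are constant on blocks. -/
def colouring (n : ℕ) {k : ℕ} (d : Diagram k) : Matrix (Fin k → Fin n) (Fin k → Fin n) ℂ :=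
  open scoped Classical in fun f g => if d ≤ Setoid.ker (Sum.elim f g) then 1 else 0

/-- The colour of a component that meets the image of `q` is dictated by `F`, and every other
component is free. -/
theorem card_extensions_fin {X Y : Type} [Finite X] (n : ℕ) (J : Setoid X) (q : Y → X)
    (F : Y → Fin n) (hF : Setoid.comap q J ≤ Setoid.ker F) :
    Nat.card {G : X → Fin n // J ≤ Setoid.ker G ∧ G ∘ q = F} =
      n ^ Nat.card {c : Quotient J // ∀ y, Quotient.mk J (q y) ≠ c} := by
  classical
  let e : {G : X → Fin n // J ≤ Setoid.ker G ∧ G ∘ q = F} ≃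
      ({c : Quotient J // ∀ y, Quotient.mk J (q y) ≠ c} → Fin n) :=
    { toFun := fun G c => Quotient.lift G.1 (fun a b h => G.2.1 h) c.1
      invFun := fun u => ⟨fun x => if h : ∃ y, Quotient.mk J (q y) = Quotient.mk J x then
          F h.choose else u ⟨Quotient.mk J x, by simpa using h⟩, by
          constructor
          · intro x x' hx
            have hx' : Quotient.mk J x = Quotient.mk J x' := Quotient.sound hx
            simp only [Setoid.ker_def, hx']
          · funext y
            have h : ∃ y', Quotient.mk J (q y') = Quotient.mk J (q y) := ⟨y, rfl⟩
            simp only [Function.comp, dif_pos h]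
            have h' : J (q h.choose) (q y) := Quotient.exact h.choose_spec
            exact hF h'⟩
      left_inv := by
        rintro ⟨G, hG, hq⟩
        apply Subtype.ext
        funext x
        by_cases h : ∃ y, Quotient.mk J (q y) = Quotient.mk J x
        · simp only [dif_pos h]
          rw [← hq]
          exact hG (Quotient.exact h.choose_spec)
        · simp only [dif_neg h]
          rfl
      right_inv := by
        intro u
        funext ⟨c, hc⟩
        induction c using Quotient.inductionOn with
        | h x =>
          have h : ¬ ∃ y, Quotient.mk J (q y) = Quotient.mk J x := by simpa using hc
          simp only [Quotient.lift_mk, dif_neg h] }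
  rw [Nat.card_congr e, Nat.card_fun]
  simp

theorem stack_le_ker_iff {k : ℕ} {C : Type} (d₁ d₂ : Diagram k) (G : Fin k ⊕ Fin k ⊕ Fin k → C) :
    stack d₁ d₂ ≤ Setoid.ker G ↔
      d₁ ≤ Setoid.ker (G ∘ upper) ∧ d₂ ≤ Setoid.ker (G ∘ lower) := by
  constructor
  · intro h
    exact ⟨fun a b hab => h (FourRows.stack_upper d₂ hab),
      fun a b hab => h (FourRows.stack_lower d₁ hab)⟩
  · rintro ⟨h₁, h₂⟩ x y hxy
    induction hxy with
    | rel x y h =>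
      rcases h with ⟨a, b, hab, rfl, rfl⟩ | ⟨a, b, hab, rfl, rfl⟩
      · exact h₁ hab
      · exact h₂ hab
    | refl x => rfl
    | symm x y _ ih => exact ih.symm
    | trans x y z _ _ ih₁ ih₂ => exact ih₁.trans ih₂

/-- An entry of the product counts colourings of the middle row compatible with the outer ones; each
component inside the middle row is coloured freely and gives a factor `n`. -/
theorem colouring_mul {k : ℕ} (n : ℕ) (d₁ d₂ : Diagram k) :
    colouring n d₁ * colouring n d₂ = (n : ℂ) ^ loops d₁ d₂ • colouring n (comp d₁ d₂) := by
  classical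
  ext f g
  have h₁ : (colouring n d₁ * colouring n d₂) f g =
      Nat.card {h : Fin k → Fin n // d₁ ≤ Setoid.ker (Sum.elim f h) ∧
        d₂ ≤ Setoid.ker (Sum.elim h g)} := by
    rw [Nat.card_eq_fintype_card, Fintype.card_subtype, Finset.card_filter, Matrix.mul_apply,
      Nat.cast_sum]
    refine Finset.sum_congr rfl fun h _ => ?_
    simp only [colouring, ite_and]
    split_ifs <;> simp
  have hE : {h : Fin k → Fin n // d₁ ≤ Setoid.ker (Sum.elim f h) ∧
        d₂ ≤ Setoid.ker (Sum.elim h g)} ≃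
      {G : Fin k ⊕ Fin k ⊕ Fin k → Fin n // stack d₁ d₂ ≤ Setoid.ker G ∧
        G ∘ outer = Sum.elim f g} :=
    { toFun := fun h => ⟨Sum.elim f (Sum.elim h.1 g), by
        rw [stack_le_ker_iff]
        refine ⟨?_, by funext x; cases x <;> rfl⟩
        convert h.2 using 3
        · funext x; cases x <;> rfl
        · funext x; cases x <;> rfl⟩
      invFun := fun G => ⟨fun i => G.1 (.inr (.inl i)), by
        have h := (stack_le_ker_iff _ _ _).1 G.2.1
        have hf : ∀ x, G.1 (outer x) = Sum.elim f g x := fun x => congrFun G.2.2 x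
        convert h using 3
        · funext x
          cases x with
          | inl i => exact (hf (.inl i)).symm
          | inr i => rfl
        · funext x
          cases x with
          | inl i => rfl
          | inr i => exact (hf (.inr i)).symm⟩
      left_inv := fun h => rfl
      right_inv := by
        rintro ⟨G, hG, hq⟩
        apply Subtype.ext
        have hf : ∀ x, G (outer x) = Sum.elim f g x := fun x => congrFun hq x
        funext x
        rcases x with i | i | i
        · exact (hf (.inl i)).symm
        · rfl
        · exact (hf (.inr i)).symm }
  rw [h₁, Nat.card_congr hE]
  by_cases hF : comp d₁ d₂ ≤ Setoid.ker (Sum.elim f g)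
  · rw [card_extensions_fin _ _ _ _ hF]
    simp [colouring, hF, loops]
  · have : IsEmpty {G : Fin k ⊕ Fin k ⊕ Fin k → Fin n // stack d₁ d₂ ≤ Setoid.ker G ∧
        G ∘ outer = Sum.elim f g} := by
      refine ⟨fun G => hF ?_⟩
      rw [← G.2.2]
      intro x y hxy
      exact G.2.1 hxy
    simp [colouring, hF]

theorem colouring_id (n k : ℕ) : colouring n (idDiagram k) = 1 := by
  classical
  ext f g
  simp only [colouring, Matrix.one_apply]
  congr 1
  refine propext ⟨fun h => funext fun i => ?_, ?_⟩
  · exact h (show idDiagram k (.inl i) (.inr i) from rfl)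
  · rintro rfl x y hxy
    have hxy' : Sum.elim id id x = Sum.elim id id y := hxy
    simp only [Setoid.ker_def]
    cases x <;> cases y <;> simp_all

theorem colouring_flip (n : ℕ) {k : ℕ} (d : Diagram k) :
    colouring n (flip d) = (colouring n d).conjTranspose := by
  classical
  ext f g
  have h : flip d ≤ Setoid.ker (Sum.elim f g) ↔ d ≤ Setoid.ker (Sum.elim g f) := by
    constructor
    · intro h x y hxy
      have := h (show flip d x.swap y.swap by
        change d x.swap.swap y.swap.swap
        rwa [Sum.swap_swap, Sum.swap_swap])
      rcases x with x | x <;> rcases y with y | y <;> exact this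
    · intro h x y hxy
      have := h hxy
      rcases x with x | x <;> rcases y with y | y <;> exact this
  simp only [colouring, Matrix.conjTranspose_apply, h]
  split_ifs <;> simp

open PartitionAlgebra

/-- The representation of the partition algebra on the colourings with `n` colours. -/
def colourRep (k n : ℕ) : PartitionAlgebra k n →ₐ[ℂ] Matrix (Fin k → Fin n) (Fin k → Fin n) ℂ :=
  AlgHom.ofLinearMap (extend (colouring n)) ((extend_diag _ _).trans (colouring_id n k)) (by
    intro x y
    have h : (LinearMap.mul ℂ (PartitionAlgebra k n)).compr₂ (extend (colouring n)) =
        (LinearMap.mul ℂ _).compl₁₂ (extend (colouring n)) (extend (colouring n)) := by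
      refine hom_ext fun d₁ => hom_ext fun d₂ => ?_
      simp only [LinearMap.compr₂_apply, LinearMap.mul_apply', LinearMap.compl₁₂_apply,
        diag_mul_diag, map_smul, extend_diag, colouring_mul]
    exact congrArg (fun f => f x y) h)

theorem colourRep_diag {k : ℕ} (n : ℕ) (d : Diagram k) :
    colourRep k n (diag n d) = colouring n d := extend_diag _ _

instance (k : ℕ) : Finite (Diagram k) :=
  Finite.of_injective (fun d : Diagram k => fun x y => d x y) fun d d' h => by
    ext x y
    exact iff_of_eq (congrFun (congrFun h x) y)

instance (k n : ℕ) : FiniteDimensional ℂ (PartitionAlgebra k n) :=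
  inferInstanceAs (FiniteDimensional ℂ (Diagram k →₀ ℂ))

/-- Take `d` minimal in the support of a kernel element. As `n ≥ 2k`, some colouring `F` has the
blocks of `d` as its exact colour classes. The entry at `F` sees only diagrams refining `d`, hence
equals the coefficient of `d`. -/
theorem colourRep_injective {k n : ℕ} (h : 2 * k ≤ n) : Function.Injective (colourRep k n) := by
  classical
  rw [injective_iff_map_eq_zero]
  intro x hx
  by_contra hne
  have hx0 : (x : Diagram k →₀ ℂ) ≠ 0 := hne
  obtain ⟨d, hd⟩ := Finset.exists_minimal (Finsupp.support_nonempty_iff.2 hx0)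
  obtain ⟨F, hF⟩ : ∃ F : Fin k ⊕ Fin k → Fin n, Setoid.ker F = d := by
    have hc : Nat.card (Quotient d) ≤ n := by
      refine (Nat.card_le_card_of_surjective (Quotient.mk d) Quotient.mk_surjective).trans ?_
      simpa [two_mul] using h
    have : Nonempty (Quotient d ↪ Fin n) := by
      have := Fintype.ofFinite (Quotient d)
      refine Function.Embedding.nonempty_of_card_le ?_
      rwa [Fintype.card_fin, ← Nat.card_eq_fintype_card]
    obtain ⟨φ⟩ := this
    refine ⟨fun x => φ (Quotient.mk d x), Setoid.ext fun x y => ?_⟩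
    rw [Setoid.ker_def, φ.injective.eq_iff]
    exact Quotient.eq
  have hval : ∀ y : Diagram k →₀ ℂ, Minimal (· ∈ y.support) d →
      (y.sum fun d' c => c • colouring n d') (F ∘ Sum.inl) (F ∘ Sum.inr) = y d := by
    intro y hd
    rw [Finsupp.sum, Matrix.sum_apply, Finset.sum_eq_single d]
    · simp [colouring, hF]
    · intro d' hd' hdd'
      have : ¬ d' ≤ d := fun hle => hdd' (le_antisymm hle (hd.2 hd' hle))
      simp [colouring, hF, this]
    · intro h'
      exact absurd hd.1 h'
  have h0 := hval x hd
  rw [show (Finsupp.sum x fun d' c => c • colouring n d') = 0 from hx] at h0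
  exact Finsupp.mem_support_iff.1 hd.1 h0.symm

/-! ## Spans of diagrams -/

/-- The span of a set of diagrams. -/
def diagSpan (n : ℕ) {k : ℕ} (D : Set (Diagram k)) : Submodule ℂ (PartitionAlgebra k n) :=
  Submodule.span ℂ (diag n '' D)

theorem diag_mem_diagSpan (n : ℕ) {k : ℕ} {D : Set (Diagram k)} {d : Diagram k} (h : d ∈ D) :
    diag n d ∈ diagSpan n D := Submodule.subset_span (Set.mem_image_of_mem _ h)

theorem mul_mem_diagSpan {n k : ℕ} {D₁ D₂ D : Set (Diagram k)}
    (h : ∀ d₁ ∈ D₁, ∀ d₂ ∈ D₂, comp d₁ d₂ ∈ D) {x y : PartitionAlgebra k n}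
    (hx : x ∈ diagSpan n D₁) (hy : y ∈ diagSpan n D₂) : x * y ∈ diagSpan n D := by
  have hle : diagSpan n D₁ * diagSpan n D₂ ≤ diagSpan n D := by
    rw [diagSpan, diagSpan, Submodule.span_mul_span, Submodule.span_le]
    rintro _ ⟨_, ⟨d₁, h₁, rfl⟩, _, ⟨d₂, h₂, rfl⟩, rfl⟩
    simp only [diag_mul_diag]
    exact Submodule.smul_mem _ _ (diag_mem_diagSpan n (h d₁ h₁ d₂ h₂))
  exact hle (Submodule.mul_mem_mul hx hy)

theorem exists_star {n k : ℕ} {D : Set (Diagram k)} (h : ∀ d ∈ D, flip d ∈ D)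
    {x : PartitionAlgebra k n} (hx : x ∈ diagSpan n D) :
    ∃ y ∈ diagSpan n D, colourRep k n y = (colourRep k n x).conjTranspose := by
  induction hx using Submodule.span_induction with
  | mem x hx =>
    obtain ⟨d, hd, rfl⟩ := hx
    exact ⟨diag n (flip d), diag_mem_diagSpan n (h d hd), by
      rw [colourRep_diag, colourRep_diag, colouring_flip]⟩
  | zero => exact ⟨0, Submodule.zero_mem _, by simp⟩
  | add x y _ _ hx hy =>
    obtain ⟨x', hx', ex⟩ := hx
    obtain ⟨y', hy', ey⟩ := hy
    exact ⟨x' + y', Submodule.add_mem _ hx' hy', by simp [ex, ey]⟩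
  | smul c x _ hx =>
    obtain ⟨x', hx', ex⟩ := hx
    exact ⟨star c • x', Submodule.smul_mem _ _ hx', by simp [ex, Matrix.conjTranspose_smul]⟩

theorem idDiagram_mem (A : Family) (k : ℕ) : idDiagram k ∈ A.diagrams k := by
  have : idDiagram k = tailDiagram A.width k k := by
    ext x y
    rw [tailDiagram_iff, idDiagram, Setoid.ker_def]
    rcases x with x | x <;> rcases y with y | y <;> simp [tailLabel, Fin.ext_iff]
  rw [this]
  exact tailDiagram_mem A (s := 0) (by simp)

theorem mem_algebra_iff {A : Family} {k n : ℕ} {x : PartitionAlgebra k n} :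
    x ∈ A.algebra k n ↔ x ∈ diagSpan n (A.diagrams k) := by
  rw [Family.algebra, ← Subalgebra.mem_toSubmodule, Algebra.adjoin_eq_span_of_subset]
  · rfl
  · intro x hx
    change x ∈ diagSpan n (A.diagrams k)
    induction hx using Submonoid.closure_induction with
    | mem x hx => exact Submodule.subset_span hx
    | one => exact diag_mem_diagSpan n (idDiagram_mem A k)
    | mul x y _ _ hx hy => exact mul_mem_diagSpan (fun _ h₁ _ h₂ => comp_mem h₁ h₂) hx hy

/-- A diagram as an element of the algebra. -/
def algDiag {A : Family} {k : ℕ} (n : ℕ) {d : Diagram k} (hd : d ∈ A.diagrams k) :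
    A.algebra k n := ⟨diag n d, mem_algebra_iff.2 (diag_mem_diagSpan n hd)⟩

/-- The diagrams of rank less than `m`. -/
def lowDiagrams (A : Family) (k m : ℕ) : Set (Diagram k) := {d | d ∈ A.diagrams k ∧ rank d < m}

/-- Multiplying on the left cannot raise the rank, so the complex span of the low diagrams is
already a left ideal. -/
theorem mem_lowerIdeal_iff {A : Family} {k n m : ℕ} {x : A.algebra k n} :
    x ∈ A.lowerIdeal k n m ↔ (x : PartitionAlgebra k n) ∈ diagSpan n (lowDiagrams A k m) := by
  constructor
  · intro hx
    induction hx using Submodule.span_induction with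
    | mem x hx =>
      obtain ⟨d, hd, hr, e⟩ := hx
      rw [e]
      exact diag_mem_diagSpan n ⟨hd, hr⟩
    | zero => exact Submodule.zero_mem _
    | add x y _ _ hx hy => exact Submodule.add_mem _ hx hy
    | smul a x _ hx =>
      exact mul_mem_diagSpan (D := lowDiagrams A k m) (fun _ h₁ _ h₂ => ⟨comp_mem h₁ h₂.1,
        (rank_comp_le_right h₁ h₂.1).trans_lt h₂.2⟩) (mem_algebra_iff.1 a.2) hx
  · intro hx
    have hle : diagSpan n (lowDiagrams A k m) ≤
        ((A.lowerIdeal k n m).restrictScalars ℂ).map (A.algebra k n).val.toLinearMap := by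
      refine Submodule.span_le.2 ?_
      rintro _ ⟨d, hd, rfl⟩
      have hmem : algDiag n hd.1 ∈ A.lowerIdeal k n m := by
        unfold Family.lowerIdeal
        exact Submodule.subset_span ⟨d, hd.1, hd.2, rfl⟩
      exact ⟨algDiag n hd.1, hmem, rfl⟩
    obtain ⟨y, hy, e⟩ := hle hx
    rwa [← Subtype.ext e]

/-! ## Simplicity from a faithful representation closed under adjoints -/

-- Put `a = x' * x`, which `ρ` makes Hermitian. Then `a` and `a²` have the same kernel as left
-- multiplications, hence the same range by dimension, so `a = a * (a * b)` for some `b`. Positivity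
-- upgrades this to `x = x * (a * b)`, which lies in `J` because `J` is two-sided.
open scoped Matrix ComplexOrder in
theorem mem_of_star_mul_mem {R ι : Type*} [Ring R] [Algebra ℂ R] [FiniteDimensional ℂ R]
    [Fintype ι] [DecidableEq ι] {ρ : R →ₐ[ℂ] Matrix ι ι ℂ} (hρ : Function.Injective ρ)
    {J : Submodule R R} (hJ : ∀ x ∈ J, ∀ y, x * y ∈ J) {x x' : R} (hx : ρ x' = (ρ x)ᴴ)
    (h : x' * x ∈ J) : x ∈ J := by
  set a := x' * x with ha
  have hH : ρ a = (ρ x)ᴴ * ρ x := by rw [ha, map_mul, hx]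
  have hH' : (ρ a)ᴴ = ρ a := by rw [hH, Matrix.conjTranspose_mul, Matrix.conjTranspose_conjTranspose]
  let L : R →ₗ[ℂ] R := LinearMap.mulLeft ℂ a
  have hker : LinearMap.ker (L ∘ₗ L) = LinearMap.ker L := by
    refine le_antisymm (fun y hy => ?_) (LinearMap.ker_le_ker_comp L L)
    have hy' : a * (a * y) = 0 := hy
    have h0 : (ρ (a * y))ᴴ * ρ (a * y) = 0 := by
      rw [map_mul, Matrix.conjTranspose_mul, hH', Matrix.mul_assoc, ← map_mul, ← map_mul, hy',
        map_zero, Matrix.mul_zero]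
    rw [Matrix.conjTranspose_mul_self_eq_zero] at h0
    exact hρ (h0.trans (map_zero ρ).symm)
  have hrange : LinearMap.range (L ∘ₗ L) = LinearMap.range L := by
    refine Submodule.eq_of_le_of_finrank_eq (LinearMap.range_comp_le_range L L) ?_
    have h₁ := LinearMap.finrank_range_add_finrank_ker L
    have h₂ := LinearMap.finrank_range_add_finrank_ker (L ∘ₗ L)
    rw [hker] at h₂
    omega
  obtain ⟨b, hb⟩ : a ∈ LinearMap.range (L ∘ₗ L) := by
    rw [hrange]
    exact ⟨1, mul_one a⟩
  have hb' : a * (a * b) = a := hb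
  -- The element is `x (1 - ab)`, and its adjoint times itself is `(1 - ab)^* (a - a (ab)) = 0`.
  have hz : ρ (x - x * (a * b)) = 0 := by
    have e : ρ (x - x * (a * b)) = ρ x * (1 - ρ (a * b)) := by
      rw [map_sub, map_mul, mul_sub, mul_one]
    rw [← Matrix.conjTranspose_mul_self_eq_zero, e, Matrix.conjTranspose_mul, Matrix.mul_assoc,
      ← Matrix.mul_assoc _ (ρ x), ← hH, mul_sub, mul_one, ← map_mul, hb', sub_self, Matrix.mul_zero]
  have hxe : x = x * (a * b) := sub_eq_zero.1 (hρ (hz.trans (map_zero ρ).symm))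
  rw [hxe]
  exact J.smul_mem x (hJ a h b)

/-- By `h₂` a nonzero vector `a e` can be moved to a nonzero element of the corner `e R e`, which by
`h₁` is a scalar multiple of `e` modulo `J`; and `e` generates the module. -/
theorem isSimpleModule_map_mkQ {R : Type*} [Ring R] [Algebra ℂ R] {J : Submodule R R} {e : R}
    (he : e ∉ J) (h₁ : ∀ a, ∃ c : ℂ, e * a * e - c • e ∈ J)
    (h₂ : ∀ a, a * e ∉ J → ∃ z, e * z * (a * e) ∉ J) :
    IsSimpleModule R (Submodule.map J.mkQ (Submodule.span R {e})) := by
  rw [isSimpleModule_iff_toSpanSingleton_surjective]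
  have hmem : J.mkQ e ∈ Submodule.map J.mkQ (Submodule.span R {e}) :=
    Submodule.mem_map_of_mem (Submodule.mem_span_singleton_self e)
  refine ⟨⟨⟨⟨J.mkQ e, hmem⟩, 0, fun h => he ?_⟩⟩, ?_⟩
  · exact (Submodule.Quotient.mk_eq_zero J).1 (congrArg Subtype.val h)
  · rintro ⟨v, hv⟩ hne ⟨w, hw⟩
    obtain ⟨_, hx, rfl⟩ := hv
    obtain ⟨_, hy, rfl⟩ := hw
    obtain ⟨a, rfl⟩ := Submodule.mem_span_singleton.1 hx
    obtain ⟨b, rfl⟩ := Submodule.mem_span_singleton.1 hy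
    have ha : a * e ∉ J := fun h => hne (Subtype.ext ((Submodule.Quotient.mk_eq_zero J).2 h))
    obtain ⟨z, hz⟩ := h₂ a ha
    obtain ⟨c, hc⟩ := h₁ (z * a)
    have e₁ : e * (z * a) * e = e * z * (a * e) := by simp only [mul_assoc]
    have hc0 : c ≠ 0 := by
      rintro rfl
      rw [zero_smul, sub_zero, e₁] at hc
      exact hz hc
    -- `e * z` sends `a e` to `c e`; dividing by `c` and applying `b` reaches `b e`.
    refine ⟨c⁻¹ • (b * (e * z)), Subtype.ext ?_⟩
    change (c⁻¹ • (b * (e * z))) • J.mkQ (a • e) = J.mkQ (b • e)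
    rw [← map_smul, ← sub_eq_zero, ← map_sub]
    refine (Submodule.Quotient.mk_eq_zero J).2 ?_
    have e₂ : (c⁻¹ • (b * (e * z))) • a • e - b • e =
        (c⁻¹ • b) * (e * (z * a) * e - c • e) := by
      simp only [smul_eq_mul, mul_sub, smul_mul_assoc, mul_smul_comm, smul_smul, mul_assoc,
        mul_inv_cancel₀ hc0, one_smul]
    rw [e₂]
    exact J.smul_mem _ hc

theorem trace_lsmul_of_isIdempotentElem {R V : Type*} [Ring R] [Algebra ℂ R] [AddCommGroup V]
    [Module R V] [Module ℂ V] [IsScalarTower ℂ R V] [SMulCommClass R ℂ V] [FiniteDimensional ℂ V]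
    {x : R} (hx : x * x = x) :
    LinearMap.trace ℂ V (Algebra.lsmul ℂ ℂ V x) =
      Module.finrank ℂ (LinearMap.range (Algebra.lsmul ℂ ℂ V x)) := by
  have h : IsIdempotentElem (Algebra.lsmul ℂ ℂ V x) := by
    rw [IsIdempotentElem, ← map_mul, hx]
  exact (LinearMap.IsIdempotentElem.isProj_range _ h).trace

/-! ## The irreducible modules -/

theorem linearIndependent_diag (k n : ℕ) :
    LinearIndependent ℂ (diag n : Diagram k → PartitionAlgebra k n) :=
  (Finsupp.basisSingleOne (R := ℂ) (ι := Diagram k)).linearIndependent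

theorem diag_mem_diagSpan_iff {k n : ℕ} {D : Set (Diagram k)} {d : Diagram k} :
    diag n d ∈ diagSpan n D ↔ d ∈ D := by
  refine ⟨fun h => ?_, diag_mem_diagSpan n⟩
  by_contra hd
  exact (linearIndependent_diag k n).notMem_span_image hd h

variable {A : Family} {k n : ℕ}

theorem coe_tailElement {r s : ℕ} (h : r + A.width * s = k) :
    (A.tailElement n h : PartitionAlgebra k n) =
      ((n : ℂ)⁻¹) ^ s • diag n (tailDiagram A.width k r) := rfl

theorem tailElement_mul_self (hn : 1 ≤ n) {r s : ℕ} (h : r + A.width * s = k) :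
    A.tailElement n h * A.tailElement n h = A.tailElement n h := by
  have hn0 : (n : ℂ) ≠ 0 := by exact_mod_cast (Nat.one_le_iff_ne_zero.1 hn)
  refine Subtype.ext ?_
  rw [Subalgebra.coe_mul, coe_tailElement, smul_mul_smul_comm, diag_mul_diag,
    loops_tailDiagram A h, tailDiagram_comp_self, smul_smul, mul_assoc, ← mul_pow,
    inv_mul_cancel₀ hn0, one_pow, mul_one]

theorem diag_mul_diag_mul_diag (n : ℕ) (d₁ d₂ d₃ : Diagram k) : ∃ c : ℂ,
    diag n d₁ * diag n d₂ * diag n d₃ = c • diag n (comp d₁ (comp d₂ d₃)) :=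
  ⟨_, by rw [mul_assoc, diag_mul_diag, mul_smul_comm, diag_mul_diag, smul_smul]⟩

theorem tailElement_notMem (hn : 1 ≤ n) {m s : ℕ} (h : m + A.width * s = k) :
    A.tailElement n h ∉ A.lowerIdeal k n m := by
  have hn0 : (n : ℂ) ≠ 0 := by exact_mod_cast (Nat.one_le_iff_ne_zero.1 hn)
  intro hmem
  rw [mem_lowerIdeal_iff, coe_tailElement,
    Submodule.smul_mem_iff _ (pow_ne_zero _ (inv_ne_zero hn0)), diag_mem_diagSpan_iff] at hmem
  have := hmem.2
  rw [rank_tailDiagram A h] at this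
  exact lt_irrefl _ this

/-- For a diagram the sandwich has rank at most `m`: below `m` it lies in the ideal, and at `m` it
is the tail diagram itself by `sandwich_eq`. -/
theorem tailElement_sandwich (hn : 1 ≤ n) {m s : ℕ} (h : m + A.width * s = k)
    (a : A.algebra k n) : ∃ c : ℂ, A.tailElement n h * a * A.tailElement n h -
      c • A.tailElement n h ∈ A.lowerIdeal k n m := by
  have hn0 : (n : ℂ) ≠ 0 := by exact_mod_cast (Nat.one_le_iff_ne_zero.1 hn)
  simp only [mem_lowerIdeal_iff]
  change ∃ c : ℂ, (A.tailElement n h : PartitionAlgebra k n) * a * A.tailElement n h -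
      c • (A.tailElement n h : PartitionAlgebra k n) ∈ _
  have ha := mem_algebra_iff.1 a.2
  generalize (a : PartitionAlgebra k n) = x at ha
  rw [coe_tailElement]
  have hβ : ((n : ℂ)⁻¹) ^ s ≠ 0 := pow_ne_zero _ (inv_ne_zero hn0)
  generalize ((n : ℂ)⁻¹) ^ s = β at hβ
  have ht := tailDiagram_mem A h
  induction ha using Submodule.span_induction with
  | mem x hx =>
    obtain ⟨d, hd, rfl⟩ := hx
    obtain ⟨c, hc⟩ := diag_mul_diag_mul_diag n (tailDiagram A.width k m) d
      (tailDiagram A.width k m)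
    have e : β • diag n (tailDiagram A.width k m) * diag n d * β • diag n (tailDiagram A.width k m)
        = (β * β * c) • diag n (comp (tailDiagram A.width k m)
          (comp d (tailDiagram A.width k m))) := by
      rw [smul_mul_assoc, smul_mul_assoc, mul_smul_comm, hc, smul_smul, smul_smul, mul_assoc]
    rw [e]
    have hle := rank_comp_le_left ht (comp_mem hd ht)
    rw [rank_tailDiagram A h] at hle
    rcases hle.lt_or_eq with hlt | heq
    · refine ⟨0, ?_⟩
      rw [zero_smul, sub_zero]
      exact Submodule.smul_mem _ _ (diag_mem_diagSpan n ⟨comp_mem ht (comp_mem hd ht), hlt⟩)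
    · refine ⟨β * c, ?_⟩
      rw [sandwich_eq h hd heq, smul_smul, mul_right_comm, mul_comm (β * c) β, ← mul_assoc,
        mul_right_comm, sub_self]
      exact Submodule.zero_mem _
  | zero => exact ⟨0, by simp⟩
  | add x y _ _ hx hy =>
    obtain ⟨c, hc⟩ := hx
    obtain ⟨c', hc'⟩ := hy
    refine ⟨c + c', ?_⟩
    have := Submodule.add_mem _ hc hc'
    rwa [sub_add_sub_comm, ← add_mul, ← mul_add, ← add_smul] at this
  | smul b x _ hx =>
    obtain ⟨c, hc⟩ := hx
    refine ⟨b * c, ?_⟩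
    have := Submodule.smul_mem _ b hc
    rwa [smul_sub, smul_smul, ← smul_mul_assoc, ← mul_smul_comm] at this

/-- The element `z` is the adjoint of `a`. As the idempotent is self-adjoint, `e z (a e)` is the
adjoint of `a e` times `a e`, and `mem_of_star_mul_mem` applies. -/
theorem isSimpleModule_irreducibleModule (hn : 1 ≤ n) (hkn : 2 * k ≤ n) {m : ℕ}
    (h : m ∈ A.ranks k) : IsSimpleModule (A.algebra k n) (A.irreducibleModule n h) := by
  have hs := Family.ranks_spec h
  refine isSimpleModule_map_mkQ (tailElement_notMem hn hs) (tailElement_sandwich hn hs) ?_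
  intro a ha
  obtain ⟨y, hy, hya⟩ := exists_star (fun d hd => flip_mem hd) (mem_algebra_iff.1 a.2)
  refine ⟨⟨y, mem_algebra_iff.2 hy⟩, fun hmem => ha ?_⟩
  refine mem_of_star_mul_mem (ρ := (colourRep k n).comp (A.algebra k n).val)
    ((colourRep_injective hkn).comp Subtype.val_injective) (fun x hx y => ?_) ?_ hmem
  · rw [mem_lowerIdeal_iff] at hx ⊢
    exact mul_mem_diagSpan (D := lowDiagrams A k m) (fun _ h₁ _ h₂ => ⟨comp_mem h₁.1 h₂,
      (rank_comp_le_left h₁.1 h₂).trans_lt h₁.2⟩) hx (mem_algebra_iff.1 y.2)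
  · have he : (colourRep k n (A.tailElement n hs)).conjTranspose =
        colourRep k n (A.tailElement n hs) := by
      rw [coe_tailElement, map_smul, colourRep_diag, Matrix.conjTranspose_smul, ← colouring_flip,
        flip_tailDiagram]
      simp
    change colourRep k n (A.tailElement n hs * y) =
      (colourRep k n (a * A.tailElement n hs)).conjTranspose
    rw [map_mul, map_mul, Matrix.conjTranspose_mul, he, hya]

/-! ### The range of an idempotent and its trace -/

/-- The image of a diagram in the quotient by the diagrams of lower rank. -/
def quotDiag {m r : ℕ} (n : ℕ) (d : sandwichDiagrams A k r m) :
    A.algebra k n ⧸ A.lowerIdeal k n m := (A.lowerIdeal k n m).mkQ (algDiag n d.2.1)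

/-- Diagrams of rank exactly `m` span a subspace that meets the span of those of lower rank
trivially. -/
theorem linearIndependent_quotDiag (m r : ℕ) :
    LinearIndependent ℂ (quotDiag n : sandwichDiagrams A k r m → _) := by
  have hP : LinearIndependent ℂ fun d : sandwichDiagrams A k r m => diag n d.1 :=
    (linearIndependent_diag k n).comp _ Subtype.val_injective
  have hA : LinearIndependent ℂ fun d : sandwichDiagrams A k r m =>
      (algDiag n d.2.1 : A.algebra k n) :=
    LinearIndependent.of_comp (A.algebra k n).val.toLinearMap hP
  refine hA.map (f := (A.lowerIdeal k n m).mkQ.restrictScalars ℂ) ?_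
  rw [Submodule.disjoint_def]
  intro x hx hker
  have hJ : x ∈ A.lowerIdeal k n m := (Submodule.Quotient.mk_eq_zero _).1 hker
  rw [mem_lowerIdeal_iff] at hJ
  have hx' : (x : PartitionAlgebra k n) ∈ diagSpan n (sandwichDiagrams A k r m) := by
    have := Submodule.mem_map_of_mem (f := (A.algebra k n).val.toLinearMap) hx
    rw [Submodule.map_span] at this
    refine Submodule.span_mono ?_ this
    rintro _ ⟨_, ⟨d, rfl⟩, rfl⟩
    exact ⟨d.1, d.2, rfl⟩
  have hdisj : Disjoint (sandwichDiagrams A k r m) (lowDiagrams A k m) := by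
    rw [Set.disjoint_left]
    rintro d ⟨-, hr, -⟩ ⟨-, hr'⟩
    omega
  exact Subtype.ext (Submodule.disjoint_def.1
    ((linearIndependent_diag k n).disjoint_span_image hdisj) _ hx' hJ)

instance (m : ℕ) (V : Submodule (A.algebra k n) (A.algebra k n ⧸ A.lowerIdeal k n m)) :
    FiniteDimensional ℂ V :=
  FiniteDimensional.of_injective (V.subtype.restrictScalars ℂ) Subtype.val_injective

/-- A product `t_r d t_m` either drops in rank and dies in the quotient, or is a multiple of a
sandwich diagram. Conversely the two idempotents fix every sandwich diagram up to a nonzero scalar.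
-/
theorem map_range_tailElement (hn : 1 ≤ n) {m r s : ℕ} (h : m ∈ A.ranks k)
    (hrs : r + A.width * s = k) :
    (LinearMap.range (Algebra.lsmul ℂ ℂ (A.irreducibleModule n h) (A.tailElement n hrs))).map
      ((A.irreducibleModule n h).subtype.restrictScalars ℂ) =
    Submodule.span ℂ (Set.range (quotDiag n : sandwichDiagrams A k r m → _)) := by
  have hn0 : (n : ℂ) ≠ 0 := by exact_mod_cast (Nat.one_le_iff_ne_zero.1 hn)
  have hm := Family.ranks_spec h
  have htr := tailDiagram_mem A hrs
  have htm := tailDiagram_mem A hm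
  have er : A.tailElement n hrs = ((n : ℂ)⁻¹) ^ s • algDiag n htr := rfl
  have em : A.idempotent n h = ((n : ℂ)⁻¹) ^ ((k - m) / A.width) • algDiag n htm := rfl
  refine le_antisymm ?_ ?_
  · rintro _ ⟨_, ⟨⟨_, x, hx, rfl⟩, rfl⟩, rfl⟩
    obtain ⟨a, rfl⟩ := Submodule.mem_span_singleton.1 hx
    change A.tailElement n hrs • (A.lowerIdeal k n m).mkQ (a • A.idempotent n h) ∈ _
    have key : ∀ x ∈ diagSpan n (A.diagrams k), ∀ hx : x ∈ A.algebra k n,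
        (A.lowerIdeal k n m).mkQ (algDiag n htr * ⟨x, hx⟩ * algDiag n htm) ∈
          Submodule.span ℂ (Set.range (quotDiag n : sandwichDiagrams A k r m → _)) := by
      intro x hx
      induction hx using Submodule.span_induction with
      | mem x hx =>
        obtain ⟨d, hd, rfl⟩ := hx
        intro hx
        obtain ⟨c, hc⟩ := diag_mul_diag_mul_diag n (tailDiagram A.width k r) d
          (tailDiagram A.width k m)
        have hmem := comp_mem htr (comp_mem hd htm)
        have e : algDiag n htr * ⟨diag n d, hx⟩ * algDiag n htm = c • algDiag n hmem :=
          Subtype.ext hc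
        rw [e, LinearMap.map_smul_of_tower]
        refine Submodule.smul_mem _ _ ?_
        have hle := rank_comp_le_right (comp_mem htr hd) htm
        rw [comp_assoc, rank_tailDiagram A hm] at hle
        rcases hle.lt_or_eq with hlt | heq
        · have h0 : (A.lowerIdeal k n m).mkQ (algDiag n hmem) = 0 :=
            (Submodule.Quotient.mk_eq_zero _).2
              (mem_lowerIdeal_iff.2 (diag_mem_diagSpan n ⟨hmem, hlt⟩))
          rw [h0]
          exact Submodule.zero_mem _
        · refine Submodule.subset_span ⟨⟨_, hmem, heq, ?_, ?_⟩, rfl⟩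
          · rw [← comp_assoc, tailDiagram_comp_self]
          · rw [comp_assoc, comp_assoc, tailDiagram_comp_self]
      | zero =>
        intro hx
        have e : algDiag n htr * ⟨0, hx⟩ * algDiag n htm = 0 := Subtype.ext (by simp)
        rw [e, map_zero]
        exact Submodule.zero_mem _
      | add x y hx hy ihx ihy =>
        intro hxy
        have hx := mem_algebra_iff.2 hx
        have hy := mem_algebra_iff.2 hy
        have e : algDiag n htr * ⟨x + y, hxy⟩ * algDiag n htm =
            algDiag n htr * ⟨x, hx⟩ * algDiag n htm + algDiag n htr * ⟨y, hy⟩ * algDiag n htm := by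
          rw [← add_mul, ← mul_add]
          rfl
        rw [e, map_add]
        exact Submodule.add_mem _ (ihx hx) (ihy hy)
      | smul c x hx ihx =>
        intro hcx
        have hx := mem_algebra_iff.2 hx
        have e : algDiag n htr * ⟨c • x, hcx⟩ * algDiag n htm =
            c • (algDiag n htr * ⟨x, hx⟩ * algDiag n htm) := by
          rw [← smul_mul_assoc, ← mul_smul_comm]
          rfl
        rw [e, LinearMap.map_smul_of_tower]
        exact Submodule.smul_mem _ _ (ihx hx)
    rw [← map_smul, er, em, smul_eq_mul, smul_eq_mul, mul_smul_comm, smul_mul_smul_comm,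
      LinearMap.map_smul_of_tower, ← mul_assoc]
    exact Submodule.smul_mem _ _ (key a (mem_algebra_iff.1 a.2) a.2)
  · rw [Submodule.span_le]
    rintro _ ⟨⟨d, hd, hr, h₁, h₂⟩, rfl⟩
    have e₁ : algDiag n htr * algDiag n hd =
        (n : ℂ) ^ loops (tailDiagram A.width k r) d • algDiag n hd :=
      Subtype.ext ((diag_mul_diag _ _).trans (by rw [h₁]; rfl))
    have e₂ : algDiag n hd * algDiag n htm =
        (n : ℂ) ^ loops d (tailDiagram A.width k m) • algDiag n hd :=
      Subtype.ext ((diag_mul_diag _ _).trans (by rw [h₂]; rfl))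
    -- `β` is a product of powers of `n` and of its inverse.
    obtain ⟨β, hβ, e₃⟩ : ∃ β : ℂ, β ≠ 0 ∧
        A.tailElement n hrs * algDiag n hd * A.idempotent n h = β • algDiag n hd := by
      refine ⟨_, ?_, by rw [er, em, smul_mul_assoc, e₁, smul_mul_smul_comm, smul_mul_assoc, e₂,
        smul_smul, smul_smul]⟩
      simp [hn0]
    refine ⟨_, ⟨⟨(A.lowerIdeal k n m).mkQ ((β⁻¹ • algDiag n hd) • A.idempotent n h),
      Submodule.mem_map_of_mem (Submodule.smul_mem _ _ (Submodule.mem_span_singleton_self _))⟩,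
      rfl⟩, ?_⟩
    change A.tailElement n hrs •
      (A.lowerIdeal k n m).mkQ ((β⁻¹ • algDiag n hd) • A.idempotent n h) =
      (A.lowerIdeal k n m).mkQ (algDiag n hd)
    rw [← map_smul, smul_eq_mul, smul_eq_mul, smul_mul_assoc, mul_smul_comm, ← mul_assoc, e₃,
      smul_smul, inv_mul_cancel₀ hβ, one_smul]

/-- The trace of an idempotent is the dimension of its range, and here a basis of the range is
indexed by the sandwich diagrams. -/
theorem trace_tailElement (hn : 1 ≤ n) {m r s : ℕ} (h : m ∈ A.ranks k)
    (hrs : r + A.width * s = k) :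
    LinearMap.trace ℂ (A.irreducibleModule n h)
      (Algebra.lsmul ℂ ℂ (A.irreducibleModule n h) (A.tailElement n hrs)) =
    ((A.symmetricDiagrams r m).ncard : ℂ) := by
  have := Fintype.ofFinite (sandwichDiagrams A k r m)
  rw [trace_lsmul_of_isIdempotentElem (tailElement_mul_self hn hrs),
    ncard_sandwichDiagrams A hrs (Family.ranks_spec h),
    (Submodule.equivMapOfInjective ((A.irreducibleModule n h).subtype.restrictScalars ℂ)
      Subtype.val_injective _).finrank_eq, map_range_tailElement hn h hrs,
    finrank_span_eq_card (linearIndependent_quotDiag (A := A) (k := k) (n := n) m r), ← Nat.card_eq_fintype_card]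
  rfl

end PlanarDiagram

end

/-! ### The main theorem -/

theorem mainTheorem10 (A : PlanarDiagram.Family) (k n : ℕ) (hn : 1 ≤ n) (hkn : 2 * k ≤ n)
    (lam : n.Partition) (hlam : lam ∈ A.indexSet k n) (m : ℕ)
    (hm : PlanarDiagram.starSize lam = m) (r s : ℕ) (hrs : r + A.width * s = k) :
    IsSimpleModule (A.algebra k n) (A.irrep hlam) ∧
    A.character hlam (A.tailElement n hrs) = ((A.symmetricDiagrams r m).ncard : ℂ) ∧
    (A = .temperleyLieb → ((A.symmetricDiagrams r m).ncard : ℤ) =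
      PlanarDiagram.binom r (((r : ℤ) - m) / 2) -
        PlanarDiagram.binom r (((r : ℤ) - m) / 2 - 1)) ∧
    (A = .motzkin → ((A.symmetricDiagrams r m).ncard : ℤ) =
      ∑ t ∈ Finset.range (r + 1), PlanarDiagram.binom r (m + 2 * t) *
        (PlanarDiagram.binom (m + 2 * t) t - PlanarDiagram.binom (m + 2 * t) (t - 1))) ∧
    (A = .planarRook → ((A.symmetricDiagrams r m).ncard : ℤ) = PlanarDiagram.binom r m) := by
  subst hm
  refine ⟨PlanarDiagram.isSimpleModule_irreducibleModule hn hkn hlam.2,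
    PlanarDiagram.trace_tailElement hn hlam.2 hrs, ?_, ?_, ?_⟩
  all_goals
    rintro rfl
    rw [PlanarDiagram.ncard_symmetricDiagrams, PlanarDiagram.ncard_words]
  · obtain ⟨s', hs'⟩ := hlam.2
    simp only [PlanarDiagram.Family.width] at hrs hs'
    -- Both `r` and `m` have the parity of `k`, so the integer division by `2` is exact, also when
    -- `m > r`.
    have hj : (PlanarDiagram.starSize lam : ℤ) =
        r - 2 * (((r : ℤ) - PlanarDiagram.starSize lam) / 2) := by omega
    have h := PlanarDiagram.wordCount_temperleyLieb r
      (((r : ℤ) - PlanarDiagram.starSize lam) / 2) (by omega)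
    rwa [← hj] at h
  · exact PlanarDiagram.wordCount_motzkin r _
  · exact PlanarDiagram.wordCount_planarRook r _
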